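/- **Setting.** Let $\mathbb P(\mathbb R^d)$ be real projective space. A subset is *convex* (resp. *properly convex*) if it is a convex (resp. bounded convex) subset of some affine chart; a *properly convex domain* is an open properly convex set. For a properly convex set $C$, $\mathrm{relint}(C)$ is the interior of $C$ in $\mathbb P(\mathrm{Span}\,C)$, $\partial C=\overline C\setminus \mathrm{relint}(C)$, $\partial_i C=\partial C\setminus C$, and (for $C \neq\emptyset$ convex) $\dim C=\dim\mathbb P(\mathrm{Span}\,C)$. If $\Omega$ is properly convex and open in its span (that is, $\Omega=\mathrm{relint}(\Omega)$), its *Hilbert metric* is $d_\Omega(x,x)=0$ and, for $x\ne y$, $$d_\Omega(x,y)=\tfrac12\log\frac{|x-b|\,|y-a|}{|x-a|\,|y-b|},$$ where $a,b$ are the two points of $\partial\Omega$ on the projective line through $x,y$, in the order $a,x,y,b$ (the cross ratio being computed in an affine chart containing the four points). The *coarse dimension* $\mathrm{cdim}_\Omega(A)$ of a non-empty $A\subset\Omega$ is the smallest integer $k\ge0$ such that there are $R>0$ and a $k$-dimensional convex subset $B\subset\Omega$ with $A\subset\{p\in\Omega: d_\Omega(p,B)<R\}$; and $\mathrm{diam}_\Omega(A)=\sup_{y,z\in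 A}d_\Omega(y,z)$. For a properly convex domain $\Omega$ and $x\in\overline\Omega$, the *open face* $F_\Omega(x)$ consists of $x$ and of all $y\in\overline\Omega$ such that some open line segment contained in $\overline\Omega$ contains both $x$ and $y$. A *simplex of dimension $k$* ($0\le k\le d-1$) is a set $S$ with $gS=\{[x_1:\dots:x_{k+1}:0:\dots:0] : x_1,\dots,x_{k+1}>0\}$ for some $g\in\mathrm{PGL}_d(\mathbb R)$. A set $A\subset B$ is *properly embedded* in $B$ if the inclusion $A\hookrightarrow B$ is a proper map. A *naive convex co-compact triple* $(\Omega,\mathcal C,\Lambda)$ consists of a properly convex domain $\Omega\subset\mathbb P(\mathbb R^d)$, an infinite discrete subgroup $\Lambda\subset\mathrm{Aut}(\Omega)=\{g\in\mathrm{PGL}_d(\mathbb R):g\Omega=\Omega\}$, and a non-empty convex subset $\mathcal C\subset\Omega$, closed in $\Omega$, such that $g\mathcal C=\mathcal C$ for all $g\in\Lambda$ and $\Lambda$ acts co-compactly on $\mathcal C$. **Theorem.** Let $(\Omega,\mathcal C,\Lambda)$ be a naive convex co-compact triple. Then the following are equivalent: 1. $\mathrm{cdim}_{F_\Omega(x)}\big(\overline{\mathcal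 C}\cap F_\Omega(x)\big)=0$ for all $x\in\overline{\mathcal C}\cap\partial\Omega$; 2. $\mathrm{cdim}_{F_\Omega(x)}\big(\partial_i\mathcal C\cap F_\Omega(x)\big)=0$ for all $x\in\partial_i\mathcal C$; 3. there exists $R>0$ such that $\mathrm{diam}_{F_\Omega(x)}\big(\partial_i\mathcal C\cap F_\Omega(x)\big)\le R$ for all $x\in\partial_i\mathcal C$; 4. $\mathcal C$ does not contain a properly embedded simplex of dimension at least two; 5. $(\mathcal C,d_\Omega)$ is Gromov hyperbolic; 6. $\Lambda$ is a word hyperbolic group. -/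

import Mathlib

open scoped Pointwise LinearAlgebra.Projectivization

/-! ### Projective space and the projective linear group -/

/-- The real projective space of lines in `ℝ^d`. -/
abbrev RP (d : ℕ) : Type := ℙ ℝ (Fin d → ℝ)

/-- The projective linear group `PGL_d(ℝ)`. -/
abbrev PGLR (d : ℕ) : Type := Matrix.ProjGenLinGroup (Fin d) ℝ

/-- The quotient topology on projective space. -/
noncomputable instance RP.instTopologicalSpace (d : ℕ) : TopologicalSpace (RP d) :=
  TopologicalSpace.coinduced (Projectivization.mk' ℝ : {v : Fin d → ℝ // v ≠ 0} → RP d)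
    inferInstance

/-- The quotient topology on `PGL_d(ℝ)`. -/
noncomputable instance PGLR.instTopologicalSpace (d : ℕ) : TopologicalSpace (PGLR d) :=
  TopologicalSpace.coinduced
    (Matrix.ProjGenLinGroup.mk : Matrix.GeneralLinearGroup (Fin d) ℝ → PGLR d) inferInstance

/-! ### Affine charts and convexity -/

/-- The affine chart of projective space that is the complement of the hyperplane `φ = 0`. -/
def affChart {d : ℕ} (φ : Module.Dual ℝ (Fin d → ℝ)) : Set (RP d) :=
  {x | φ x.rep ≠ 0}

/-- The affine coordinate of a point of the chart `affChart φ`: its unique representative in the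
affine hyperplane `φ = 1`. -/
noncomputable def affCoord {d : ℕ} (φ : Module.Dual ℝ (Fin d → ℝ)) (x : RP d) : Fin d → ℝ :=
  (φ x.rep)⁻¹ • x.rep

/-- A subset of projective space is convex if it is a convex subset of some affine chart. -/
def IsProjConvex {d : ℕ} (C : Set (RP d)) : Prop :=
  ∃ φ : Module.Dual ℝ (Fin d → ℝ), φ ≠ 0 ∧ C ⊆ affChart φ ∧ Convex ℝ (affCoord φ '' C)

/-- A subset of projective space is properly convex if it is a bounded convex subset of some affine
chart. -/
def IsProperlyConvex {d : ℕ} (C : Set (RP d)) : Prop :=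
  ∃ φ : Module.Dual ℝ (Fin d → ℝ), φ ≠ 0 ∧ C ⊆ affChart φ ∧ Convex ℝ (affCoord φ '' C) ∧
    Bornology.IsBounded (affCoord φ '' C)

/-- The linear span of a set of points of projective space. -/
noncomputable def projSpan {d : ℕ} (A : Set (RP d)) : Submodule ℝ (Fin d → ℝ) :=
  ⨆ x ∈ A, x.submodule

/-- `A` is non-empty and `ℙ(Span A)` has dimension `k`. For a convex set `A` this says that `A` has
dimension `k`. -/
def HasProjDim {d : ℕ} (A : Set (RP d)) (k : ℕ) : Prop :=
  Module.finrank ℝ (projSpan A) = k + 1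

/-- The relative interior: the interior of `C` in `ℙ(Span C)`. -/
def projRelint {d : ℕ} (C : Set (RP d)) : Set (RP d) :=
  {x | x.submodule ≤ projSpan C ∧
    ∃ U : Set (RP d), IsOpen U ∧ x ∈ U ∧ ∀ y ∈ U, y.submodule ≤ projSpan C → y ∈ C}

/-- The boundary `∂C = closure C \ relint C`. -/
def projBoundary {d : ℕ} (C : Set (RP d)) : Set (RP d) :=
  closure C \ projRelint C

/-- The ideal boundary `∂ᵢC = ∂C \ C`. -/
def idealBoundary {d : ℕ} (C : Set (RP d)) : Set (RP d) :=
  projBoundary C \ C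

/-- The open line segment between two points of the affine chart `affChart φ`, taken in that
chart. -/
def projOpenSegment {d : ℕ} (φ : Module.Dual ℝ (Fin d → ℝ)) (p q : RP d) : Set (RP d) :=
  {z | z ∈ affChart φ ∧ affCoord φ z ∈ openSegment ℝ (affCoord φ p) (affCoord φ q)}

/-- The open face `F_Ω(x)`: the point `x`, together with every `y` in `closure Ω` such that some
open line segment in `closure Ω` contains both `x` and `y`. -/
def openFace {d : ℕ} (Ω : Set (RP d)) (x : RP d) : Set (RP d) :=
  {x} ∪ {y | y ∈ closure Ω ∧ ∃ (φ : Module.Dual ℝ (Fin d → ℝ)) (p q : RP d),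
    p ∈ affChart φ ∧ q ∈ affChart φ ∧ p ≠ q ∧ projOpenSegment φ p q ⊆ closure Ω ∧
    x ∈ projOpenSegment φ p q ∧ y ∈ projOpenSegment φ p q}

/-! ### The Hilbert metric -/

/-- The cross ratio `|x - b||y - a| / (|x - a||y - b|)` of points of the chart `affChart φ`. For
distinct collinear points it depends neither on the chart nor on the norm. -/
noncomputable def crossRatio {d : ℕ} (φ : Module.Dual ℝ (Fin d → ℝ)) (a x y b : RP d) : ℝ :=
  (‖affCoord φ x - affCoord φ b‖ * ‖affCoord φ y - affCoord φ a‖) /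
    (‖affCoord φ x - affCoord φ a‖ * ‖affCoord φ y - affCoord φ b‖)

/-- `r` is the Hilbert distance from `x` to `y` in `Ω`: either `x = y` and `r = 0`, or
`r = (1/2) log [a, x, y, b]`, where `a, b` are the points of `∂Ω` on the projective line through `x`
and `y`, and `a, x, y, b` lie in this order (the strict betweenness relations also say that the
four points are collinear). -/
def IsHilbertDist {d : ℕ} (Ω : Set (RP d)) (x y : RP d) (r : ℝ) : Prop :=
  (x = y ∧ r = 0) ∨
  ∃ (φ : Module.Dual ℝ (Fin d → ℝ)) (a b : RP d),
    a ∈ projBoundary Ω ∧ b ∈ projBoundary Ω ∧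
    a ∈ affChart φ ∧ x ∈ affChart φ ∧ y ∈ affChart φ ∧ b ∈ affChart φ ∧
    Sbtw ℝ (affCoord φ a) (affCoord φ x) (affCoord φ y) ∧
    Sbtw ℝ (affCoord φ x) (affCoord φ y) (affCoord φ b) ∧
    r = 1 / 2 * Real.log (crossRatio φ a x y b)

/-- The Hilbert distance of a properly convex set `Ω` that is open in its span. For `x, y ∈ Ω`
exactly one number satisfies `IsHilbertDist Ω x y`, and the supremum below is that number. -/
noncomputable def hilbertDist {d : ℕ} (Ω : Set (RP d)) (x y : RP d) : ℝ :=
  sSup {r | IsHilbertDist Ω x y r}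

/-- The open `R`-neighbourhood of `B` in `Ω` for the Hilbert metric. -/
def hilbertNhd {d : ℕ} (Ω B : Set (RP d)) (R : ℝ) : Set (RP d) :=
  {p | p ∈ Ω ∧ ∃ b ∈ B, hilbertDist Ω p b < R}

/-- The diameter of `A ⊆ Ω` for the Hilbert metric of `Ω`. -/
noncomputable def hilbertDiam {d : ℕ} (Ω A : Set (RP d)) : ENNReal :=
  ⨆ y ∈ A, ⨆ z ∈ A, ENNReal.ofReal (hilbertDist Ω y z)

/-- The coarse dimension of `A` in `Ω`: the least `k` such that `A` lies in a bounded neighbourhood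
(for the Hilbert metric of `Ω`) of a `k`-dimensional convex subset of `Ω`. -/
noncomputable def coarseDim {d : ℕ} (Ω A : Set (RP d)) : ℕ∞ :=
  ⨅ (k : ℕ) (_ : ∃ R : ℝ, 0 < R ∧ ∃ B : Set (RP d), B ⊆ Ω ∧ IsProjConvex B ∧ HasProjDim B k ∧
    A ⊆ hilbertNhd Ω B R), (k : ℕ∞)

/-! ### Simplices -/

/-- The standard open `k`-simplex `{[x₁ : ⋯ : x_{k+1} : 0 : ⋯ : 0] | xᵢ > 0}`. -/
def stdProjSimplex (d k : ℕ) : Set (RP d) :=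
  {z | ∃ (v : Fin d → ℝ) (hv : v ≠ 0), z = Projectivization.mk ℝ v hv ∧
    (∀ i : Fin d, i.val ≤ k → 0 < v i) ∧ (∀ i : Fin d, k < i.val → v i = 0)}

/-- `S` is a simplex of dimension `k`: a projective image of the standard one. -/
def IsProjSimplex {d : ℕ} (S : Set (RP d)) (k : ℕ) : Prop :=
  k + 1 ≤ d ∧ ∃ g : PGLR d, g • S = stdProjSimplex d k

/-- `A ⊆ B` and the inclusion map is proper. -/
def IsProperlyEmbedded {d : ℕ} (A B : Set (RP d)) : Prop :=
  ∃ h : A ⊆ B, IsProperMap (Set.inclusion h)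

/-! ### Hyperbolicity -/

/-- The Gromov product `(x | y)_w` for the distance function `dst`. -/
noncomputable def gromovProd {X : Type*} (dst : X → X → ℝ) (w x y : X) : ℝ :=
  (dst x w + dst y w - dst x y) / 2

/-- Gromov hyperbolicity of a distance function (in terms of Gromov products). -/
def IsGromovHyperbolic {X : Type*} (dst : X → X → ℝ) : Prop :=
  ∃ δ : ℝ, ∀ w x y z : X,
    min (gromovProd dst w x y) (gromovProd dst w y z) - δ ≤ gromovProd dst w x z

/-- A group is word hyperbolic if it has a finite generating set for which the word metric (the path
metric of the Cayley graph) is Gromov hyperbolic. -/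
def IsWordHyperbolic (G : Type*) [Group G] : Prop :=
  ∃ S : Finset G, Subgroup.closure (S : Set G) = ⊤ ∧
    IsGromovHyperbolic fun g h : G => ((SimpleGraph.mulCayley (S : Set G)).dist g h : ℝ)

/-! ### Naive convex co-compact triples -/

/-- A properly convex domain: an open properly convex subset of projective space. -/
def IsProperlyConvexDomain {d : ℕ} (Ω : Set (RP d)) : Prop :=
  IsOpen Ω ∧ IsProperlyConvex Ω

/-- `(Ω, C, Λ)` is a naive convex co-compact triple: `Ω` is a properly convex domain, `Λ` is an
infinite discrete subgroup of `Aut(Ω)`, and `C` is a non-empty convex subset of `Ω`, closed in `Ω`,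
which is `Λ`-invariant and on which `Λ` acts co-compactly. -/
structure IsNaiveConvexCocompactTriple {d : ℕ} (Ω C : Set (RP d)) (Λ : Subgroup (PGLR d)) :
    Prop where
  domain : IsProperlyConvexDomain Ω
  aut : ∀ g ∈ Λ, g • Ω = Ω
  infinite : Infinite Λ
  discrete : DiscreteTopology Λ
  subset : C ⊆ Ω
  nonempty : C.Nonempty
  closed : IsClosed (Subtype.val ⁻¹' C : Set Ω)
  convex : IsProjConvex C
  invariant : ∀ g ∈ Λ, g • C = C
  cocompact : ∃ K : Set (RP d), K ⊆ C ∧ IsCompact K ∧ C ⊆ ⋃ g ∈ Λ, g • K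

/-!
Everything is translated into the geometry of closed convex cones. The properly convex domain `Ω`
is the set of rays in the interior of a closed cone `K` containing no line, and `C` is the set of
rays in `L ∩ interior K` for a closed convex cone `L ⊆ K` (`exists_isConeModel`). The open faces of
`Ω` are the sets of rays of the parts of `K`, two vectors being in the same part if each is
dominated by a multiple of the other in the order of `K`
(`IsConeModel.openFace_isProjectivizationOf`), and the Hilbert metric of `Ω`, as well as that of
each open face, is Birkhoff's metric `coneDist K`, which is defined by this domination
(`IsSharpCone.hilbertDist_eq_coneDist`). The relation `ConeNear K r`, "at distance at most `r`",
passes to limits even if these lie in the boundary of the cone, so that compactness arguments need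
no separate discussion of faces. As `C` is closed in `Ω`, the set `closure C ∩ ∂Ω` is the ideal
boundary of `C`, and the two conditions on coarse dimension agree; moreover, the coarse dimension of
a set vanishes if and only if the set lies in a ball, so a uniform bound on diameters implies both.

If every open face meets the ideal boundary in a bounded set, then triangles in `C` are slim
(`IsSharpCone.exists_slim`). Otherwise there are triangles `x, y, z` and points `u` of the side
`[x, y]` with arbitrarily large distance to the other two sides. Cocompactness allows to move `u`
into a compact set. In the limit the sides `[x, z]` and `[z, y]` lie in the boundary of `K`; as
faces are bounded, `x` and `z` lie in the same part, and so do `z` and `y`; hence so do `x`, `y` and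
the interior point `u`, which is absurd. Slim triangles give the four point condition
(`isGromovHyperbolic_of_slim`).

If the diameters in the open faces are not uniformly bounded, there are points `a, b` of `L` in the
same boundary face with a midpoint far from both. Joining the three points to an interior point of
`L` and moving a point near the midpoint into a compact set leads to a limit triangle whose three
sides lie in the boundary of `K`, but which meets the interior
(`IsSharpCone.exists_ideal_triangle`); its interior is a properly embedded simplex. Conversely, in
logarithmic coordinates the Hilbert metric of a simplex is the metric of a polyhedral norm, in which
the four point condition fails
(`IsConeModel.not_isGromovHyperbolic_of_isProperlyEmbedded`).

Finally, the group acts properly and cocompactly on `C`, whose straight segments are geodesics.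
Properness comes from discreteness: group elements that move a point by a bounded distance have
lifts which, together with their inverses, stay in a compact set of matrices. The Švarc–Milnor lemma
and the invariance of hyperbolicity under quasi-isometries (`isWordHyperbolic_iff`) then compare `C`
with the group. The invariance rests on the stability of quasi-geodesics
(`exists_dist_quasiGeodesic_le`), which is obtained by iterating the four point condition.
-/

/-! ### Coarse geometry of distance functions -/

/-- `D` satisfies the axioms of a pseudometric. -/
structure IsPseudoDist {X : Type*} (D : X → X → ℝ) : Prop where
  self : ∀ x, D x x = 0
  symm : ∀ x y, D x y = D y x
  tri : ∀ x y z, D x z ≤ D x y + D y z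

/-- The points `γ 0, …, γ n` form a discrete geodesic from `x` to `y`, up to the additive
error `c`. -/
structure IsRoughGeodesic {X : Type*} (D : X → X → ℝ) (c : ℝ) (x y : X) (n : ℕ) (γ : ℕ → X) :
    Prop where
  start : γ 0 = x
  finish : γ n = y
  lower : ∀ i j, i ≤ j → j ≤ n → (j : ℝ) - i - c ≤ D (γ i) (γ j)
  upper : ∀ i j, i ≤ j → j ≤ n → D (γ i) (γ j) ≤ (j : ℝ) - i + c

/-- The points `β 0, …, β n` form a discrete quasi-geodesic with constants `a` and `b`. -/
structure IsQuasiGeodesic {X : Type*} (D : X → X → ℝ) (a b : ℝ) (n : ℕ) (β : ℕ → X) : Prop where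
  upper : ∀ i j, i ≤ j → j ≤ n → D (β i) (β j) ≤ a * ((j : ℝ) - i) + b
  lower : ∀ i j, i ≤ j → j ≤ n → (j : ℝ) - i ≤ a * D (β i) (β j) + b

theorem exists_adjacent_of_forall_or {n : ℕ} {P Q : ℕ → Prop} (h : ∀ i ≤ n, P i ∨ Q i)
    (h0 : P 0) (hn : Q n) : ∃ i j, i ≤ j ∧ j ≤ i + 1 ∧ j ≤ n ∧ P i ∧ Q j := by
  classical
  have hex : ∃ j, Q j := ⟨n, hn⟩
  have hle : Nat.find hex ≤ n := Nat.find_min' hex hn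
  rcases Nat.eq_zero_or_pos (Nat.find hex) with h1 | h1
  · exact ⟨0, 0, le_rfl, by omega, by omega, h0, h1 ▸ Nat.find_spec hex⟩
  · refine ⟨Nat.find hex - 1, Nat.find hex, by omega, by omega, hle, ?_, Nat.find_spec hex⟩
    have h2 := Nat.find_min hex (m := Nat.find hex - 1) (by omega)
    exact (h _ (by omega)).resolve_right h2

section Coarse

variable {X : Type*} {D : X → X → ℝ}

theorem IsPseudoDist.nonneg (hD : IsPseudoDist D) (x y : X) : 0 ≤ D x y := by
  have := hD.tri x y x
  rw [hD.self, hD.symm y x] at this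
  linarith

theorem IsRoughGeodesic.nonneg {c : ℝ} {x y : X} {n : ℕ} {γ : ℕ → X} (hD : IsPseudoDist D)
    (h : IsRoughGeodesic D c x y n γ) : 0 ≤ c := by
  have := h.upper 0 0 le_rfl (Nat.zero_le _)
  have := hD.nonneg (γ 0) (γ 0)
  simp at *
  linarith

theorem IsRoughGeodesic.dist_add_dist_le {c : ℝ} {x y : X} {n : ℕ} {γ : ℕ → X}
    (h : IsRoughGeodesic D c x y n γ) {i : ℕ} (hi : i ≤ n) :
    D x (γ i) + D (γ i) y ≤ D x y + 3 * c := by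
  have h1 := h.upper 0 i (Nat.zero_le _) hi
  have h2 := h.upper i n hi le_rfl
  have h3 := h.lower 0 n (Nat.zero_le _) le_rfl
  rw [h.start] at h1 h3
  rw [h.finish] at h2 h3
  simp at *
  linarith

theorem gromovProd_symm (hD : IsPseudoDist D) (w x y : X) :
    gromovProd D w x y = gromovProd D w y x := by
  unfold gromovProd
  rw [hD.symm x y]; ring

theorem gromovProd_le_of_isRoughGeodesic (hD : IsPseudoDist D) {c : ℝ} {x y : X} {n : ℕ}
    {γ : ℕ → X} (h : IsRoughGeodesic D c x y n γ) (w : X) {i : ℕ} (hi : i ≤ n) :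
    gromovProd D w x y ≤ D w (γ i) + 2 * c := by
  have h1 := h.dist_add_dist_le hi
  have h2 := hD.tri x (γ i) w
  have h3 := hD.tri y (γ i) w
  have h4 := hD.symm y (γ i)
  have h5 := hD.symm w (γ i)
  have h6 := h.nonneg hD
  unfold gromovProd
  linarith

/-- In a geodesic triangle whose side `[x, y]` is covered by the neighbourhoods of the other two
sides, that side passes close to the opposite vertex, at a distance controlled by the Gromov
product. -/
theorem exists_dist_le_gromovProd_of_slim (hD : IsPseudoDist D) {c δ : ℝ} {x y w : X}
    {n n₁ n₂ : ℕ} {γ γ₁ γ₂ : ℕ → X} (h : IsRoughGeodesic D c x y n γ)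
    (h₁ : IsRoughGeodesic D c x w n₁ γ₁) (h₂ : IsRoughGeodesic D c w y n₂ γ₂) (hδ : 0 ≤ δ)
    (hs : ∀ i ≤ n, (∃ j ≤ n₁, D (γ i) (γ₁ j) ≤ δ) ∨ (∃ j ≤ n₂, D (γ i) (γ₂ j) ≤ δ)) :
    ∃ i ≤ n, D w (γ i) ≤ gromovProd D w x y + (3 * δ + 6 * c + 2) := by
  obtain ⟨i, i', hii, hi1, hi'n, ⟨j, hj, hj'⟩, ⟨k, hk, hk'⟩⟩ := exists_adjacent_of_forall_or hs
    ⟨0, Nat.zero_le _, by rw [h.start, h₁.start, hD.self]; exact hδ⟩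
    ⟨n₂, le_rfl, by rw [h.finish, h₂.finish, hD.self]; exact hδ⟩
  refine ⟨i, by omega, ?_⟩
  have hc := h.nonneg hD
  have e1 := h₁.dist_add_dist_le hj
  have e2 := h₂.dist_add_dist_le hk
  have e3 := h.upper i i' hii hi'n
  have e4 : (i' : ℝ) ≤ i + 1 := by exact_mod_cast hi1
  have t1 := hD.tri x (γ₁ j) (γ i)
  have t2 := hD.tri (γ i) (γ₂ k) y
  have t3 := hD.tri (γ i) (γ i') (γ₂ k)
  have t4 := hD.tri w (γ₁ j) (γ i)
  have t5 := hD.tri w (γ₂ k) (γ i)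
  have t6 := hD.tri x (γ i) y
  have s1 := hD.symm (γ₁ j) (γ i)
  have s2 := hD.symm (γ₂ k) (γ i)
  have s3 := hD.symm (γ₁ j) w
  have s4 := hD.symm y w
  unfold gromovProd
  linarith

/-- Slim triangles imply the four point condition. -/
theorem isGromovHyperbolic_of_slim (hD : IsPseudoDist D) {c δ : ℝ} (hδ : 0 ≤ δ)
    {n : X → X → ℕ} {γ : X → X → ℕ → X} (h : ∀ x y, IsRoughGeodesic D c x y (n x y) (γ x y))
    (hs : ∀ x y z, ∀ i ≤ n x z, (∃ j ≤ n x y, D (γ x z i) (γ x y j) ≤ δ) ∨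
      (∃ j ≤ n y z, D (γ x z i) (γ y z j) ≤ δ)) : IsGromovHyperbolic D := by
  refine ⟨4 * δ + 8 * c + 2, fun w x y z => ?_⟩
  obtain ⟨i, hi, hi'⟩ := exists_dist_le_gromovProd_of_slim hD (h x z) (h x w) (h w z) hδ (hs x w z)
  rcases hs x y z i hi with ⟨j, hj, hj'⟩ | ⟨j, hj, hj'⟩
  · have := gromovProd_le_of_isRoughGeodesic hD (h x y) w hj
    have := hD.tri w (γ x z i) (γ x y j)
    have := min_le_left (gromovProd D w x y) (gromovProd D w y z)
    linarith
  · have := gromovProd_le_of_isRoughGeodesic hD (h y z) w hj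
    have := hD.tri w (γ x z i) (γ y z j)
    have := min_le_right (gromovProd D w x y) (gromovProd D w y z)
    linarith

/-- The four point condition, iterated along a chain of at most `2 ^ k` steps. -/
theorem le_gromovProd_chain {δ : ℝ}
    (hδ : ∀ w x y z : X, min (gromovProd D w x y) (gromovProd D w y z) - δ ≤ gromovProd D w x z)
    (m : X) (r : ℝ) (hδ0 : 0 ≤ δ) (k : ℕ) : ∀ (s N : ℕ) (y : ℕ → X), 0 < N → N ≤ 2 ^ k →
      (∀ i < N, r ≤ gromovProd D m (y (s + i)) (y (s + i + 1))) →
      r - k * δ ≤ gromovProd D m (y s) (y (s + N)) := by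
  induction k with
  | zero =>
    intro s N y h0 h1 h
    obtain rfl : N = 1 := by simp at h1; omega
    simpa using h 0 (by omega)
  | succ k ih =>
    intro s N y h0 h1 h
    have hp : 2 ^ (k + 1) = 2 ^ k + 2 ^ k := by ring
    push_cast
    by_cases h2 : N ≤ 2 ^ k
    · have := ih s N y h0 h2 h
      linarith
    · push Not at h2
      have hpos : 0 < 2 ^ k := by positivity
      have a1 := ih s (2 ^ k) y hpos le_rfl (fun i hi => h i (by omega))
      have a2 := ih (s + 2 ^ k) (N - 2 ^ k) y (by omega) (by omega) (fun i hi => by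
        have := h (2 ^ k + i) (by omega)
        rwa [← add_assoc] at this)
      rw [show s + 2 ^ k + (N - 2 ^ k) = s + N by omega] at a2
      have := hδ m (y s) (y (s + 2 ^ k)) (y (s + N))
      have := le_min a1 a2
      linarith

theorem sq_le_two_mul_two_pow (k : ℕ) : k ^ 2 ≤ 2 * 2 ^ k := by
  induction k with
  | zero => simp
  | succ k ih =>
    rcases Nat.lt_or_ge k 3 with h | h
    · interval_cases k <;> norm_num
    · have : 2 * 2 ^ (k + 1) = 2 * (2 * 2 ^ k) := by ring
      nlinarith

theorem exists_two_pow_ge (l : ℕ) : ∃ k : ℕ, l ≤ 2 ^ k ∧ k ^ 2 ≤ 4 * l := by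
  rcases Nat.eq_zero_or_pos l with rfl | hl
  · exact ⟨0, by simp, by simp⟩
  · refine ⟨Nat.clog 2 l, Nat.le_pow_clog (by norm_num) l, ?_⟩
    rcases Nat.lt_or_ge 1 l with h | h
    · have h1 := Nat.pow_pred_clog_lt_self (b := 2) (by norm_num) h
      have h2 := sq_le_two_mul_two_pow (Nat.clog 2 l)
      have h3 : 0 < Nat.clog 2 l := Nat.clog_pos (by norm_num) h
      have h4 : 2 ^ Nat.clog 2 l = 2 * 2 ^ (Nat.clog 2 l).pred := by
        rw [← pow_succ', ← Nat.succ_eq_add_one, Nat.succ_pred_eq_of_pos h3]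
      omega
    · obtain rfl : l = 1 := by omega
      simp

end Coarse

/-! ### Quasi-geodesics in hyperbolic spaces -/

section Morse

variable {X Y : Type*} {D : X → X → ℝ}

/-- Seen from a point `m` at distance at least `r` from a quasi-geodesic, the Gromov product of
two points of the quasi-geodesic is at least `r`, up to a term logarithmic in the number of steps
between them. -/
theorem IsQuasiGeodesic.le_gromovProd (hD : IsPseudoDist D) {δ : ℝ} (hδ0 : 0 ≤ δ)
    (hδ : ∀ w x y z : X, min (gromovProd D w x y) (gromovProd D w y z) - δ ≤ gromovProd D w x z)
    {a b : ℝ} (ha : 0 ≤ a) (hb : 0 ≤ b) {n : ℕ} {β : ℕ → X} (hβ : IsQuasiGeodesic D a b n β)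
    (m : X) (r : ℝ) (hr : ∀ i ≤ n, r ≤ D m (β i)) {i j k : ℕ} (hij : i ≤ j) (hj : j ≤ n)
    (hk : j - i ≤ 2 ^ k) : r - (a + b) - k * δ ≤ gromovProd D m (β i) (β j) := by
  rcases hij.eq_or_lt with rfl | hlt
  · have h1 : gromovProd D m (β i) (β i) = D m (β i) := by
      unfold gromovProd
      rw [hD.self, hD.symm m]; ring
    have h2 := hr i hj
    have h3 : (0 : ℝ) ≤ k * δ := by positivity
    rw [h1]; linarith
  · have := le_gromovProd_chain hδ m (r - (a + b)) hδ0 k i (j - i) β (by omega) hk (by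
      intro l hl
      have h1 := hβ.upper (i + l) (i + l + 1) (by omega) (by omega)
      have h2 := hr (i + l) (by omega)
      have h3 := hr (i + l + 1) (by omega)
      have h4 := hD.symm m (β (i + l))
      have h5 := hD.symm m (β (i + l + 1))
      push_cast at h1
      unfold gromovProd
      linarith)
    rwa [show i + (j - i) = j by omega] at this

theorem le_of_quadratic_bound {P Q k : ℝ} (hP : 0 ≤ P) (hQ : 0 ≤ Q) (h : k ^ 2 ≤ P + Q * k) :
    k ≤ P + Q + 1 := by
  by_contra hk
  push Not at hk
  nlinarith

/-- In a hyperbolic space, geodesics stay close to quasi-geodesics with the same ends. -/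
theorem exists_dist_quasiGeodesic_le (hD : IsPseudoDist D) {δ c a b : ℝ} (hδ0 : 0 ≤ δ)
    (hδ : ∀ w x y z : X, min (gromovProd D w x y) (gromovProd D w y z) - δ ≤ gromovProd D w x z)
    (hc : 0 ≤ c) (ha : 0 ≤ a) (hb : 0 ≤ b) : ∃ R : ℝ, 0 ≤ R ∧ ∀ (n N : ℕ) (β γ : ℕ → X),
      IsQuasiGeodesic D a b n β → IsRoughGeodesic D c (β 0) (β n) N γ →
      ∀ k ≤ N, ∃ i ≤ n, D (γ k) (β i) ≤ R := by
  -- `A + δ * κ` bounds the maximal distance, where `2 ^ κ` bounds the number of steps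
  -- between the two points of `β` that are used below
  set A : ℝ := a + b + 2 * δ + 2 * c with hA
  set P : ℝ := 4 * (a * (6 * A + 4 * c + 4) + b) with hP
  set Q : ℝ := 24 * a * δ with hQ
  have hA0 : 0 ≤ A := by positivity
  have hP0 : 0 ≤ P := by positivity
  have hQ0 : 0 ≤ Q := by positivity
  refine ⟨A + δ * (P + Q + 1), by positivity, fun n N β γ hβ hγ => ?_⟩
  have hmin : ∀ k, ∃ i ≤ n, ∀ j ≤ n, D (γ k) (β i) ≤ D (γ k) (β j) := by
    intro k
    obtain ⟨i, hi, hi'⟩ := Finset.exists_min_image (Finset.range (n + 1))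
      (fun i => D (γ k) (β i)) ⟨0, by simp⟩
    exact ⟨i, by simpa [Nat.lt_succ_iff] using hi,
      fun j hj => hi' j (by simpa [Nat.lt_succ_iff] using hj)⟩
  choose f hfn hf using hmin
  obtain ⟨k, hk, hkmax⟩ := Finset.exists_max_image (Finset.range (N + 1))
    (fun k => D (γ k) (β (f k))) ⟨0, by simp⟩
  have hkN : k ≤ N := by simpa [Nat.lt_succ_iff] using hk
  suffices hmain : D (γ k) (β (f k)) ≤ A + δ * (P + Q + 1) by
    intro l hl
    exact ⟨f l, hfn l, (hkmax l (by simpa [Nat.lt_succ_iff] using hl)).trans hmain⟩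
  set r := D (γ k) (β (f k)) with hr
  have hr0 : 0 ≤ r := hD.nonneg _ _
  set m := γ k with hm
  have hrm : ∀ i ≤ n, r ≤ D m (β i) := fun i hi => hf k i hi
  set L := ⌈2 * r + c⌉₊ with hL
  have hL1 : 2 * r + c ≤ L := Nat.le_ceil _
  have hL2 : (L : ℝ) < 2 * r + c + 1 := Nat.ceil_lt_add_one (by positivity)
  -- `γ (k - L)` and `γ (k + L)`, or the ends of `γ`, are at distance about `2 * r` from `m`
  have hleft : ∃ l ≤ k, ∃ i ≤ n, D m (γ l) ≤ 2 * r + 2 * c + 1 ∧ D (γ l) (β i) ≤ r ∧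
      r ≤ gromovProd D m (γ l) (β i) := by
    rcases Nat.lt_or_ge k L with h | h
    · refine ⟨0, by omega, 0, Nat.zero_le _, ?_, ?_, ?_⟩
      · have h1 := hγ.upper 0 k (Nat.zero_le _) hkN
        rw [hD.symm]
        have : (k : ℝ) < L := by exact_mod_cast h
        simp at h1
        linarith
      · rw [hγ.start, hD.self]; exact hr0
      · have := hrm 0 (Nat.zero_le _)
        unfold gromovProd
        rw [hγ.start, hD.self, hD.symm (β 0) m]; linarith
    · refine ⟨k - L, by omega, f (k - L), hfn _, ?_, ?_, ?_⟩
      · have h1 := hγ.upper (k - L) k (by omega) hkN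
        rw [Nat.cast_sub h] at h1
        rw [hD.symm]; linarith
      · exact hkmax _ (by simp; omega)
      · have h1 := hγ.lower (k - L) k (by omega) hkN
        rw [Nat.cast_sub h] at h1
        have h2 : D (γ (k - L)) (β (f (k - L))) ≤ r := hkmax _ (by simp; omega)
        have h3 := hrm _ (hfn (k - L))
        rw [hD.symm] at h3
        unfold gromovProd
        linarith
  have hright : ∃ l, k ≤ l ∧ l ≤ N ∧ ∃ i ≤ n, D m (γ l) ≤ 2 * r + 2 * c + 1 ∧
      D (γ l) (β i) ≤ r ∧ r ≤ gromovProd D m (β i) (γ l) := by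
    rcases Nat.lt_or_ge N (k + L) with h | h
    · refine ⟨N, hkN, le_rfl, n, le_rfl, ?_, ?_, ?_⟩
      · have h1 := hγ.upper k N hkN le_rfl
        have : (N : ℝ) < k + L := by exact_mod_cast h
        linarith
      · rw [hγ.finish, hD.self]; exact hr0
      · have := hrm n le_rfl
        unfold gromovProd
        rw [hγ.finish, hD.self, hD.symm (β n) m]; linarith
    · refine ⟨k + L, by omega, h, f (k + L), hfn _, ?_, ?_, ?_⟩
      · have h1 := hγ.upper k (k + L) (by omega) h
        push_cast at h1
        linarith
      · exact hkmax _ (by simp; omega)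
      · have h1 := hγ.lower k (k + L) (by omega) h
        push_cast at h1
        have h2 : D (γ (k + L)) (β (f (k + L))) ≤ r := hkmax _ (by simp; omega)
        have h3 := hrm _ (hfn (k + L))
        rw [hD.symm] at h3
        rw [hD.symm] at h1 h2
        unfold gromovProd
        linarith
  obtain ⟨l₁, hl₁, i₁, hi₁, d₁, e₁, g₁⟩ := hleft
  obtain ⟨l₂, hl₂, hl₂N, i₂, hi₂, d₂, e₂, g₂⟩ := hright
  have hgeo : gromovProd D m (γ l₁) (γ l₂) ≤ 2 * c := by
    have h1 := hγ.upper l₁ k hl₁ hkN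
    have h2 := hγ.upper k l₂ hl₂ hl₂N
    have h3 := hγ.lower l₁ l₂ (by omega) hl₂N
    unfold gromovProd
    rw [hD.symm (γ l₂) m]; linarith
  have hβd : D (β i₁) (β i₂) ≤ 6 * r + 4 * c + 4 := by
    have h1 := hD.tri (β i₁) (γ l₁) (β i₂)
    have h2 := hD.tri (γ l₁) m (β i₂)
    have h3 := hD.tri m (γ l₂) (β i₂)
    have h4 := hD.symm (β i₁) (γ l₁)
    have h5 := hD.symm (γ l₁) m
    linarith
  have key : ∃ κ : ℕ, r - (a + b) - κ * δ ≤ gromovProd D m (β i₁) (β i₂) ∧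
      (κ : ℝ) ^ 2 ≤ 4 * (a * (6 * r + 4 * c + 4) + b) := by
    rcases le_total i₁ i₂ with h | h
    · obtain ⟨κ, hκ, hκ'⟩ := exists_two_pow_ge (i₂ - i₁)
      refine ⟨κ, hβ.le_gromovProd hD hδ0 hδ ha hb m r hrm h hi₂ hκ, ?_⟩
      have h1 := hβ.lower i₁ i₂ h hi₂
      have h2 := mul_le_mul_of_nonneg_left hβd ha
      have h3 : (κ : ℝ) ^ 2 ≤ 4 * ((i₂ - i₁ : ℕ) : ℝ) := by exact_mod_cast hκ'
      rw [Nat.cast_sub h] at h3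
      linarith
    · obtain ⟨κ, hκ, hκ'⟩ := exists_two_pow_ge (i₁ - i₂)
      rw [gromovProd_symm hD]
      refine ⟨κ, hβ.le_gromovProd hD hδ0 hδ ha hb m r hrm h hi₁ hκ, ?_⟩
      have h1 := hβ.lower i₂ i₁ h hi₁
      rw [hD.symm] at h1
      have h2 := mul_le_mul_of_nonneg_left hβd ha
      have h3 : (κ : ℝ) ^ 2 ≤ 4 * ((i₁ - i₂ : ℕ) : ℝ) := by exact_mod_cast hκ'
      rw [Nat.cast_sub h] at h3
      linarith
  obtain ⟨κ, hκ, hκ'⟩ := key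
  have hκ0 : (0 : ℝ) ≤ κ * δ := by positivity
  have h1 := hδ m (γ l₁) (β i₁) (β i₂)
  have h2 := hδ m (γ l₁) (β i₂) (γ l₂)
  have h3 := le_min (show r - (a + b) - κ * δ ≤ gromovProd D m (γ l₁) (β i₁) by linarith) hκ
  have h4 := le_min (show r - (a + b) - κ * δ - δ ≤ gromovProd D m (γ l₁) (β i₂) by linarith)
    (show r - (a + b) - κ * δ - δ ≤ gromovProd D m (β i₂) (γ l₂) by linarith)
  have hrA : r ≤ A + δ * κ := by linarith
  have hκb : (κ : ℝ) ≤ P + Q + 1 := by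
    refine le_of_quadratic_bound hP0 hQ0 (hκ'.trans ?_)
    have := mul_le_mul_of_nonneg_left hrA ha
    rw [hP, hQ]
    nlinarith
  have := mul_le_mul_of_nonneg_left hκb hδ0
  linarith

/-- In a hyperbolic space, quasi-geodesics stay close to geodesics with the same ends. -/
theorem exists_dist_roughGeodesic_le (hD : IsPseudoDist D) {δ c a b : ℝ} (hδ0 : 0 ≤ δ)
    (hδ : ∀ w x y z : X, min (gromovProd D w x y) (gromovProd D w y z) - δ ≤ gromovProd D w x z)
    (hc : 0 ≤ c) (ha : 0 ≤ a) (hb : 0 ≤ b) : ∃ R : ℝ, 0 ≤ R ∧ ∀ (n N : ℕ) (β γ : ℕ → X),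
      IsQuasiGeodesic D a b n β → IsRoughGeodesic D c (β 0) (β n) N γ →
      ∀ i ≤ n, ∃ k ≤ N, D (β i) (γ k) ≤ R := by
  obtain ⟨R, hR0, hR⟩ := exists_dist_quasiGeodesic_le hD hδ0 hδ hc ha hb
  refine ⟨a * (a * (2 * R + 1 + c) + b) + b + R, by positivity, fun n N β γ hβ hγ i hi => ?_⟩
  obtain ⟨k, k', hkk, hk1, hkN, ⟨j, hji, hj⟩, ⟨j', hij', hj'n, hj'⟩⟩ :=
    exists_adjacent_of_forall_or (n := N) (P := fun k => ∃ j ≤ i, D (γ k) (β j) ≤ R)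
      (Q := fun k => ∃ j, i ≤ j ∧ j ≤ n ∧ D (γ k) (β j) ≤ R) (by
        intro k hk
        obtain ⟨j, hj, hjR⟩ := hR n N β γ hβ hγ k hk
        rcases le_total j i with h | h
        · exact Or.inl ⟨j, h, hjR⟩
        · exact Or.inr ⟨j, h, hj, hjR⟩)
      ⟨0, Nat.zero_le _, by rw [hγ.start, hD.self]; exact hR0⟩
      ⟨n, hi, le_rfl, by rw [hγ.finish, hD.self]; exact hR0⟩
  refine ⟨k, by omega, ?_⟩
  have h1 := hβ.lower j j' (by omega) hj'n
  have h2 := hβ.upper j i hji hi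
  have h3 := hγ.upper k k' hkk hkN
  have h4 : (k' : ℝ) ≤ k + 1 := by exact_mod_cast hk1
  have h5 := hD.tri (β j) (γ k) (β j')
  have h6 := hD.tri (γ k) (γ k') (β j')
  have h7 := hD.symm (β j) (γ k)
  have h8 := hD.tri (β i) (β j) (γ k)
  have h9 := hD.symm (β i) (β j)
  have h10 : (i : ℝ) ≤ j' := by exact_mod_cast hij'
  have h11 := mul_le_mul_of_nonneg_left (show D (β j) (β j') ≤ 2 * R + 1 + c by linarith) ha
  have h12 := mul_le_mul_of_nonneg_left
    (show (i : ℝ) - j ≤ a * (2 * R + 1 + c) + b by linarith) ha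
  linarith

/-- In a hyperbolic space, the distance from a point to a geodesic is at most the Gromov product,
up to a constant. -/
theorem exists_dist_le_gromovProd (hD : IsPseudoDist D) {δ c : ℝ}
    (hδ : ∀ w x y z : X, min (gromovProd D w x y) (gromovProd D w y z) - δ ≤ gromovProd D w x z)
    {x y : X} {N : ℕ} {γ : ℕ → X} (hγ : IsRoughGeodesic D c x y N γ) (m : X) :
    ∃ k ≤ N, D m (γ k) ≤ gromovProd D m x y + (2 * δ + 8 * c + 4) := by
  have hc := hγ.nonneg hD
  -- the point of the geodesic at distance `s = (m | y)_x` from `x`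
  set s := gromovProd D x m y with hs
  have hs0 : 0 ≤ s := by
    have := hD.tri m x y
    have := hD.symm x y
    rw [hs]; unfold gromovProd
    linarith
  have hsN : s ≤ D x y := by
    have := hD.tri m y x
    have := hD.symm x y
    rw [hs]; unfold gromovProd
    linarith
  have hxN := hγ.upper 0 N (Nat.zero_le _) le_rfl
  rw [hγ.start, hγ.finish] at hxN
  simp at hxN
  obtain ⟨k, hkN, hk1, hk2⟩ : ∃ k ≤ N, s - 1 - c ≤ k ∧ (k : ℝ) ≤ s := by
    rcases le_total ⌊s⌋₊ N with h | h
    · exact ⟨⌊s⌋₊, h, by have := Nat.lt_floor_add_one s; linarith, Nat.floor_le hs0⟩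
    · refine ⟨N, le_rfl, by linarith, le_trans (by exact_mod_cast h) (Nat.floor_le hs0)⟩
  refine ⟨k, hkN, ?_⟩
  have h1 := hγ.upper 0 k (Nat.zero_le _) hkN
  have h2 := hγ.lower 0 k (Nat.zero_le _) hkN
  have h3 := hγ.upper k N hkN le_rfl
  have h4 := hγ.lower 0 N (Nat.zero_le _) le_rfl
  rw [hγ.start] at h1 h2 h4
  rw [hγ.finish] at h3 h4
  simp only [Nat.cast_zero, sub_zero] at h1 h2 h4
  have h5 := hδ x m y (γ k)
  have h6 : s - 1 - 3 * c ≤ gromovProd D x y (γ k) := by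
    unfold gromovProd
    rw [hD.symm y x, hD.symm (γ k) x, hD.symm y (γ k)]
    linarith
  have h7 := le_min (show s - 1 - 3 * c ≤ gromovProd D x m y by linarith) h6
  have h8 : s - 1 - 3 * c - δ ≤ gromovProd D x m (γ k) := by linarith
  unfold gromovProd at *
  rw [hD.symm (γ k) x] at h8
  rw [hD.symm x m] at *
  rw [hD.symm y m, hD.symm y x] at *
  linarith

/-- Hyperbolicity passes to a (roughly) geodesic space that is quasi-isometrically embedded in a
(roughly) geodesic hyperbolic space. -/
theorem IsGromovHyperbolic.of_quasiIsometricEmbedding {E : Y → Y → ℝ} (hD : IsPseudoDist D)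
    (hE : IsPseudoDist E) {c c' : ℝ}
    (hgD : ∀ x y, ∃ n γ, IsRoughGeodesic D c x y n γ)
    (hgE : ∀ x y, ∃ n γ, IsRoughGeodesic E c' x y n γ) (hyp : IsGromovHyperbolic E) (f : X → Y)
    {a b : ℝ} (ha : 0 ≤ a) (hb : 0 ≤ b) (hf : ∀ x y, E (f x) (f y) ≤ a * D x y + b)
    (hf' : ∀ x y, D x y ≤ a * E (f x) (f y) + b) : IsGromovHyperbolic D := by
  rcases isEmpty_or_nonempty X with hX | ⟨⟨x₀⟩⟩
  · exact ⟨0, fun w => (hX.false w).elim⟩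
  choose n γ hγ using hgD
  choose n' γ' hγ' using hgE
  have hc : 0 ≤ c := (hγ x₀ x₀).nonneg hD
  have hc' : 0 ≤ c' := (hγ' (f x₀) (f x₀)).nonneg hE
  obtain ⟨δ₀, hδ₀⟩ := hyp
  set δ := max δ₀ 0 with hδdef
  have hδ0 : 0 ≤ δ := le_max_right _ _
  have hδ : ∀ w x y z : Y,
      min (gromovProd E w x y) (gromovProd E w y z) - δ ≤ gromovProd E w x z := by
    intro w x y z
    have := hδ₀ w x y z
    have := le_max_left δ₀ 0
    linarith
  have hB0 : 0 ≤ a * c + b + c := by positivity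
  have hq : ∀ x y, IsQuasiGeodesic E a (a * c + b + c) (n x y) (fun i => f (γ x y i)) := by
    intro x y
    refine ⟨fun i j hij hj => ?_, fun i j hij hj => ?_⟩
    · have := mul_le_mul_of_nonneg_left ((hγ x y).upper i j hij hj) ha
      have := hf (γ x y i) (γ x y j)
      linarith
    · have := (hγ x y).lower i j hij hj
      have := hf' (γ x y i) (γ x y j)
      have : 0 ≤ a * c := by positivity
      linarith
  obtain ⟨R₁, hR₁0, hR₁⟩ := exists_dist_quasiGeodesic_le hE hδ0 hδ hc' ha hB0
  obtain ⟨R₂, hR₂0, hR₂⟩ := exists_dist_roughGeodesic_le hE hδ0 hδ hc' ha hB0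
  have hgeo : ∀ x y, IsRoughGeodesic E c' (f (γ x y 0)) (f (γ x y (n x y)))
      (n' (f x) (f y)) (γ' (f x) (f y)) := by
    intro x y
    rw [(hγ x y).start, (hγ x y).finish]
    exact hγ' _ _
  set W := R₂ + (2 * c' + δ + (2 * δ + 8 * c' + 4)) + R₁ with hW
  -- a point of `Y` with small Gromov product is close to the image of the geodesic
  have key : ∀ x y m, gromovProd E m (f x) (f y) ≤ 2 * c' + δ →
      ∃ j ≤ n x y, E m (f (γ x y j)) ≤ (2 * c' + δ + (2 * δ + 8 * c' + 4)) + R₁ := by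
    intro x y m hm
    obtain ⟨k, hk, hk'⟩ := exists_dist_le_gromovProd hE hδ (hγ' (f x) (f y)) m
    obtain ⟨j, hj, hj'⟩ := hR₁ _ _ _ _ (hq x y) (hgeo x y) k hk
    exact ⟨j, hj, by have := hE.tri m (γ' (f x) (f y) k) (f (γ x y j)); linarith⟩
  refine isGromovHyperbolic_of_slim hD (c := c) (δ := a * W + b) (by positivity) hγ ?_
  intro x y z i hi
  obtain ⟨k, hk, hk'⟩ := hR₂ _ _ _ _ (hq x z) (hgeo x z) i hi
  set m := γ' (f x) (f z) k with hm
  have h1 : gromovProd E m (f x) (f z) ≤ 2 * c' := by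
    have := gromovProd_le_of_isRoughGeodesic hE (hγ' (f x) (f z)) m hk
    rwa [hE.self, zero_add] at this
  have h2 := hδ m (f x) (f y) (f z)
  have pull : ∀ p, E m (f p) ≤ (2 * c' + δ + (2 * δ + 8 * c' + 4)) + R₁ →
      D (γ x z i) p ≤ a * W + b := by
    intro p hp
    have h3 := hf' (γ x z i) p
    have h4 := hE.tri (f (γ x z i)) m (f p)
    have h5 := mul_le_mul_of_nonneg_left (show E (f (γ x z i)) (f p) ≤ W by linarith) ha
    linarith
  rcases min_le_iff.1 (show min (gromovProd E m (f x) (f y)) (gromovProd E m (f y) (f z)) ≤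
    2 * c' + δ by linarith) with h | h
  · obtain ⟨j, hj, hj'⟩ := key x y m h
    exact Or.inl ⟨j, hj, pull _ hj'⟩
  · obtain ⟨j, hj, hj'⟩ := key y z m h
    exact Or.inr ⟨j, hj, pull _ hj'⟩

end Morse

/-! ### Sharp cones and their Hilbert metric -/

section Cone

variable {E : Type*} [NormedAddCommGroup E] [NormedSpace ℝ E]

/-- `K` is a closed convex cone on which the linear form `φ` dominates the norm; in particular `K`
contains no line. -/
structure IsSharpCone (K : Set E) (φ : E →ₗ[ℝ] ℝ) : Prop where
  isClosed : IsClosed K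
  zero_mem : (0 : E) ∈ K
  add_mem : ∀ {x y : E}, x ∈ K → y ∈ K → x + y ∈ K
  smul_mem : ∀ {t : ℝ} {x : E}, 0 ≤ t → x ∈ K → t • x ∈ K
  bound : ∃ B : ℝ, 0 < B ∧ ∀ x ∈ K, ‖x‖ ≤ B * φ x

/-- `x` and `y` dominate each other in the partial order of the cone `K`. For nonzero points of a
closed cone this says that they lie in the same open face. -/
def SamePart (K : Set E) (x y : E) : Prop :=
  (∃ t : ℝ, t • y - x ∈ K) ∧ ∃ t : ℝ, t • x - y ∈ K

/-- The least `t` such that `x ≤ t y` in the partial order of the cone `K`; the junk value `0` if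
there is none. -/
noncomputable def coneRatio (K : Set E) (x y : E) : ℝ :=
  sInf {t : ℝ | t • y - x ∈ K}

/-- The Hilbert distance between rays of the cone `K`, in the form given to it by Birkhoff. It is
meaningful for nonzero points of the same part of `K`. -/
noncomputable def coneDist (K : Set E) (x y : E) : ℝ :=
  1 / 2 * Real.log (coneRatio K x y * coneRatio K y x)

/-- The rays of `x` and `y` are at Hilbert distance at most `r`, stated without infima so that it
passes to limits. -/
def ConeNear (K : Set E) (r : ℝ) (x y : E) : Prop :=
  ∃ s t : ℝ, s • y - x ∈ K ∧ t • x - y ∈ K ∧ s * t ≤ Real.exp (2 * r)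

/-- The union of the rays of the cone spanned by `x` and `y`, without the origin; in projective
space this is the closed segment from `x` to `y`. -/
def coneSegment (x y : E) : Set E :=
  {z | ∃ a b : ℝ, 0 ≤ a ∧ 0 ≤ b ∧ 0 < a + b ∧ z = a • x + b • y}

theorem left_mem_coneSegment (x y : E) : x ∈ coneSegment x y :=
  ⟨1, 0, zero_le_one, le_rfl, by norm_num, by simp⟩

theorem right_mem_coneSegment (x y : E) : y ∈ coneSegment x y :=
  ⟨0, 1, le_rfl, zero_le_one, by norm_num, by simp⟩

theorem coneSegment_symm (x y : E) : coneSegment x y = coneSegment y x := by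
  ext z
  constructor <;> rintro ⟨a, b, ha, hb, hab, rfl⟩ <;>
    exact ⟨b, a, hb, ha, by linarith, add_comm _ _⟩

theorem SamePart.symm {K : Set E} {x y : E} (h : SamePart K x y) : SamePart K y x := ⟨h.2, h.1⟩

theorem ConeNear.symm {K : Set E} {r : ℝ} {x y : E} (h : ConeNear K r x y) : ConeNear K r y x := by
  obtain ⟨s, t, hs, ht, hst⟩ := h
  exact ⟨t, s, ht, hs, by rwa [mul_comm]⟩

theorem ConeNear.samePart {K : Set E} {r : ℝ} {x y : E} (h : ConeNear K r x y) :
    SamePart K x y := by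
  obtain ⟨s, t, hs, ht, -⟩ := h
  exact ⟨⟨s, hs⟩, ⟨t, ht⟩⟩

theorem ConeNear.mono {K : Set E} {r r' : ℝ} {x y : E} (h : ConeNear K r x y) (hr : r ≤ r') :
    ConeNear K r' x y := by
  obtain ⟨s, t, hs, ht, hst⟩ := h
  exact ⟨s, t, hs, ht, hst.trans (Real.exp_le_exp.2 (by linarith))⟩

theorem coneDist_symm (K : Set E) (x y : E) : coneDist K x y = coneDist K y x := by
  unfold coneDist
  rw [mul_comm (coneRatio K x y)]

namespace IsSharpCone

variable {K : Set E} {φ : E →ₗ[ℝ] ℝ}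

section Basic

variable (hK : IsSharpCone K φ)
include hK

theorem nonneg {x : E} (hx : x ∈ K) : 0 ≤ φ x := by
  obtain ⟨B, hB, h⟩ := hK.bound
  have := (norm_nonneg x).trans (h x hx)
  exact nonneg_of_mul_nonneg_right this hB

theorem pos {x : E} (hx : x ∈ K \ {0}) : 0 < φ x := by
  obtain ⟨B, hB, h⟩ := hK.bound
  have h1 : 0 < ‖x‖ := norm_pos_iff.2 hx.2
  exact pos_of_mul_pos_right (h1.trans_le (h x hx.1)) hB.le

omit hK in
theorem mem_of_pos {x : E} (hx : x ∈ K) (h : 0 < φ x) : x ∈ K \ {0} :=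
  ⟨hx, by rintro rfl; simp at h⟩

theorem smul_mem_of_pos {x : E} (hx : x ∈ K \ {0}) {t : ℝ} (ht : 0 < t) : t • x ∈ K \ {0} :=
  ⟨hK.smul_mem ht.le hx.1, by simpa [ht.ne'] using hx.2⟩

theorem not_neg_mem {x : E} (hx : x ∈ K \ {0}) : -x ∉ K := by
  intro h
  have h1 := hK.pos hx
  have h2 := hK.nonneg h
  rw [map_neg] at h2
  linarith

theorem add_mem_ne_zero {x y : E} (hx : x ∈ K \ {0}) (hy : y ∈ K) : x + y ∈ K \ {0} := by
  refine mem_of_pos (φ := φ) (hK.add_mem hx.1 hy) ?_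
  have h1 := hK.pos hx
  have h2 := hK.nonneg hy
  rw [map_add]; linarith

theorem convex : Convex ℝ K := fun _ hx _ hy _ _ ha hb _ =>
  hK.add_mem (hK.smul_mem ha hx) (hK.smul_mem hb hy)

theorem coneSegment_subset {x y : E} (hx : x ∈ K \ {0}) (hy : y ∈ K \ {0}) :
    coneSegment x y ⊆ K \ {0} := by
  rintro z ⟨a, b, ha, hb, hab, rfl⟩
  rcases ha.eq_or_lt with rfl | ha
  · simpa using hK.smul_mem_of_pos hy (by linarith)
  · exact hK.add_mem_ne_zero (hK.smul_mem_of_pos hx ha) (hK.smul_mem hb hy.1)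

/-- Domination bounds the factor from below. -/
theorem div_le_of_mem {x y : E} (hy : y ∈ K \ {0}) {t : ℝ} (h : t • y - x ∈ K) :
    φ x / φ y ≤ t := by
  have h1 := hK.nonneg h
  rw [map_sub, map_smul, smul_eq_mul] at h1
  rw [div_le_iff₀ (hK.pos hy)]; linarith

theorem pos_of_mem {x y : E} (hx : x ∈ K \ {0}) (hy : y ∈ K \ {0}) {t : ℝ}
    (h : t • y - x ∈ K) : 0 < t :=
  (div_pos (hK.pos hx) (hK.pos hy)).trans_le (hK.div_le_of_mem hy h)

theorem dominated_trans {x y z : E} {s t : ℝ} (hs0 : 0 ≤ s) (hs : s • y - x ∈ K)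
    (ht : t • z - y ∈ K) : (s * t) • z - x ∈ K := by
  have := hK.add_mem hs (hK.smul_mem hs0 ht)
  convert this using 1
  module

theorem samePart_refl (x : E) : SamePart K x x := by
  have : (1 : ℝ) • x - x ∈ K := by simpa using hK.zero_mem
  exact ⟨⟨1, this⟩, ⟨1, this⟩⟩

theorem samePart_trans {x y z : E} (hx : x ∈ K \ {0}) (hy : y ∈ K \ {0}) (hz : z ∈ K \ {0})
    (h : SamePart K x y) (h' : SamePart K y z) : SamePart K x z := by
  obtain ⟨⟨s, hs⟩, ⟨s', hs'⟩⟩ := h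
  obtain ⟨⟨t, ht⟩, ⟨t', ht'⟩⟩ := h'
  exact ⟨⟨_, hK.dominated_trans (hK.pos_of_mem hx hy hs).le hs ht⟩,
    ⟨_, hK.dominated_trans (hK.pos_of_mem hz hy ht').le ht' hs'⟩⟩

theorem samePart_smul (x : E) {t : ℝ} (ht : 0 < t) :
    SamePart K x (t • x) := by
  refine ⟨⟨t⁻¹, ?_⟩, ⟨t, ?_⟩⟩
  · rw [smul_smul, inv_mul_cancel₀ ht.ne', one_smul, sub_self]; exact hK.zero_mem
  · rw [sub_self]; exact hK.zero_mem

theorem coneNear_trans {r r' : ℝ} {x y z : E} (hx : x ∈ K \ {0}) (hy : y ∈ K \ {0})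
    (hz : z ∈ K \ {0}) (h : ConeNear K r x y) (h' : ConeNear K r' y z) :
    ConeNear K (r + r') x z := by
  obtain ⟨s, s', hs, hs', hss⟩ := h
  obtain ⟨t, t', ht, ht', htt⟩ := h'
  have p1 := hK.pos_of_mem hx hy hs
  have p2 := hK.pos_of_mem hy hx hs'
  have p3 := hK.pos_of_mem hy hz ht
  have p4 := hK.pos_of_mem hz hy ht'
  refine ⟨s * t, t' * s', hK.dominated_trans p1.le hs ht, hK.dominated_trans p4.le ht' hs', ?_⟩
  rw [mul_add, Real.exp_add]
  calc s * t * (t' * s') = (s * s') * (t * t') := by ring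
    _ ≤ _ := mul_le_mul hss htt (by positivity) (Real.exp_pos _).le

theorem coneNear_self {r : ℝ} (hr : 0 ≤ r) (x : E) : ConeNear K r x x := by
  have : (1 : ℝ) • x - x ∈ K := by simpa using hK.zero_mem
  exact ⟨1, 1, this, this, by simpa using Real.one_le_exp (by linarith)⟩

theorem coneNear_smul_left {r : ℝ} {x y : E} (h : ConeNear K r x y) {c : ℝ} (hc : 0 < c) :
    ConeNear K r (c • x) y := by
  obtain ⟨s, t, hs, ht, hst⟩ := h
  refine ⟨c * s, t / c, ?_, ?_, ?_⟩
  · have := hK.smul_mem hc.le hs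
    convert this using 1
    module
  · rw [smul_smul, div_mul_cancel₀ _ hc.ne']; exact ht
  · rwa [show c * s * (t / c) = s * t by field_simp]

theorem coneNear_smul_right {r : ℝ} {x y : E} (h : ConeNear K r x y) {c : ℝ} (hc : 0 < c) :
    ConeNear K r x (c • y) :=
  (hK.coneNear_smul_left h.symm hc).symm

end Basic

section Ratio

variable (hK : IsSharpCone K φ)
include hK

theorem bddBelow_ratios (x : E) {y : E} (hy : y ∈ K \ {0}) :
    BddBelow {t : ℝ | t • y - x ∈ K} :=
  ⟨φ x / φ y, fun _ ht => hK.div_le_of_mem hy ht⟩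

theorem coneRatio_le {x y : E} (hy : y ∈ K \ {0}) {t : ℝ} (h : t • y - x ∈ K) :
    coneRatio K x y ≤ t :=
  csInf_le (hK.bddBelow_ratios x hy) h

theorem coneRatio_mem {x y : E} (hy : y ∈ K \ {0}) (h : ∃ t : ℝ, t • y - x ∈ K) :
    coneRatio K x y • y - x ∈ K := by
  have hcl : IsClosed {t : ℝ | t • y - x ∈ K} :=
    hK.isClosed.preimage (by fun_prop : Continuous fun t : ℝ => t • y - x)
  exact hcl.csInf_mem h (hK.bddBelow_ratios x hy)

theorem coneRatio_pos {x y : E} (hx : x ∈ K \ {0}) (hy : y ∈ K \ {0})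
    (h : ∃ t : ℝ, t • y - x ∈ K) : 0 < coneRatio K x y :=
  hK.pos_of_mem hx hy (hK.coneRatio_mem hy h)

omit hK in
theorem coneRatio_eq {x y : E} {m : ℝ} (h : m • y - x ∈ K) (h' : ∀ t : ℝ, t • y - x ∈ K → m ≤ t) :
    coneRatio K x y = m :=
  IsLeast.csInf_eq ⟨h, fun t ht => h' t ht⟩

theorem one_le_coneRatio_mul {x y : E} (hx : x ∈ K \ {0}) (hy : y ∈ K \ {0})
    (h : SamePart K x y) : 1 ≤ coneRatio K x y * coneRatio K y x := by
  have h1 := hK.div_le_of_mem hy (hK.coneRatio_mem hy h.1)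
  have h2 := hK.div_le_of_mem hx (hK.coneRatio_mem hx h.2)
  have p1 := hK.pos hx
  have p2 := hK.pos hy
  calc (1 : ℝ) = (φ x / φ y) * (φ y / φ x) := by field_simp
    _ ≤ _ := mul_le_mul h1 h2 (by positivity) ((by positivity : (0 : ℝ) ≤ φ x / φ y).trans h1)

theorem coneDist_nonneg {x y : E} (hx : x ∈ K \ {0}) (hy : y ∈ K \ {0})
    (h : SamePart K x y) : 0 ≤ coneDist K x y := by
  have := Real.log_nonneg (hK.one_le_coneRatio_mul hx hy h)
  unfold coneDist
  linarith

theorem exp_two_mul_coneDist {x y : E} (hx : x ∈ K \ {0}) (hy : y ∈ K \ {0})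
    (h : SamePart K x y) :
    Real.exp (2 * coneDist K x y) = coneRatio K x y * coneRatio K y x := by
  unfold coneDist
  rw [show 2 * (1 / 2 * Real.log (coneRatio K x y * coneRatio K y x)) =
    Real.log (coneRatio K x y * coneRatio K y x) by ring]
  exact Real.exp_log (mul_pos (hK.coneRatio_pos hx hy h.1) (hK.coneRatio_pos hy hx h.2))

theorem coneNear_iff {x y : E} (hx : x ∈ K \ {0}) (hy : y ∈ K \ {0}) (h : SamePart K x y) {r : ℝ} :
    ConeNear K r x y ↔ coneDist K x y ≤ r := by
  have hM := hK.exp_two_mul_coneDist hx hy h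
  constructor
  · rintro ⟨s, t, hs, ht, hst⟩
    have h1 := hK.coneRatio_le hy hs
    have h2 := hK.coneRatio_le hx ht
    have h3 : Real.exp (2 * coneDist K x y) ≤ Real.exp (2 * r) := by
      rw [hM]
      exact (mul_le_mul h1 h2 (hK.coneRatio_pos hy hx h.2).le
        (hK.pos_of_mem hx hy hs).le).trans hst
    have := Real.exp_le_exp.1 h3
    linarith
  · intro hr
    refine ⟨_, _, hK.coneRatio_mem hy h.1, hK.coneRatio_mem hx h.2, ?_⟩
    rw [← hM]
    exact Real.exp_le_exp.2 (by linarith)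

theorem coneNear_coneDist {x y : E} (hx : x ∈ K \ {0}) (hy : y ∈ K \ {0}) (h : SamePart K x y) :
    ConeNear K (coneDist K x y) x y :=
  (hK.coneNear_iff hx hy h).2 le_rfl

theorem coneDist_le_of_coneNear {x y : E} (hx : x ∈ K \ {0}) (hy : y ∈ K \ {0}) {r : ℝ}
    (h : ConeNear K r x y) : coneDist K x y ≤ r :=
  (hK.coneNear_iff hx hy h.samePart).1 h

theorem coneDist_self {x : E} (hx : x ∈ K \ {0}) : coneDist K x x = 0 :=
  le_antisymm (hK.coneDist_le_of_coneNear hx hx (hK.coneNear_self le_rfl x))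
    (hK.coneDist_nonneg hx hx (hK.samePart_refl x))

theorem coneDist_triangle {x y z : E} (hx : x ∈ K \ {0}) (hy : y ∈ K \ {0}) (hz : z ∈ K \ {0})
    (h : SamePart K x y) (h' : SamePart K y z) :
    coneDist K x z ≤ coneDist K x y + coneDist K y z :=
  hK.coneDist_le_of_coneNear hx hz
    (hK.coneNear_trans hx hy hz (hK.coneNear_coneDist hx hy h) (hK.coneNear_coneDist hy hz h'))

theorem coneDist_smul_left {x y : E} (hx : x ∈ K \ {0}) (hy : y ∈ K \ {0}) (h : SamePart K x y)
    {c : ℝ} (hc : 0 < c) : coneDist K (c • x) y = coneDist K x y := by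
  have hcx := hK.smul_mem_of_pos hx hc
  have h1 := hK.coneNear_smul_left (hK.coneNear_coneDist hx hy h) hc
  refine le_antisymm (hK.coneDist_le_of_coneNear hcx hy h1) ?_
  have h2 := hK.coneNear_smul_left (hK.coneNear_coneDist hcx hy h1.samePart) (inv_pos.2 hc)
  rw [smul_smul, inv_mul_cancel₀ hc.ne', one_smul] at h2
  exact hK.coneDist_le_of_coneNear hx hy h2

theorem coneDist_smul_right {x y : E} (hx : x ∈ K \ {0}) (hy : y ∈ K \ {0}) (h : SamePart K x y)
    {c : ℝ} (hc : 0 < c) : coneDist K x (c • y) = coneDist K x y := by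
  rw [coneDist_symm, hK.coneDist_smul_left hy hx h.symm hc, coneDist_symm]

theorem coneRatio_add_smul_right {x y : E} (hx : x ∈ K \ {0}) (hy : y ∈ K \ {0})
    (h : SamePart K x y) {t : ℝ} (ht : 0 < t) :
    coneRatio K x (x + t • y) = coneRatio K x y / (t + coneRatio K x y) := by
  set α := coneRatio K x y with hα
  have hα0 : 0 < α := hK.coneRatio_pos hx hy h.1
  refine coneRatio_eq ?_ fun s hs => ?_
  · have := hK.smul_mem (t := t / (t + α)) (by positivity) (hK.coneRatio_mem hy h.1)
    rw [← hα] at this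
    convert this using 1
    have h1 : α / (t + α) - 1 = -(t / (t + α)) := by field_simp; ring
    calc (α / (t + α)) • (x + t • y) - x
        = (α / (t + α) - 1) • x + (α / (t + α) * t) • y := by module
      _ = (t / (t + α)) • (α • y - x) := by
        rw [h1, show α / (t + α) * t = t / (t + α) * α by ring]; module
  · rw [div_le_iff₀ (by positivity)]
    rcases le_or_gt 1 s with h1 | h1
    · nlinarith
    · have h2 := hK.smul_mem (inv_nonneg.2 (by linarith : 0 ≤ 1 - s)) hs
      have h3 : (1 - s)⁻¹ • (s • (x + t • y) - x) = (s * t / (1 - s)) • y - x := by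
        have h4 : 1 - s ≠ 0 := by linarith
        have h5 : (1 - s)⁻¹ * (s - 1) = -1 := by field_simp; ring
        calc (1 - s)⁻¹ • (s • (x + t • y) - x)
            = ((1 - s)⁻¹ * (s - 1)) • x + ((1 - s)⁻¹ * (s * t)) • y := by module
          _ = _ := by rw [h5, show (1 - s)⁻¹ * (s * t) = s * t / (1 - s) by ring]; module
      rw [h3] at h2
      have h6 := hK.coneRatio_le hy h2
      rw [le_div_iff₀ (by linarith)] at h6
      linarith

theorem coneRatio_add_smul_left {x y : E} (hx : x ∈ K \ {0}) (h : SamePart K x y) {t : ℝ}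
    (ht : 0 < t) : coneRatio K (x + t • y) x = 1 + t * coneRatio K y x := by
  refine coneRatio_eq ?_ fun s hs => ?_
  · have := hK.smul_mem ht.le (hK.coneRatio_mem hx h.2)
    convert this using 1
    module
  · have h2 := hK.smul_mem (inv_pos.2 ht).le hs
    have h3 : t⁻¹ • (s • x - (x + t • y)) = ((s - 1) / t) • x - y := by
      have : t⁻¹ * t = 1 := inv_mul_cancel₀ ht.ne'
      calc t⁻¹ • (s • x - (x + t • y)) = (t⁻¹ * (s - 1)) • x - (t⁻¹ * t) • y := by module
        _ = _ := by rw [this, one_smul, show t⁻¹ * (s - 1) = (s - 1) / t by ring]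
    rw [h3] at h2
    have h4 := hK.coneRatio_le hx h2
    rw [le_div_iff₀ ht] at h4
    linarith

theorem samePart_add_smul {x y : E} (hy : y ∈ K) (h : SamePart K x y) {t : ℝ}
    (ht : 0 ≤ t) : SamePart K x (x + t • y) := by
  obtain ⟨-, ⟨s, hs⟩⟩ := h
  refine ⟨⟨1, ?_⟩, ⟨1 + t * s, ?_⟩⟩
  · rw [one_smul, add_sub_cancel_left]; exact hK.smul_mem ht hy
  · convert hK.smul_mem ht hs using 1
    module

theorem coneDist_add_smul {x y : E} (hx : x ∈ K \ {0}) (hy : y ∈ K \ {0})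
    (h : SamePart K x y) {t : ℝ} (ht : 0 < t) :
    coneDist K x (x + t • y) = 1 / 2 * Real.log (coneRatio K x y * (1 + t * coneRatio K y x) /
      (t + coneRatio K x y)) := by
  unfold coneDist
  rw [hK.coneRatio_add_smul_right hx hy h ht, hK.coneRatio_add_smul_left hx h ht]
  congr 2
  ring

theorem samePart_of_mem_coneSegment {x y z : E} (hx : x ∈ K \ {0}) (hy : y ∈ K \ {0})
    (h : SamePart K x y) (hz : z ∈ coneSegment x y) : SamePart K x z := by
  obtain ⟨a, b, ha, hb, hab, rfl⟩ := hz
  rcases ha.eq_or_lt with rfl | ha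
  · rw [zero_smul, zero_add]
    exact hK.samePart_trans hx hy (hK.smul_mem_of_pos hy (by linarith)) h
      (hK.samePart_smul y (by linarith))
  · have h1 : a • x + b • y = a • (x + (b / a) • y) := by
      rw [smul_add, smul_smul, mul_div_cancel₀ _ ha.ne']
    have hm := hK.add_mem_ne_zero hx (hK.smul_mem (div_nonneg hb ha.le) hy.1)
    rw [h1]
    exact hK.samePart_trans hx hm (hK.smul_mem_of_pos hm ha)
      (hK.samePart_add_smul hy.1 h (div_nonneg hb ha.le)) (hK.samePart_smul _ ha)

/-- Straight segments are geodesics of the Hilbert metric. -/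
theorem coneDist_add_coneDist {x y z : E} (hx : x ∈ K \ {0}) (hy : y ∈ K \ {0})
    (h : SamePart K x y) (hz : z ∈ coneSegment x y) :
    coneDist K x z + coneDist K z y = coneDist K x y := by
  obtain ⟨a, b, ha, hb, hab, rfl⟩ := hz
  rcases ha.eq_or_lt with rfl | ha
  · have hb' : 0 < b := by linarith
    rw [zero_smul, zero_add, hK.coneDist_smul_right hx hy h hb',
      hK.coneDist_smul_left hy hy (hK.samePart_refl y) hb', hK.coneDist_self hy, add_zero]
  rcases hb.eq_or_lt with rfl | hb
  · rw [zero_smul, add_zero, hK.coneDist_smul_right hx hx (hK.samePart_refl x) ha,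
      hK.coneDist_smul_left hx hy h ha, hK.coneDist_self hx, zero_add]
  set t := b / a with htdef
  have ht : 0 < t := div_pos hb ha
  have e1 : a • x + b • y = a • (x + t • y) := by
    rw [smul_add, smul_smul, htdef, mul_div_cancel₀ _ ha.ne']
  have e2 : x + t • y = t • (y + t⁻¹ • x) := by
    rw [smul_add, smul_smul, mul_inv_cancel₀ ht.ne', one_smul, add_comm]
  have hm := hK.add_mem_ne_zero hx (hK.smul_mem ht.le hy.1)
  have hm' := hK.add_mem_ne_zero hy (hK.smul_mem (inv_pos.2 ht).le hx.1)
  have hs := hK.samePart_add_smul hy.1 h ht.le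
  have hs' := hK.samePart_add_smul hx.1 h.symm (inv_pos.2 ht).le
  rw [e1, hK.coneDist_smul_right hx hm hs ha,
    hK.coneDist_smul_left hm hy (hK.samePart_trans hm hx hy hs.symm h) ha, e2,
    coneDist_symm K _ y, hK.coneDist_smul_right hy hm' hs' ht, ← e2,
    hK.coneDist_add_smul hx hy h ht, hK.coneDist_add_smul hy hx h.symm (inv_pos.2 ht)]
  have p1 := hK.coneRatio_pos hx hy h.1
  have p2 := hK.coneRatio_pos hy hx h.2
  unfold coneDist
  rw [← mul_add, ← Real.log_mul (by positivity) (by positivity)]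
  congr 2
  field_simp

theorem coneDist_eq_abs_sub {x y w w' : E} (hx : x ∈ K \ {0}) (hy : y ∈ K \ {0})
    (h : SamePart K x y) (hw : w ∈ coneSegment x y) (hw' : w' ∈ coneSegment x y) :
    coneDist K w w' = |coneDist K x w - coneDist K x w'| := by
  have aux : ∀ a b a' b' : ℝ, 0 ≤ a → 0 ≤ b → 0 < a + b → 0 ≤ a' → 0 ≤ b' → 0 < a' + b' →
      a' * b ≤ a * b' → a • x + b • y ∈ coneSegment x (a' • x + b' • y) := by
    intro a b a' b' ha hb hab ha' hb' hab' hle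
    rcases hb'.eq_or_lt with rfl | hb'
    · have ha'' : 0 < a' := by linarith
      have hb0 : b = 0 := by nlinarith
      subst hb0
      refine ⟨0, a / a', le_rfl, by positivity, ?_, ?_⟩
      · rw [zero_add]; exact div_pos (by linarith) ha''
      · rw [zero_smul, add_zero, add_zero, zero_smul, zero_add, smul_smul,
          div_mul_cancel₀ _ ha''.ne']
    · refine ⟨a - a' * b / b', b / b', ?_, by positivity, ?_, ?_⟩
      · rw [sub_nonneg, div_le_iff₀ hb']; exact hle
      · rcases hb.eq_or_lt with rfl | hb
        · simp at hab ⊢; linarith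
        · have : 0 ≤ a - a' * b / b' := by rw [sub_nonneg, div_le_iff₀ hb']; exact hle
          have := div_pos hb hb'
          linarith
      · rw [smul_add, smul_smul, smul_smul, div_mul_cancel₀ _ hb'.ne', ← add_assoc, ← add_smul]
        congr 2
        ring
  have aux2 : ∀ w w', w ∈ coneSegment x y → w' ∈ coneSegment x y → w ∈ coneSegment x w' →
      coneDist K w w' = |coneDist K x w - coneDist K x w'| := by
    intro w w' hw hw' hww
    have hwK := hK.coneSegment_subset hx hy hw
    have hwK' := hK.coneSegment_subset hx hy hw'
    have s := hK.samePart_of_mem_coneSegment hx hy h hw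
    have s' := hK.samePart_of_mem_coneSegment hx hy h hw'
    have h1 := hK.coneDist_add_coneDist hx hwK' s' hww
    have h2 := hK.coneDist_nonneg hwK hwK' (hK.samePart_trans hwK hx hwK' s.symm s')
    rw [abs_of_nonpos (by linarith)]; linarith
  obtain ⟨a, b, ha, hb, hab, rfl⟩ := id hw
  obtain ⟨a', b', ha', hb', hab', rfl⟩ := id hw'
  rcases le_total (a' * b) (a * b') with hle | hle
  · exact aux2 _ _ hw hw' (aux _ _ _ _ ha hb hab ha' hb' hab' hle)
  · rw [coneDist_symm, abs_sub_comm]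
    exact aux2 _ _ hw' hw (aux _ _ _ _ ha' hb' hab' ha hb hab hle)

/-- A straight segment contains a point at every distance up to its length. -/
theorem exists_mem_coneSegment_coneDist_eq {x y : E} (hx : x ∈ K \ {0}) (hy : y ∈ K \ {0})
    (h : SamePart K x y) {s : ℝ} (hs0 : 0 ≤ s) (hs : s ≤ coneDist K x y) :
    ∃ z ∈ coneSegment x y, coneDist K x z = s := by
  rcases hs0.eq_or_lt with rfl | hs0
  · exact ⟨x, left_mem_coneSegment x y, hK.coneDist_self hx⟩
  rcases hs.eq_or_lt with rfl | hs
  · exact ⟨y, right_mem_coneSegment x y, rfl⟩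
  have hM := hK.exp_two_mul_coneDist hx hy h
  set α := coneRatio K x y with hα
  set β := coneRatio K y x with hβ
  have p1 : 0 < α := hK.coneRatio_pos hx hy h.1
  have p2 : 0 < β := hK.coneRatio_pos hy hx h.2
  have h1 : Real.exp (2 * s) < α * β := by
    rw [← hM]; exact Real.exp_lt_exp.2 (by linarith)
  have h2 : 1 < Real.exp (2 * s) := Real.one_lt_exp_iff.2 (by linarith)
  set e := Real.exp (2 * s) with he
  have h3 : 0 < α * β - e := by linarith
  set t := α * (e - 1) / (α * β - e) with ht
  have ht0 : 0 < t := div_pos (mul_pos p1 (by linarith)) h3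
  refine ⟨x + t • y, ⟨1, t, zero_le_one, ht0.le, by linarith, by simp⟩, ?_⟩
  rw [hK.coneDist_add_smul hx hy h ht0, ← hα, ← hβ]
  have h4 : α * (1 + t * β) / (t + α) = e := by
    have h5 : t * (α * β - e) = α * (e - 1) := div_mul_cancel₀ _ h3.ne'
    rw [div_eq_iff (by positivity)]
    linarith
  rw [h4, he, Real.log_exp]
  ring

end Ratio

end IsSharpCone

end Cone

open Filter Topology in
theorem exists_subseq_tendsto_Icc {a b : ℝ} {s : ℕ → ℝ} (hs : ∀ n, s n ∈ Set.Icc a b) :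
    ∃ t ∈ Set.Icc a b, ∃ ψ : ℕ → ℕ, StrictMono ψ ∧ Tendsto (s ∘ ψ) atTop (𝓝 t) :=
  isCompact_Icc.tendsto_subseq hs

/-! ### Interior points and limits of a sharp cone -/

section ConeTopology

open Filter Topology

variable {E : Type*} [NormedAddCommGroup E] [NormedSpace ℝ E]

theorem exists_mem_Icc_of_mem_coneSegment {x y z : E} (hz : z ∈ coneSegment x y) :
    ∃ κ > (0 : ℝ), ∃ s ∈ Set.Icc (0 : ℝ) 1, z = κ • ((1 - s) • x + s • y) := by
  obtain ⟨a, b, ha, hb, hab, rfl⟩ := hz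
  refine ⟨a + b, hab, b / (a + b), ⟨by positivity, ?_⟩, ?_⟩
  · rw [div_le_one hab]; linarith
  · rw [smul_add, smul_smul, smul_smul, mul_div_cancel₀ _ hab.ne',
      show (a + b) * (1 - b / (a + b)) = a by field_simp; ring]

theorem mem_coneSegment_of_mem_Icc {x y : E} {s : ℝ} (hs : s ∈ Set.Icc (0 : ℝ) 1) :
    (1 - s) • x + s • y ∈ coneSegment x y :=
  ⟨1 - s, s, by linarith [hs.2], hs.1, by linarith, rfl⟩

theorem smul_mem_coneSegment {x y z : E} (hz : z ∈ coneSegment x y) {t : ℝ} (ht : 0 < t) :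
    t • z ∈ coneSegment x y := by
  obtain ⟨a, b, ha, hb, hab, rfl⟩ := hz
  exact ⟨t * a, t * b, by positivity, by positivity, by nlinarith, by module⟩

namespace IsSharpCone

variable {K : Set E} {φ : E →ₗ[ℝ] ℝ} (hK : IsSharpCone K φ)
include hK

theorem add_mem_interior {x y : E} (hx : x ∈ interior K) (hy : y ∈ K) : x + y ∈ interior K := by
  refine mem_interior.2 ⟨(fun z => z + y) '' interior K, ?_,
    isOpenMap_add_right y _ isOpen_interior,
    ⟨x, hx, rfl⟩⟩
  rintro _ ⟨z, hz, rfl⟩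
  exact hK.add_mem (interior_subset hz) hy

theorem smul_mem_interior {x : E} (hx : x ∈ interior K) {t : ℝ} (ht : 0 < t) :
    t • x ∈ interior K := by
  refine mem_interior.2 ⟨(fun z => t • z) '' interior K, ?_,
    isOpenMap_smul₀ ht.ne' _ isOpen_interior, ⟨x, hx, rfl⟩⟩
  rintro _ ⟨z, hz, rfl⟩
  exact hK.smul_mem ht.le (interior_subset hz)

omit hK in
theorem exists_sub_smul_mem_interior {x : E} (hx : x ∈ interior K) (y : E) :
    ∃ ε > (0 : ℝ), x - ε • y ∈ interior K := by
  have hc : Continuous fun ε : ℝ => x - ε • y := by fun_prop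
  have h0 : ∀ᶠ ε : ℝ in 𝓝 0, x - ε • y ∈ interior K :=
    hc.continuousAt.eventually_mem (isOpen_interior.mem_nhds (by simpa using hx))
  obtain ⟨δ, hδ, h⟩ := Metric.eventually_nhds_iff.1 h0
  exact ⟨δ / 2, by positivity, h (by rw [Real.dist_eq, sub_zero, abs_of_pos] <;> linarith)⟩

theorem exists_smul_sub_mem_interior {x : E} (hx : x ∈ interior K) (y : E) :
    ∃ t > (0 : ℝ), t • x - y ∈ interior K := by
  obtain ⟨ε, hε, h⟩ := exists_sub_smul_mem_interior hx y
  refine ⟨ε⁻¹, inv_pos.2 hε, ?_⟩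
  have := hK.smul_mem_interior h (inv_pos.2 hε)
  rwa [smul_sub, smul_smul, inv_mul_cancel₀ hε.ne', one_smul] at this

theorem interior_subset_ne_zero [Nontrivial E] : interior K ⊆ K \ {0} := by
  intro x hx
  refine ⟨interior_subset hx, ?_⟩
  rintro rfl
  obtain ⟨v, hv⟩ := exists_ne (0 : E)
  obtain ⟨t, -, ht⟩ := hK.exists_smul_sub_mem_interior hx v
  obtain ⟨s, -, hs⟩ := hK.exists_smul_sub_mem_interior hx (-v)
  rw [smul_zero, zero_sub] at ht hs
  rw [neg_neg] at hs
  exact hK.not_neg_mem ⟨interior_subset hs, hv⟩ (interior_subset ht)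

theorem samePart_of_mem_interior {x y : E} (hx : x ∈ interior K) (hy : y ∈ interior K) :
    SamePart K x y := by
  obtain ⟨t, -, ht⟩ := hK.exists_smul_sub_mem_interior hx y
  obtain ⟨s, -, hs⟩ := hK.exists_smul_sub_mem_interior hy x
  exact ⟨⟨s, interior_subset hs⟩, ⟨t, interior_subset ht⟩⟩

theorem mem_interior_of_samePart [Nontrivial E] {x y : E} (hx : x ∈ interior K) (hy : y ∈ K \ {0})
    (h : SamePart K x y) : y ∈ interior K := by
  obtain ⟨⟨t, ht⟩, -⟩ := h
  have h0 := hK.pos_of_mem (hK.interior_subset_ne_zero hx) hy ht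
  have h1 := hK.smul_mem_interior (hK.add_mem_interior hx ht) (inv_pos.2 h0)
  rwa [add_sub_cancel, smul_smul, inv_mul_cancel₀ h0.ne', one_smul] at h1

theorem coneSegment_subset_interior {x y : E} (hx : x ∈ interior K) (hy : y ∈ interior K) :
    coneSegment x y ⊆ interior K := by
  rintro z ⟨a, b, ha, hb, hab, rfl⟩
  rcases ha.eq_or_lt with rfl | ha
  · rw [zero_smul, zero_add]; exact hK.smul_mem_interior hy (by linarith)
  · exact hK.add_mem_interior (hK.smul_mem_interior hx ha) (hK.smul_mem hb (interior_subset hy))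

theorem isCompact_slice [FiniteDimensional ℝ E] : IsCompact {v ∈ K | φ v = 1} := by
  obtain ⟨B, hB, h⟩ := hK.bound
  refine Metric.isCompact_of_isClosed_isBounded ?_ ?_
  · exact hK.isClosed.inter
      (isClosed_singleton.preimage φ.continuous_of_finiteDimensional : IsClosed (φ ⁻¹' {1}))
  · refine (Metric.isBounded_closedBall (x := (0 : E)) (r := B)).subset fun v hv => ?_
    have := h v hv.1
    rw [hv.2, mul_one] at this
    simpa using this

/-- Bounded Hilbert distance is a closed condition, even when the limit points lie on the boundary
of the cone. -/
theorem coneNear_of_tendsto [FiniteDimensional ℝ E] {r : ℝ} {u v : ℕ → E} {x y : E}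
    (hu : Tendsto u atTop (𝓝 x)) (hv : Tendsto v atTop (𝓝 y)) (huK : ∀ n, u n ∈ K)
    (hvK : ∀ n, v n ∈ K) (hu1 : ∀ n, φ (u n) = 1) (hv1 : ∀ n, φ (v n) = 1)
    (h : ∀ n, ConeNear K r (u n) (v n)) : ConeNear K r x y := by
  choose s t hs ht hst using h
  have hu0 : ∀ n, u n ∈ K \ {0} := fun n => mem_of_pos (φ := φ) (huK n) (by rw [hu1]; norm_num)
  have hv0 : ∀ n, v n ∈ K \ {0} := fun n => mem_of_pos (φ := φ) (hvK n) (by rw [hv1]; norm_num)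
  have hs1 : ∀ n, 1 ≤ s n := fun n => by
    have := hK.div_le_of_mem (hv0 n) (hs n)
    rwa [hu1, hv1, div_one] at this
  have ht1 : ∀ n, 1 ≤ t n := fun n => by
    have := hK.div_le_of_mem (hu0 n) (ht n)
    rwa [hu1, hv1, div_one] at this
  have hs2 : ∀ n, s n ∈ Set.Icc 1 (Real.exp (2 * r)) := fun n =>
    ⟨hs1 n, by nlinarith [hs1 n, ht1 n, hst n]⟩
  have ht2 : ∀ n, t n ∈ Set.Icc 1 (Real.exp (2 * r)) := fun n =>
    ⟨ht1 n, by nlinarith [hs1 n, ht1 n, hst n]⟩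
  obtain ⟨s₀, -, ψ, hψ, hs₀⟩ := exists_subseq_tendsto_Icc hs2
  obtain ⟨t₀, -, ψ', hψ', ht₀⟩ := exists_subseq_tendsto_Icc (fun n => ht2 (ψ n))
  have hs₁ := hs₀.comp hψ'.tendsto_atTop
  have hθ := hψ.tendsto_atTop.comp hψ'.tendsto_atTop
  have hu₁ := hu.comp hθ
  have hv₁ := hv.comp hθ
  refine ⟨s₀, t₀, ?_, ?_, ?_⟩
  · exact hK.isClosed.mem_of_tendsto ((hs₁.smul hv₁).sub hu₁) (Eventually.of_forall fun n => hs _)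
  · exact hK.isClosed.mem_of_tendsto ((ht₀.smul hu₁).sub hv₁) (Eventually.of_forall fun n => ht _)
  · exact le_of_tendsto (hs₁.mul ht₀) (Eventually.of_forall fun n => hst _)

theorem exists_eventually_coneNear [Nontrivial E] {u v : ℕ → E} {x y : E} (hx : x ∈ interior K)
    (hy : y ∈ interior K) (hu : Tendsto u atTop (𝓝 x)) (hv : Tendsto v atTop (𝓝 y)) :
    ∃ r, ∀ᶠ n in atTop, ConeNear K r (u n) (v n) := by
  obtain ⟨s, hs0, hs⟩ := hK.exists_smul_sub_mem_interior hy x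
  obtain ⟨t, ht0, ht⟩ := hK.exists_smul_sub_mem_interior hx y
  have h1 : ∀ᶠ n in atTop, s • v n - u n ∈ interior K :=
    ((hv.const_smul s).sub hu).eventually_mem (isOpen_interior.mem_nhds hs)
  have h2 : ∀ᶠ n in atTop, t • u n - v n ∈ interior K :=
    ((hu.const_smul t).sub hv).eventually_mem (isOpen_interior.mem_nhds ht)
  refine ⟨Real.log (s * t) / 2, ?_⟩
  filter_upwards [h1, h2] with n h1 h2
  refine ⟨s, t, interior_subset h1, interior_subset h2, ?_⟩
  rw [mul_div_cancel₀ _ two_ne_zero, Real.exp_log (by positivity)]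

/-- If segments go away to infinity, as seen from points converging in the interior of the cone,
then the limit segment lies in the boundary. -/
theorem coneSegment_disjoint_interior_of_tendsto [Nontrivial E] {u p a : ℕ → E} {u₀ p₀ a₀ : E}
    (hu : Tendsto u atTop (𝓝 u₀)) (hp : Tendsto p atTop (𝓝 p₀)) (ha : Tendsto a atTop (𝓝 a₀))
    (hu₀ : u₀ ∈ interior K) {r : ℕ → ℝ} (hr : Tendsto r atTop atTop)
    (h : ∀ n, ∀ w ∈ coneSegment (p n) (a n), w ∈ interior K → ¬ ConeNear K (r n) (u n) w) :
    ∀ w ∈ coneSegment p₀ a₀, w ∉ interior K := by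
  rintro w ⟨s, t, hs, ht, hst, rfl⟩ hw
  have hlim : Tendsto (fun n => s • p n + t • a n) atTop (𝓝 (s • p₀ + t • a₀)) :=
    (hp.const_smul s).add (ha.const_smul t)
  obtain ⟨R, hR⟩ := hK.exists_eventually_coneNear hu₀ hw hu hlim
  have h1 := hlim.eventually_mem (isOpen_interior.mem_nhds hw)
  obtain ⟨n, h1, h2, h3⟩ := (h1.and (hR.and (hr.eventually_ge_atTop R))).exists
  exact h n _ ⟨s, t, hs, ht, hst, rfl⟩ h1 (h2.mono h3)

/-- Points close to a boundary point `c` are far from the segment joining an interior point `p` to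
a boundary point `a` that is far from `c` (possibly because it lies in another face). -/
theorem exists_forall_not_coneNear [FiniteDimensional ℝ E] [Nontrivial E] {p a c : E} {r : ℝ}
    (hp : p ∈ interior K) (ha : a ∈ K) (hc : c ∈ K) (hc' : c ∉ interior K) (hp1 : φ p = 1)
    (ha1 : φ a = 1) (hc1 : φ c = 1) (h : ¬ ConeNear K r c a) :
    ∃ ε₀ > (0 : ℝ), ∀ ε : ℝ, 0 < ε → ε < ε₀ → ∀ w ∈ coneSegment p a,
      ¬ ConeNear K r ((1 - ε) • c + ε • p) w := by
  by_contra! hcon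
  have hpos : ∀ n : ℕ, (0 : ℝ) < 1 / ((n : ℝ) + 1) := fun n => by positivity
  choose ε hε0 hε w hw hnear using fun n : ℕ =>
    hcon (1 / ((n : ℝ) + 1) : ℝ) (hpos n)
  choose κ hκ s hs hws using fun n => exists_mem_Icc_of_mem_coneSegment (hw n)
  have hεlim : Tendsto ε atTop (𝓝 0) :=
    squeeze_zero (fun n => (hε0 n).le) (fun n => (hε n).le) tendsto_one_div_add_atTop_nhds_zero_nat
  obtain ⟨s₀, hs₀, ψ, hψ, hlim⟩ := exists_subseq_tendsto_Icc hs
  have hε1 : ∀ n, ε n ≤ 1 := fun n => (hε n).le.trans (by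
    rw [div_le_one (by positivity)]
    have : (0 : ℝ) ≤ n := by positivity
    linarith)
  have hεψ := hεlim.comp hψ.tendsto_atTop
  have key : ConeNear K r c ((1 - s₀) • p + s₀ • a) := by
    have l1 : Tendsto (fun n => (1 - ε (ψ n)) • c + ε (ψ n) • p) atTop
        (𝓝 ((1 - (0 : ℝ)) • c + (0 : ℝ) • p)) :=
      ((tendsto_const_nhds.sub hεψ).smul tendsto_const_nhds).add (hεψ.smul tendsto_const_nhds)
    have l2 : Tendsto (fun n => (1 - s (ψ n)) • p + s (ψ n) • a) atTop
        (𝓝 ((1 - s₀) • p + s₀ • a)) :=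
      ((tendsto_const_nhds.sub hlim).smul tendsto_const_nhds).add (hlim.smul tendsto_const_nhds)
    rw [sub_zero, one_smul, zero_smul, add_zero] at l1
    refine hK.coneNear_of_tendsto l1 l2 (fun n => ?_) (fun n => ?_) (fun n => ?_) (fun n => ?_)
      fun n => ?_
    · exact hK.add_mem (hK.smul_mem (by linarith [hε1 (ψ n)]) hc)
        (hK.smul_mem (hε0 _).le (interior_subset hp))
    · exact hK.add_mem (hK.smul_mem (by linarith [(hs (ψ n)).2]) (interior_subset hp))
        (hK.smul_mem (hs _).1 ha)
    · simp [hc1, hp1]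
    · simp [ha1, hp1]
    · have := hnear (ψ n)
      rw [hws] at this
      have := hK.coneNear_smul_right this (inv_pos.2 (hκ (ψ n)))
      rwa [smul_smul, inv_mul_cancel₀ (hκ (ψ n)).ne', one_smul] at this
  rcases hs₀.2.eq_or_lt with rfl | hlt
  · rw [sub_self, zero_smul, zero_add, one_smul] at key
    exact h key
  · have hint : (1 - s₀) • p + s₀ • a ∈ interior K :=
      hK.add_mem_interior (hK.smul_mem_interior hp (by linarith)) (hK.smul_mem hs₀.1 ha)
    exact hc' (hK.mem_interior_of_samePart hint (mem_of_pos (φ := φ) hc (by rw [hc1]; norm_num))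
      key.samePart.symm)

/-- If the open segment from `x` to `z` is bounded, then its ends lie in the same open face. -/
theorem samePart_of_bounded [FiniteDimensional ℝ E] {x z : E} {R : ℝ}
    (hx : x ∈ K \ {0}) (hz : z ∈ K \ {0}) (hx1 : φ x = 1) (hz1 : φ z = 1)
    (h : ∀ s : ℝ, 0 < s → s < 1 →
      ConeNear K R ((1 - s) • x + s • z) ((1 / 2 : ℝ) • x + (1 / 2 : ℝ) • z)) :
    SamePart K x z := by
  set m := (1 / 2 : ℝ) • x + (1 / 2 : ℝ) • z with hm
  have hmK : m ∈ K := hK.add_mem (hK.smul_mem (by norm_num) hx.1) (hK.smul_mem (by norm_num) hz.1)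
  have hm1 : φ m = 1 := by rw [hm]; simp [hx1, hz1]; norm_num
  have hm0 : m ∈ K \ {0} := mem_of_pos (φ := φ) hmK (by rw [hm1]; norm_num)
  have hseq : Tendsto (fun n : ℕ => 1 / ((n : ℝ) + 1) * (1 / 2)) atTop (𝓝 0) := by
    simpa using (tendsto_one_div_add_atTop_nhds_zero_nat (𝕜 := ℝ)).mul_const (2⁻¹)
  have hs0 : ∀ n : ℕ, 0 < 1 / ((n : ℝ) + 1) * (1 / 2) := fun n => by positivity
  have hs1 : ∀ n : ℕ, 1 / ((n : ℝ) + 1) * (1 / 2) < 1 := fun n => by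
    have : 1 / ((n : ℝ) + 1) ≤ 1 := by
      rw [div_le_one (by positivity)]
      have : (0 : ℝ) ≤ n := by positivity
      linarith
    linarith
  have aux : ∀ x z : E, x ∈ K → z ∈ K → φ x = 1 → φ z = 1 →
      (∀ s : ℝ, 0 < s → s < 1 → ConeNear K R ((1 - s) • x + s • z) m) → ConeNear K R x m := by
    intro x z hx hz hx1 hz1 h
    have l1 : Tendsto (fun n : ℕ => (1 - 1 / ((n : ℝ) + 1) * (1 / 2)) • x +
        (1 / ((n : ℝ) + 1) * (1 / 2)) • z) atTop (𝓝 ((1 - (0 : ℝ)) • x + (0 : ℝ) • z)) :=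
      ((tendsto_const_nhds.sub hseq).smul tendsto_const_nhds).add (hseq.smul tendsto_const_nhds)
    rw [sub_zero, one_smul, zero_smul, add_zero] at l1
    refine hK.coneNear_of_tendsto l1 (tendsto_const_nhds (x := m)) (fun n => ?_) (fun _ => hmK)
      (fun n => ?_) (fun _ => hm1) (fun n => h _ (hs0 n) (hs1 n))
    · exact hK.add_mem (hK.smul_mem (by linarith [hs1 n]) hx) (hK.smul_mem (hs0 n).le hz)
    · simp only [map_add, map_smul, hx1, hz1, smul_eq_mul]; ring
  have h1 := aux x z hx.1 hz.1 hx1 hz1 h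
  have h2 := aux z x hz.1 hx.1 hz1 hx1 fun s hs0 hs1 => by
    have := h (1 - s) (by linarith) (by linarith)
    rwa [sub_sub_cancel, add_comm] at this
  exact hK.samePart_trans hx hm0 hz h1.samePart h2.samePart.symm

/-- A straight segment, sampled at unit intervals, is a rough geodesic. -/
theorem exists_roughGeodesic {x y : E} (hx : x ∈ K \ {0}) (hy : y ∈ K \ {0})
    (h : SamePart K x y) : ∃ (n : ℕ) (γ : ℕ → E), IsRoughGeodesic (coneDist K) 2 x y n γ ∧
      (∀ i, γ i ∈ coneSegment x y) ∧ ∀ w ∈ coneSegment x y, ∃ i ≤ n, coneDist K w (γ i) ≤ 1 := by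
  set d := coneDist K x y with hd
  have hd0 : 0 ≤ d := hK.coneDist_nonneg hx hy h
  have hex : ∀ i : ℕ, ∃ z ∈ coneSegment x y, coneDist K x z = min (i : ℝ) d := fun i =>
    hK.exists_mem_coneSegment_coneDist_eq hx hy h (le_min (Nat.cast_nonneg i) hd0)
      (min_le_right _ _)
  choose z hz hzd using hex
  set n := ⌈d⌉₊ + 1 with hn
  have hdn : d ≤ ⌈d⌉₊ := Nat.le_ceil d
  have hdn' : (⌈d⌉₊ : ℝ) < d + 1 := Nat.ceil_lt_add_one hd0
  set γ : ℕ → E := fun i => if i = 0 then x else if n ≤ i then y else z i with hγ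
  have hseg : ∀ i, γ i ∈ coneSegment x y := by
    intro i
    simp only [hγ]
    split_ifs
    · exact left_mem_coneSegment x y
    · exact right_mem_coneSegment x y
    · exact hz i
  have hdist : ∀ i, coneDist K x (γ i) = min (i : ℝ) d := by
    intro i
    simp only [hγ]
    split_ifs with h1 h2
    · subst h1
      rw [hK.coneDist_self hx]
      simp [hd0]
    · rw [min_eq_right]
      have : (n : ℝ) ≤ i := by exact_mod_cast h2
      rw [hn] at this
      push_cast at this
      linarith
    · exact hzd i
  have hij : ∀ i j, i ≤ j → coneDist K (γ i) (γ j) = min (j : ℝ) d - min (i : ℝ) d := by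
    intro i j hij
    rw [hK.coneDist_eq_abs_sub hx hy h (hseg i) (hseg j), hdist, hdist, abs_sub_comm,
      abs_of_nonneg]
    have : min (i : ℝ) d ≤ min (j : ℝ) d := min_le_min_right d (by exact_mod_cast hij)
    linarith
  refine ⟨n, γ, ⟨by simp [hγ], by simp [hγ, hn], fun i j h1 h2 => ?_, fun i j h1 h2 => ?_⟩,
    hseg, fun w hw => ?_⟩
  · rw [hij i j h1]
    have h3 : (j : ℝ) ≤ n := by exact_mod_cast h2
    rw [hn] at h3
    push_cast at h3
    have h4 : (j : ℝ) - 2 ≤ min (j : ℝ) d := le_min (by linarith) (by linarith)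
    have h5 := min_le_left (i : ℝ) d
    linarith
  · rw [hij i j h1]
    have h3 : (i : ℝ) ≤ j := by exact_mod_cast h1
    rcases le_total (i : ℝ) d with h4 | h4
    · rw [min_eq_left h4]
      have := min_le_left (j : ℝ) d
      linarith
    · rw [min_eq_right h4]
      have := min_le_right (j : ℝ) d
      linarith
  · have h1 : coneDist K x w ≤ d := by
      have := hK.coneDist_add_coneDist hx hy h hw
      have hwK := hK.coneSegment_subset hx hy hw
      have := hK.coneDist_nonneg hwK hy (hK.samePart_trans hwK hx hy
        (hK.samePart_of_mem_coneSegment hx hy h hw).symm h)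
      linarith
    have h0 : 0 ≤ coneDist K x w := hK.coneDist_nonneg hx (hK.coneSegment_subset hx hy hw)
      (hK.samePart_of_mem_coneSegment hx hy h hw)
    refine ⟨⌊coneDist K x w⌋₊, ?_, ?_⟩
    · have : ⌊coneDist K x w⌋₊ ≤ ⌈d⌉₊ := (Nat.floor_le_ceil _).trans (Nat.ceil_mono h1)
      omega
    · have h2 := Nat.floor_le h0
      have h3 := Nat.lt_floor_add_one (coneDist K x w)
      rw [hK.coneDist_eq_abs_sub hx hy h hw (hseg _), hdist, min_eq_left (h2.trans h1),
        abs_of_nonneg] <;> linarith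

end IsSharpCone

end ConeTopology

/-! ### Topology and charts of projective space -/

section ProjectiveSpace

open Projectivization Topology Filter

variable {d : ℕ}

/-- The nonzero vectors that represent points of `A`. -/
def projLifts (A : Set (RP d)) : Set (Fin d → ℝ) :=
  {v | ∃ hv : v ≠ 0, mk ℝ v hv ∈ A}

/-- `A` is the set of the points of projective space represented by the vectors of `P`. -/
def IsProjectivizationOf (A : Set (RP d)) (P : Set (Fin d → ℝ)) : Prop :=
  ∀ (v : Fin d → ℝ) (hv : v ≠ 0), mk ℝ v hv ∈ A ↔ v ∈ P ∨ -v ∈ P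

theorem mk_smul_eq {v : Fin d → ℝ} (hv : v ≠ 0) {t : ℝ} (ht : t ≠ 0)
    (hv' : t • v ≠ 0 := smul_ne_zero ht hv) : (mk ℝ (t • v) hv' : RP d) = mk ℝ v hv :=
  (mk_eq_mk_iff' ℝ _ _ _ _).2 ⟨t, rfl⟩

theorem mk_neg_eq {v : Fin d → ℝ} (hv : v ≠ 0) (hv' : -v ≠ 0 := neg_ne_zero.2 hv) :
    (mk ℝ (-v) hv' : RP d) = mk ℝ v hv :=
  (mk_eq_mk_iff' ℝ _ _ _ _).2 ⟨-1, by simp⟩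

theorem continuous_mk' : Continuous (mk' ℝ : {v : Fin d → ℝ // v ≠ 0} → RP d) :=
  continuous_coinduced_rng

theorem isOpenMap_mk' : IsOpenMap (mk' ℝ : {v : Fin d → ℝ // v ≠ 0} → RP d) := by
  intro U hU
  rw [isOpen_coinduced]
  have h1 : (mk' ℝ : {v : Fin d → ℝ // v ≠ 0} → RP d) ⁻¹' (mk' ℝ '' U) =
      ⋃ t : {t : ℝ // t ≠ 0}, (fun v : {v : Fin d → ℝ // v ≠ 0} =>
        (⟨t.1 • v.1, smul_ne_zero t.2 v.2⟩ : {v : Fin d → ℝ // v ≠ 0})) ⁻¹' U := by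
    ext v
    simp only [Set.mem_preimage, Set.mem_image, Set.mem_iUnion]
    constructor
    · rintro ⟨u, hu, huv⟩
      rw [mk'_eq_mk, mk'_eq_mk, mk_eq_mk_iff'] at huv
      obtain ⟨t, ht⟩ := huv
      refine ⟨⟨t, ?_⟩, ?_⟩
      · rintro rfl
        exact u.2 (by rw [← ht, zero_smul])
      · convert hu
    · rintro ⟨t, ht⟩
      exact ⟨_, ht, mk_smul_eq v.2 t.2⟩
  rw [h1]
  refine isOpen_iUnion fun t => hU.preimage ?_
  exact (continuous_subtype_val.const_smul t.1).subtype_mk _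

theorem isOpen_projLifts {A : Set (RP d)} (hA : IsOpen A) : IsOpen (projLifts A) := by
  have h1 : projLifts A = Subtype.val '' ((mk' ℝ : {v : Fin d → ℝ // v ≠ 0} → RP d) ⁻¹' A) := by
    ext v
    constructor
    · rintro ⟨hv, h⟩
      exact ⟨⟨v, hv⟩, h, rfl⟩
    · rintro ⟨u, hu, rfl⟩
      exact ⟨u.2, hu⟩
  rw [h1]
  exact (isOpen_compl_singleton (x := (0 : Fin d → ℝ))).isOpenMap_subtype_val _
    (hA.preimage continuous_mk')

theorem mk_mem_closure_iff {A : Set (RP d)} {v : Fin d → ℝ} (hv : v ≠ 0) :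
    mk ℝ v hv ∈ closure A ↔ v ∈ closure (projLifts A) := by
  have h1 := isOpenMap_mk'.preimage_closure_eq_closure_preimage continuous_mk' A
  have h2 : mk ℝ v hv ∈ closure A ↔ (⟨v, hv⟩ : {v : Fin d → ℝ // v ≠ 0}) ∈
      mk' ℝ ⁻¹' closure A := Iff.rfl
  rw [h2, h1, closure_subtype]
  have h3 : (Subtype.val '' ((mk' ℝ : {v : Fin d → ℝ // v ≠ 0} → RP d) ⁻¹' A)) = projLifts A := by
    ext v
    constructor
    · rintro ⟨u, hu, rfl⟩
      exact ⟨u.2, hu⟩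
    · rintro ⟨hv, h⟩
      exact ⟨⟨v, hv⟩, h, rfl⟩
  rw [h3]

theorem mk_mem_affChart_iff {φ : Module.Dual ℝ (Fin d → ℝ)} {v : Fin d → ℝ} (hv : v ≠ 0) :
    mk ℝ v hv ∈ affChart φ ↔ φ v ≠ 0 := by
  obtain ⟨a, ha⟩ := exists_smul_eq_mk_rep ℝ v hv
  have h1 : mk ℝ v hv ∈ affChart φ ↔ φ (mk ℝ v hv).rep ≠ 0 := Iff.rfl
  rw [h1, ← ha, Units.smul_def, map_smul, smul_eq_mul]
  simp

theorem affCoord_mk (φ : Module.Dual ℝ (Fin d → ℝ)) {v : Fin d → ℝ} (hv : v ≠ 0) :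
    affCoord φ (mk ℝ v hv) = (φ v)⁻¹ • v := by
  obtain ⟨a, ha⟩ := exists_smul_eq_mk_rep ℝ v hv
  unfold affCoord
  rw [← ha, Units.smul_def, map_smul, smul_eq_mul, smul_smul, mul_inv]
  congr 1
  have := a.ne_zero
  field_simp

theorem apply_affCoord {φ : Module.Dual ℝ (Fin d → ℝ)} {x : RP d} (hx : x ∈ affChart φ) :
    φ (affCoord φ x) = 1 := by
  unfold affCoord
  rw [map_smul, smul_eq_mul, inv_mul_cancel₀ hx]

theorem ne_zero_of_apply_eq_one {φ : Module.Dual ℝ (Fin d → ℝ)} {v : Fin d → ℝ} (h : φ v = 1) :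
    v ≠ 0 := by
  rintro rfl
  simp at h

theorem affCoord_ne_zero {φ : Module.Dual ℝ (Fin d → ℝ)} {x : RP d} (hx : x ∈ affChart φ) :
    affCoord φ x ≠ 0 :=
  ne_zero_of_apply_eq_one (apply_affCoord hx)

theorem mk_affCoord {φ : Module.Dual ℝ (Fin d → ℝ)} {x : RP d} (hx : x ∈ affChart φ)
    (h : affCoord φ x ≠ 0 := affCoord_ne_zero hx) : mk ℝ (affCoord φ x) h = x := by
  conv_rhs => rw [← mk_rep x]
  exact mk_smul_eq x.rep_nonzero (inv_ne_zero hx)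

theorem affCoord_mk_of_eq_one {φ : Module.Dual ℝ (Fin d → ℝ)} {v : Fin d → ℝ} (h : φ v = 1)
    (hv : v ≠ 0 := ne_zero_of_apply_eq_one h) : affCoord φ (mk ℝ v hv) = v := by
  rw [affCoord_mk, h, inv_one, one_smul]

theorem continuousOn_affCoord (φ : Module.Dual ℝ (Fin d → ℝ)) :
    ContinuousOn (affCoord φ) (affChart φ) := by
  have hφ : Continuous φ := φ.continuous_of_finiteDimensional
  intro x hx
  induction x using ind with
  | h v hv =>
  rw [mk_mem_affChart_iff] at hx
  refine ContinuousAt.continuousWithinAt ?_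
  intro s hs
  rw [affCoord_mk] at hs
  have h1 : ContinuousAt (fun u : {v : Fin d → ℝ // v ≠ 0} => (φ u.1)⁻¹ • u.1) ⟨v, hv⟩ :=
    (ContinuousAt.inv₀ (f := fun u : {v : Fin d → ℝ // v ≠ 0} => φ u.1)
      (hφ.comp continuous_subtype_val).continuousAt hx).smul continuous_subtype_val.continuousAt
  have h2 := h1 hs
  have h3 := isOpenMap_mk'.image_mem_nhds h2
  rw [mem_map]
  refine mem_of_superset h3 ?_
  rintro _ ⟨u, hu, rfl⟩
  rw [Set.mem_preimage, mk'_eq_mk, affCoord_mk]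
  exact hu

/-- A convex subset of a chart is closed under addition of representatives of the same sign. -/
theorem mk_add_mem_of_convex {A : Set (RP d)} {φ : Module.Dual ℝ (Fin d → ℝ)}
    (hA : A ⊆ affChart φ) (hconv : Convex ℝ (affCoord φ '' A)) {v w : Fin d → ℝ}
    (hv : v ∈ projLifts A) (hw : w ∈ projLifts A) (h : 0 < φ v * φ w) : v + w ∈ projLifts A := by
  obtain ⟨hv0, hv⟩ := hv
  obtain ⟨hw0, hw⟩ := hw
  have hv1 : φ v ≠ 0 := (mk_mem_affChart_iff hv0).1 (hA hv)
  have hw1 : φ w ≠ 0 := (mk_mem_affChart_iff hw0).1 (hA hw)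
  have hs : φ v + φ w ≠ 0 := by
    intro h0
    have : φ w = -φ v := by linarith
    rw [this] at h
    nlinarith [sq_nonneg (φ v)]
  have hab : φ v / (φ v + φ w) + φ w / (φ v + φ w) = 1 := by field_simp
  have hsq : 0 < (φ v + φ w) ^ 2 := by positivity
  have ha : 0 ≤ φ v / (φ v + φ w) := by
    rw [show φ v / (φ v + φ w) = (φ v * φ v + φ v * φ w) / (φ v + φ w) ^ 2 by field_simp]
    exact div_nonneg (by nlinarith [mul_self_nonneg (φ v)]) hsq.le
  have hb : 0 ≤ φ w / (φ v + φ w) := by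
    rw [show φ w / (φ v + φ w) = (φ w * φ w + φ v * φ w) / (φ v + φ w) ^ 2 by
      field_simp; ring]
    exact div_nonneg (by nlinarith [mul_self_nonneg (φ w)]) hsq.le
  obtain ⟨z, hz, hz'⟩ := hconv (Set.mem_image_of_mem _ hv) (Set.mem_image_of_mem _ hw) ha hb hab
  rw [affCoord_mk, affCoord_mk, smul_smul, smul_smul,
    show φ v / (φ v + φ w) * (φ v)⁻¹ = (φ v + φ w)⁻¹ by field_simp,
    show φ w / (φ v + φ w) * (φ w)⁻¹ = (φ v + φ w)⁻¹ by field_simp, ← smul_add] at hz'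
  have hz0 := affCoord_ne_zero (hA hz)
  have hsum : v + w = (φ v + φ w) • affCoord φ z := by
    rw [hz', smul_smul, mul_inv_cancel₀ hs, one_smul]
  refine ⟨by rw [hsum]; exact smul_ne_zero hs hz0, ?_⟩
  have : mk ℝ (v + w) (by rw [hsum]; exact smul_ne_zero hs hz0) = z := by
    conv_rhs => rw [← mk_affCoord (hA hz)]
    rw [mk_eq_mk_iff']
    exact ⟨φ v + φ w, hsum.symm⟩
  rw [this]; exact hz

theorem smul_mem_projLifts {A : Set (RP d)} {v : Fin d → ℝ} (hv : v ∈ projLifts A) {t : ℝ}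
    (ht : t ≠ 0) : t • v ∈ projLifts A := by
  obtain ⟨hv0, hv⟩ := hv
  exact ⟨smul_ne_zero ht hv0, by rwa [mk_smul_eq hv0 ht]⟩

theorem neg_mem_projLifts {A : Set (RP d)} {v : Fin d → ℝ} (hv : v ∈ projLifts A) :
    -v ∈ projLifts A := by
  simpa using smul_mem_projLifts hv (neg_ne_zero.2 one_ne_zero)

theorem IsProjectivizationOf.projLifts_eq {A : Set (RP d)} {P : Set (Fin d → ℝ)}
    (h : IsProjectivizationOf A P) : projLifts A = (P ∪ -P) \ {0} := by
  ext v
  constructor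
  · rintro ⟨hv, h'⟩
    exact ⟨(h v hv).1 h', hv⟩
  · rintro ⟨h', hv⟩
    exact ⟨hv, (h v hv).2 h'⟩

theorem IsProjectivizationOf.closure {A : Set (RP d)} {P : Set (Fin d → ℝ)}
    (h : IsProjectivizationOf A P) (h0 : (0 : Fin d → ℝ) ∉ P) :
    IsProjectivizationOf (closure A) (closure P) := by
  intro v hv
  have h1 : (P ∪ -P) \ {0} = P ∪ -P := by
    refine Set.sdiff_singleton_eq_self ?_
    simpa using h0
  rw [mk_mem_closure_iff, h.projLifts_eq, h1, closure_union,
    ← show (Homeomorph.neg (Fin d → ℝ)) ⁻¹' _root_.closure P = _root_.closure (-P) from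
      (Homeomorph.neg (Fin d → ℝ)).preimage_closure P]
  rfl

end ProjectiveSpace

/-! ### Cones over convex sets -/

section ConeModel

open Projectivization Topology Filter

variable {d : ℕ}

/-- A description of a properly convex domain `Ω` and of a convex subset `C`, closed in `Ω`, by
closed convex cones: `Ω` consists of the rays in the interior of `K`, and `C` of the rays in
`L ∩ interior K`; the rays of `K` and `L` form the closures. The linear form `φ`, positive on `K`
away from the origin, provides the chart in which representatives are normalized. -/
structure IsConeModel (Ω C : Set (RP d)) (K L : Set (Fin d → ℝ)) (φ : Module.Dual ℝ (Fin d → ℝ)) :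
    Prop where
  nontrivial : Nontrivial (Fin d → ℝ)
  sharp : IsSharpCone K φ
  subset : L ⊆ K
  isClosed : IsClosed L
  add_mem : ∀ {x y : Fin d → ℝ}, x ∈ L → y ∈ L → x + y ∈ L
  smul_mem : ∀ {t : ℝ} {x : Fin d → ℝ}, 0 ≤ t → x ∈ L → t • x ∈ L
  nonempty : (L ∩ interior K).Nonempty
  domain : IsProjectivizationOf Ω (interior K)
  closure_domain : IsProjectivizationOf (closure Ω) K
  convex : IsProjectivizationOf C (L ∩ interior K)
  closure_convex : IsProjectivizationOf (closure C) L

theorem smul_mem_closure {F : Type*} [NormedAddCommGroup F] [NormedSpace ℝ F] {P : Set F}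
    (hne : P.Nonempty) (hP : ∀ {t : ℝ} {x : F}, 0 < t → x ∈ P → t • x ∈ P) {t : ℝ} {x : F}
    (ht : 0 ≤ t) (hx : x ∈ closure P) : t • x ∈ closure P := by
  rcases ht.eq_or_lt with rfl | ht
  · obtain ⟨u, hu⟩ := hne
    rw [zero_smul]
    have h1 : Tendsto (fun n : ℕ => (1 / ((n : ℝ) + 1)) • u) atTop (𝓝 ((0 : ℝ) • u)) :=
      tendsto_one_div_add_atTop_nhds_zero_nat.smul_const u
    rw [zero_smul] at h1
    exact mem_closure_of_tendsto h1 (Eventually.of_forall fun n => hP (by positivity) hu)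
  · exact map_mem_closure (continuous_const_smul t) hx fun y hy => hP ht hy

theorem add_mem_closure {F : Type*} [NormedAddCommGroup F] [NormedSpace ℝ F] {P : Set F}
    (hP : ∀ {x y : F}, x ∈ P → y ∈ P → x + y ∈ P) {x y : F} (hx : x ∈ closure P)
    (hy : y ∈ closure P) : x + y ∈ closure P :=
  map_mem_closure₂ continuous_add hx hy fun _ ha _ hb => hP ha hb

/-- A linear form that does not vanish on a set closed under positive linear combinations of
`v` and `w` has the same sign on `v` and on `w`. -/
theorem apply_mul_apply_pos {F : Type*} [AddCommGroup F] [Module ℝ F] {ψ : F →ₗ[ℝ] ℝ} {v w : F}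
    (hv : ψ v ≠ 0) (hw : ψ w ≠ 0)
    (h : ∀ a b : ℝ, 0 < a → 0 < b → a + b = 1 → ψ (a • v + b • w) ≠ 0) : 0 < ψ v * ψ w := by
  rcases lt_or_gt_of_ne hv with hv | hv <;> rcases lt_or_gt_of_ne hw with hw | hw
  · exact mul_pos_of_neg_of_neg hv hw
  · refine absurd ?_ (h (ψ w / (ψ w - ψ v)) (-ψ v / (ψ w - ψ v)) (div_pos hw (by linarith))
      (div_pos (by linarith) (by linarith)) ?_)
    · rw [map_add, map_smul, map_smul, smul_eq_mul, smul_eq_mul]; ring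
    · have : ψ w - ψ v ≠ 0 := by linarith
      field_simp; ring
  · refine absurd ?_ (h (-ψ w / (ψ v - ψ w)) (ψ v / (ψ v - ψ w)) (div_pos (by linarith)
      (by linarith)) (div_pos hv (by linarith)) ?_)
    · rw [map_add, map_smul, map_smul, smul_eq_mul, smul_eq_mul]; ring
    · have : ψ v - ψ w ≠ 0 := by linarith
      field_simp; ring
  · exact mul_pos hv hw

/-- The cone of those representatives of points of a convex set on which `φ` is positive is closed
under addition; the set may be convex in a chart other than that of `φ`. -/
theorem add_mem_of_isProjConvex {Ω C : Set (RP d)} {φ : Module.Dual ℝ (Fin d → ℝ)}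
    (hΩ : Ω ⊆ affChart φ) (hCΩ : C ⊆ Ω) (hC : IsProjConvex C) {v w : Fin d → ℝ}
    (hv : v ∈ projLifts C) (hw : w ∈ projLifts C) (hv1 : 0 < φ v) (hw1 : 0 < φ w) :
    v + w ∈ projLifts C := by
  obtain ⟨ψ, -, hψ, hconv⟩ := hC
  rcases le_or_gt (ψ v * ψ w) 0 with hneg | hpos
  · exfalso
    have hv2 : ψ v ≠ 0 := (mk_mem_affChart_iff hv.1).1 (hψ hv.2)
    have hw2 : ψ w ≠ 0 := (mk_mem_affChart_iff hw.1).1 (hψ hw.2)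
    have hneg' : ψ v * ψ w < 0 := lt_of_le_of_ne hneg (mul_ne_zero hv2 hw2)
    have h1 : 0 < φ v * φ (-w) := by
      refine apply_mul_apply_pos hv1.ne' (by rw [map_neg]; linarith) fun a b ha hb hab => ?_
      have h2 := mk_add_mem_of_convex hψ hconv (smul_mem_projLifts hv ha.ne')
        (smul_mem_projLifts (neg_mem_projLifts hw) hb.ne') (by
          simp only [map_smul, map_neg, smul_eq_mul]
          have := mul_pos ha hb
          nlinarith)
      exact (mk_mem_affChart_iff h2.1).1 (hΩ (hCΩ h2.2))
    rw [map_neg] at h1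
    nlinarith
  · exact mk_add_mem_of_convex hψ hconv hv hw hpos

theorem isProjectivizationOf_pos {A : Set (RP d)} {φ : Module.Dual ℝ (Fin d → ℝ)}
    (hA : A ⊆ affChart φ) : IsProjectivizationOf A {v | v ∈ projLifts A ∧ 0 < φ v} := by
  intro v hv
  constructor
  · intro h
    have hv' : v ∈ projLifts A := ⟨hv, h⟩
    rcases lt_or_gt_of_ne ((mk_mem_affChart_iff hv).1 (hA h)) with h1 | h1
    · exact Or.inr ⟨neg_mem_projLifts hv', by rw [map_neg]; linarith⟩
    · exact Or.inl ⟨hv', h1⟩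
  · rintro (h | h)
    · exact h.1.2
    · have := neg_mem_projLifts h.1
      rw [neg_neg] at this
      exact this.2

theorem exists_isConeModel {Ω C : Set (RP d)} (hΩ : IsProperlyConvexDomain Ω) (hCΩ : C ⊆ Ω)
    (hne : C.Nonempty) (hcl : IsClosed (Subtype.val ⁻¹' C : Set Ω)) (hC : IsProjConvex C) :
    ∃ K L φ, IsConeModel Ω C K L φ := by
  obtain ⟨hopen, φ, hφ0, hφ, hconv, hbdd⟩ := hΩ
  have hφc : Continuous φ := φ.continuous_of_finiteDimensional
  set P : Set (Fin d → ℝ) := {v | v ∈ projLifts Ω ∧ 0 < φ v} with hP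
  set Q : Set (Fin d → ℝ) := {v | v ∈ projLifts C ∧ 0 < φ v} with hQ
  have hQP : Q ⊆ P := fun v hv => ⟨⟨hv.1.1, hCΩ hv.1.2⟩, hv.2⟩
  have hPo : IsOpen P := (isOpen_projLifts hopen).inter (isOpen_lt continuous_const hφc)
  have hPs : ∀ {t : ℝ} {x : Fin d → ℝ}, 0 < t → x ∈ P → t • x ∈ P := fun {t x} ht hx =>
    ⟨smul_mem_projLifts hx.1 ht.ne', by rw [map_smul]; exact mul_pos ht hx.2⟩
  have hQs : ∀ {t : ℝ} {x : Fin d → ℝ}, 0 < t → x ∈ Q → t • x ∈ Q := fun {t x} ht hx =>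
    ⟨smul_mem_projLifts hx.1 ht.ne', by rw [map_smul]; exact mul_pos ht hx.2⟩
  have hPa : ∀ {x y : Fin d → ℝ}, x ∈ P → y ∈ P → x + y ∈ P := fun {x y} hx hy =>
    ⟨mk_add_mem_of_convex hφ hconv hx.1 hy.1 (mul_pos hx.2 hy.2), by
      rw [map_add]; exact add_pos hx.2 hy.2⟩
  have hQa : ∀ {x y : Fin d → ℝ}, x ∈ Q → y ∈ Q → x + y ∈ Q := fun {x y} hx hy =>
    ⟨add_mem_of_isProjConvex hφ hCΩ hC hx.1 hy.1 hx.2 hy.2, by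
      rw [map_add]; exact add_pos hx.2 hy.2⟩
  have hprojP : IsProjectivizationOf Ω P := isProjectivizationOf_pos hφ
  have hprojQ : IsProjectivizationOf C Q := isProjectivizationOf_pos (hCΩ.trans hφ)
  have h0P : (0 : Fin d → ℝ) ∉ P := fun h => by simpa using h.2
  have h0Q : (0 : Fin d → ℝ) ∉ Q := fun h => h0P (hQP h)
  have hQne : Q.Nonempty := by
    obtain ⟨x, hx⟩ := hne
    have hx' := hφ (hCΩ hx)
    exact ⟨affCoord φ x, ⟨affCoord_ne_zero hx', by rw [mk_affCoord hx']; exact hx⟩, by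
      rw [apply_affCoord hx']; norm_num⟩
  have hPne : P.Nonempty := hQne.mono hQP
  have hPconv : Convex ℝ P := by
    intro x hx y hy a b ha hb hab
    rcases ha.eq_or_lt with rfl | ha
    · rw [zero_add] at hab
      simpa [hab] using hy
    rcases hb.eq_or_lt with rfl | hb
    · rw [add_zero] at hab
      simpa [hab] using hx
    exact hPa (hPs ha hx) (hPs hb hy)
  have hint : interior (closure P) = P := by
    rw [hPconv.interior_closure_eq_interior_of_nonempty_interior (by rwa [hPo.interior_eq]),
      hPo.interior_eq]
  obtain ⟨B, hB0, hB⟩ := hbdd.exists_pos_norm_le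
  have hsharp : IsSharpCone (closure P) φ := by
    refine ⟨isClosed_closure, ?_, add_mem_closure hPa, smul_mem_closure hPne hPs, B, hB0, ?_⟩
    · obtain ⟨u, hu⟩ := hPne
      simpa using smul_mem_closure ⟨u, hu⟩ hPs le_rfl (subset_closure hu)
    · intro x hx
      refine closure_minimal (s := P) (t := {x | ‖x‖ ≤ B * φ x}) (fun x hx => ?_)
        (isClosed_le continuous_norm (continuous_const.mul hφc)) hx
      have h1 := hB _ (Set.mem_image_of_mem (affCoord φ) hx.1.2)
      rw [affCoord_mk, norm_smul, norm_inv, Real.norm_of_nonneg hx.2.le, inv_mul_le_iff₀ hx.2] at h1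
      show ‖x‖ ≤ B * φ x
      linarith
  have hclC : ∀ x ∈ closure C, x ∈ Ω → x ∈ C := by
    intro x hx hxΩ
    obtain ⟨T, hT, hT'⟩ := isClosed_induced_iff.1 hcl
    have h1 : C ⊆ T := fun y hy => by
      have : (⟨y, hCΩ hy⟩ : Ω) ∈ (Subtype.val ⁻¹' T : Set Ω) := by rw [hT']; exact hy
      exact this
    have h2 : (⟨x, hxΩ⟩ : Ω) ∈ (Subtype.val ⁻¹' T : Set Ω) := closure_minimal h1 hT hx
    rw [hT'] at h2
    exact h2
  have hclQ := hprojQ.closure h0Q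
  have hQeq : closure Q ∩ interior (closure P) = Q := by
    rw [hint]
    refine Set.Subset.antisymm (fun v hv => ?_) fun v hv => ⟨subset_closure hv, hQP hv⟩
    have hv0 : v ≠ 0 := by rintro rfl; exact h0P hv.2
    exact ⟨⟨hv0, hclC _ ((hclQ v hv0).2 (Or.inl hv.1)) hv.2.1.2⟩, hv.2.2⟩
  have hnt : Nontrivial (Fin d → ℝ) := by
    obtain ⟨v, hv⟩ := hQne
    exact ⟨v, 0, hv.1.1⟩
  refine ⟨closure P, closure Q, φ, hnt, hsharp, closure_mono hQP, isClosed_closure,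
    add_mem_closure hQa,
    smul_mem_closure hQne hQs, by rwa [hQeq], by rwa [hint], hprojP.closure h0P, by rwa [hQeq],
    hclQ⟩

end ConeModel

/-! ### Open faces and the Hilbert metric in terms of cones -/

section Part

variable {E : Type*} [NormedAddCommGroup E] [NormedSpace ℝ E]

/-- The relative interior of the face of the cone `K` that contains `x` in its relative
interior. -/
def conePart (K : Set E) (x : E) : Set E :=
  {y | y ∈ K \ {0} ∧ SamePart K x y}

namespace IsSharpCone

open Topology Filter

variable {K : Set E} {φ : E →ₗ[ℝ] ℝ} (hK : IsSharpCone K φ)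
include hK

theorem self_mem_conePart {x : E} (hx : x ∈ K \ {0}) : x ∈ conePart K x :=
  ⟨hx, hK.samePart_refl x⟩

omit hK in
theorem conePart_subset {x : E} : conePart K x ⊆ K := fun _ hy => hy.1.1

theorem samePart_of_mem_conePart {x y z : E} (hx : x ∈ K \ {0}) (hy : y ∈ conePart K x)
    (hz : z ∈ conePart K x) : SamePart K y z :=
  hK.samePart_trans hy.1 hx hz.1 hy.2.symm hz.2

theorem smul_mem_conePart {x y : E} (hx : x ∈ K \ {0}) (hy : y ∈ conePart K x) {t : ℝ}
    (ht : 0 < t) : t • y ∈ conePart K x :=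
  ⟨hK.smul_mem_of_pos hy.1 ht, hK.samePart_trans hx hy.1 (hK.smul_mem_of_pos hy.1 ht) hy.2
    (hK.samePart_smul y ht)⟩

theorem mem_conePart_of_samePart {x y z : E} (hx : x ∈ K \ {0}) (hy : y ∈ conePart K x)
    (hz : z ∈ K \ {0}) (h : SamePart K y z) : z ∈ conePart K x :=
  ⟨hz, hK.samePart_trans hx hy.1 hz hy.2 h⟩

theorem conePart_eq_interior [Nontrivial E] {x : E} (hx : x ∈ interior K) :
    conePart K x = interior K :=
  Set.Subset.antisymm (fun _ hy => hK.mem_interior_of_samePart hx hy.1 hy.2)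
    fun _ hy => ⟨hK.interior_subset_ne_zero hy, hK.samePart_of_mem_interior hx hy⟩

theorem conePart_eq_of_mem {x y : E} (hx : x ∈ K \ {0}) (hy : y ∈ conePart K x) :
    conePart K y = conePart K x :=
  Set.Subset.antisymm (fun _ hz => hK.mem_conePart_of_samePart hx hy hz.1 hz.2)
    fun _ hz => ⟨hz.1, hK.samePart_of_mem_conePart hx hy hz⟩

/-- Beyond the least factor `t` with `x ≤ t y`, the difference lies in the relative interior of the
face. -/
theorem smul_sub_mem_conePart {x y : E} (hx : x ∈ K \ {0}) (hy : y ∈ K \ {0})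
    (h : SamePart K x y) {t : ℝ} (ht : coneRatio K x y < t) :
    t • y - x ∈ K \ {0} ∧ SamePart K x (t • y - x) := by
  have h0 := hK.coneRatio_mem hy h.1
  have hpos := hK.coneRatio_pos hx hy h.1
  set α := coneRatio K x y
  have e1 : t • y - x = (t - α) • y + (α • y - x) := by module
  have hm : t • y - x ∈ K \ {0} := by
    rw [e1]
    exact hK.add_mem_ne_zero (hK.smul_mem_of_pos hy (by linarith)) h0
  refine ⟨hm, hK.samePart_trans hx hy hm h ⟨⟨(t - α)⁻¹, ?_⟩, ⟨t, ?_⟩⟩⟩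
  · rw [e1, smul_add, smul_smul, inv_mul_cancel₀ (by linarith), one_smul, add_sub_cancel_left]
    exact hK.smul_mem (inv_nonneg.2 (by linarith)) h0
  · rw [sub_sub_cancel]; exact hx.1

/-- At the least factor `t` with `x ≤ t y`, the difference leaves the relative interior of the
face. -/
theorem not_samePart_coneRatio_smul_sub {x y : E} (hy : y ∈ K \ {0})
    (hne : coneRatio K x y • y - x ∈ K \ {0}) :
    ¬ SamePart K y (coneRatio K x y • y - x) := by
  rintro ⟨⟨s, hs⟩, -⟩
  have hs0 := hK.pos_of_mem hy hne hs
  set α := coneRatio K x y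
  have h1 := hK.smul_mem (inv_pos.2 hs0).le hs
  have e1 : s⁻¹ • (s • (α • y - x) - y) = (α - s⁻¹) • y - x := by
    rw [smul_sub, smul_smul, inv_mul_cancel₀ hs0.ne', one_smul]; module
  rw [e1] at h1
  have h2 := hK.coneRatio_le hy h1
  have h3 := inv_pos.2 hs0
  linarith

/-- The parts of a cone are open in their span. -/
theorem exists_ball_inter_span_subset_conePart [FiniteDimensional ℝ E] {x v : E}
    (hx : x ∈ K \ {0}) (hv : v ∈ conePart K x) : ∃ δ > (0 : ℝ),
      ∀ w ∈ Submodule.span ℝ (conePart K x),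
      dist w v < δ → w ∈ conePart K x := by
  set S := Submodule.span ℝ (conePart K x) with hS
  have hvS : v ∈ S := Submodule.subset_span hv
  have hvne : (⟨v, hvS⟩ : S) ≠ 0 := fun h => hv.1.2 (congrArg Subtype.val h)
  have : Nontrivial S := ⟨⟨_, _, hvne⟩⟩
  set KS : Set S := Subtype.val ⁻¹' K with hKS
  have hsharp : IsSharpCone KS (φ ∘ₗ S.subtype) := by
    obtain ⟨B, hB, h⟩ := hK.bound
    exact ⟨hK.isClosed.preimage continuous_subtype_val, hK.zero_mem, fun hx hy => hK.add_mem hx hy,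
      fun ht hx => hK.smul_mem ht hx, B, hB, fun y hy => h y hy⟩
  have hspan : Submodule.span ℝ KS = ⊤ := by
    rw [eq_top_iff, ← Submodule.span_span_coe_preimage (R := ℝ) (s := conePart K x)]
    exact Submodule.span_mono fun y hy => show y.1 ∈ K from conePart_subset (x := x) hy
  have hne : (interior KS).Nonempty := by
    rw [hsharp.convex.interior_nonempty_iff_affineSpan_eq_top,
      AffineSubspace.affineSpan_eq_top_iff_vectorSpan_eq_top_of_nonempty ℝ S S
        ⟨0, hsharp.zero_mem⟩, vectorSpan_eq_span_vsub_set_right ℝ hsharp.zero_mem]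
    simpa using hspan
  obtain ⟨u, hu⟩ := hne
  -- every vector of the span is dominated by `v`
  have hdom : ∀ w ∈ S, (∃ t : ℝ, 0 ≤ t ∧ t • v - w ∈ K) ∧ ∃ t : ℝ, 0 ≤ t ∧ t • v + w ∈ K := by
    intro w hw
    induction hw using Submodule.span_induction with
    | mem w hw =>
      obtain ⟨t, ht⟩ := (hK.samePart_of_mem_conePart hx hw hv).1
      exact ⟨⟨t, (hK.pos_of_mem hw.1 hv.1 ht).le, ht⟩, ⟨0, le_rfl, by simpa using hw.1.1⟩⟩
    | zero => exact ⟨⟨0, le_rfl, by simpa using hK.zero_mem⟩,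
        ⟨0, le_rfl, by simpa using hK.zero_mem⟩⟩
    | add w w' _ _ h h' =>
      obtain ⟨⟨s, hs0, hs⟩, ⟨t, ht0, ht⟩⟩ := h
      obtain ⟨⟨s', hs0', hs'⟩, ⟨t', ht0', ht'⟩⟩ := h'
      refine ⟨⟨s + s', by linarith, ?_⟩, ⟨t + t', by linarith, ?_⟩⟩
      · convert hK.add_mem hs hs' using 1; module
      · convert hK.add_mem ht ht' using 1; module
    | smul c w _ h =>
      obtain ⟨⟨s, hs0, hs⟩, ⟨t, ht0, ht⟩⟩ := h
      rcases le_total 0 c with hc | hc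
      · refine ⟨⟨c * s, by positivity, ?_⟩, ⟨c * t, by positivity, ?_⟩⟩
        · convert hK.smul_mem hc hs using 1; module
        · convert hK.smul_mem hc ht using 1; module
      · have hc' : 0 ≤ -c := by linarith
        refine ⟨⟨-c * t, by positivity, ?_⟩, ⟨-c * s, by positivity, ?_⟩⟩
        · convert hK.smul_mem hc' ht using 1; module
        · convert hK.smul_mem hc' hs using 1; module
  have hvint : (⟨v, hvS⟩ : S) ∈ interior KS := by
    obtain ⟨⟨t, ht0, ht⟩, -⟩ := hdom u u.2
    have ht' : t • (⟨v, hvS⟩ : S) - u ∈ KS := ht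
    have h1 := hsharp.add_mem_interior hu ht'
    rw [add_sub_cancel] at h1
    rcases ht0.eq_or_lt with rfl | ht0
    · rw [zero_smul] at h1
      exact absurd rfl (hsharp.interior_subset_ne_zero h1).2
    · have := hsharp.smul_mem_interior h1 (inv_pos.2 ht0)
      rwa [smul_smul, inv_mul_cancel₀ ht0.ne', one_smul] at this
  obtain ⟨δ, hδ, hball⟩ := Metric.isOpen_iff.1 isOpen_interior _ hvint
  refine ⟨δ, hδ, fun w hw hdist => ?_⟩
  have hwint : (⟨w, hw⟩ : S) ∈ interior KS := hball (by rw [Metric.mem_ball]; exact hdist)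
  have h2 := hsharp.interior_subset_ne_zero hwint
  obtain ⟨⟨s, hs⟩, ⟨t, ht⟩⟩ := hsharp.samePart_of_mem_interior hvint hwint
  refine hK.mem_conePart_of_samePart hx hv ⟨h2.1, fun h => h2.2 (Subtype.ext h)⟩
    ⟨⟨s, hs⟩, ⟨t, ht⟩⟩

end IsSharpCone

end Part

section Between

variable {E : Type*} [AddCommGroup E] [Module ℝ E]

theorem sbtw_of_eq {a x y : E} {c : ℝ} (hc : 0 < c) (hxy : x ≠ y) (ha : a = x + c • (x - y)) :
    Sbtw ℝ a x y := by
  have h1 : x - y ≠ 0 := sub_ne_zero.2 hxy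
  refine ⟨⟨c / (1 + c), ⟨by positivity, by rw [div_le_one (by positivity)]; linarith⟩, ?_⟩, ?_, hxy⟩
  · rw [AffineMap.lineMap_apply_module, ha,
      show 1 - c / (1 + c) = 1 / (1 + c) by field_simp; ring]
    have h2 : (1 / (1 + c)) * (1 + c) = 1 := by field_simp
    have h3 : c / (1 + c) = (1 / (1 + c)) * c := by field_simp
    calc (1 / (1 + c)) • (x + c • (x - y)) + (c / (1 + c)) • y
        = ((1 / (1 + c)) * (1 + c)) • x - ((1 / (1 + c)) * c - c / (1 + c)) • y := by module
      _ = x := by rw [h2, h3]; simp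
  · rw [ha]
    intro h
    have h2 : c • (x - y) = 0 := by simpa using h.symm
    exact (smul_ne_zero hc.ne' h1) h2

theorem exists_eq_of_sbtw {a x y : E} (h : Sbtw ℝ a x y) :
    ∃ c : ℝ, 0 < c ∧ a = x + c • (x - y) := by
  obtain ⟨⟨s, ⟨hs0, hs1⟩, hs⟩, hxa, hxy⟩ := h
  rw [AffineMap.lineMap_apply_module] at hs
  have h1 : s ≠ 0 := by
    rintro rfl
    exact hxa (by rw [← hs]; simp)
  have h2 : s ≠ 1 := by
    rintro rfl
    exact hxy (by rw [← hs]; simp)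
  have h3 : 0 < 1 - s := by
    have := lt_of_le_of_ne hs1 h2
    linarith
  have h4 : 0 < s := lt_of_le_of_ne hs0 (Ne.symm h1)
  refine ⟨s / (1 - s), by positivity, ?_⟩
  have e1 : (1 - s)⁻¹ * (1 - s) = 1 := inv_mul_cancel₀ h3.ne'
  have e2 : 1 + s / (1 - s) = (1 - s)⁻¹ := by field_simp; ring
  have e3 : s / (1 - s) = (1 - s)⁻¹ * s := by field_simp
  calc a = ((1 - s)⁻¹ * (1 - s)) • a := by rw [e1, one_smul]
    _ = (1 - s)⁻¹ • (((1 - s) • a + s • y)) - ((1 - s)⁻¹ * s) • y := by module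
    _ = (1 + s / (1 - s)) • x - (s / (1 - s)) • y := by rw [hs, e2, e3]
    _ = _ := by module

end Between

theorem crossRatio_eq {d : ℕ} {φ : Module.Dual ℝ (Fin d → ℝ)} {a x y b : RP d} {c c' : ℝ}
    (hc : 0 < c) (hc' : 0 < c') (hxy : affCoord φ x ≠ affCoord φ y)
    (ha : affCoord φ a = affCoord φ x + c • (affCoord φ x - affCoord φ y))
    (hb : affCoord φ b = affCoord φ y + c' • (affCoord φ y - affCoord φ x)) :
    crossRatio φ a x y b = ((1 + c) / c) * ((1 + c') / c') := by
  unfold crossRatio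
  set u := affCoord φ x
  set v := affCoord φ y
  have h0 : 0 < ‖u - v‖ := norm_pos_iff.2 (sub_ne_zero.2 hxy)
  have h1 : ‖v - u‖ = ‖u - v‖ := norm_sub_rev v u
  have e1 : u - affCoord φ b = (1 + c') • (u - v) := by rw [hb]; module
  have e2 : v - affCoord φ a = (1 + c) • (v - u) := by rw [ha]; module
  have e3 : u - affCoord φ a = c • (v - u) := by rw [ha]; module
  have e4 : v - affCoord φ b = c' • (u - v) := by rw [hb]; module
  rw [e1, e2, e3, e4, norm_smul, norm_smul, norm_smul, norm_smul, h1,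
    Real.norm_of_nonneg (by positivity), Real.norm_of_nonneg (by positivity),
    Real.norm_of_nonneg hc.le, Real.norm_of_nonneg hc'.le]
  field_simp

section Dictionary

open Projectivization Topology Filter

variable {d : ℕ} {K : Set (Fin d → ℝ)} {φ : Module.Dual ℝ (Fin d → ℝ)}

theorem ne_zero_of_mem_diff {x : Fin d → ℝ} (hx : x ∈ K \ {0}) : x ≠ 0 := fun h => hx.2 h

namespace IsSharpCone

section Collinear

variable (hK : IsSharpCone K φ)
include hK

theorem add_mem_conePart {x y z : Fin d → ℝ} (hx : x ∈ K \ {0}) (hy : y ∈ conePart K x)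
    (hz : z ∈ conePart K x) : y + z ∈ conePart K x := by
  have h := hK.samePart_add_smul hz.1.1 (hK.samePart_of_mem_conePart hx hy hz) zero_le_one
  rw [one_smul] at h
  exact hK.mem_conePart_of_samePart hx hy (hK.add_mem_ne_zero hy.1 hz.1.1) h

/-- The line through `x` and `y` leaves the part of `x` at a point determined by the ratio of `y`
to `x`. -/
theorem coneRatio_eq_of_boundary {x y : Fin d → ℝ} (hx : x ∈ K \ {0}) (hy : y ∈ conePart K x)
    {c c' : ℝ} (hc : 0 < c) (hc' : 0 < c') (ha : x + c • (x - y) ∈ K ∨ -(x + c • (x - y)) ∈ K)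
    (haP : x + c • (x - y) ∉ conePart K x) (hbP : y + c' • (y - x) ∉ conePart K x) :
    coneRatio K y x = (1 + c) / c := by
  have hm : c * ((1 + c) / c) = 1 + c := by field_simp
  have hm' : c' * ((1 + c') / c') = 1 + c' := by field_simp
  have ea : x + c • (x - y) = c • (((1 + c) / c) • x - y) := by
    rw [smul_sub c (_ • x), smul_smul, hm]; module
  have eb : y + c' • (y - x) = c' • (((1 + c') / c') • y - x) := by
    rw [smul_sub c' (_ • y), smul_smul, hm']; module
  have hgt : 1 < (1 + c) / c := by rw [lt_div_iff₀ hc]; linarith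
  have hgt' : 1 < (1 + c') / c' := by rw [lt_div_iff₀ hc']; linarith
  rcases ha with ha | ha
  · rw [ea] at ha
    have h1 := hK.smul_mem (inv_pos.2 hc).le ha
    rw [smul_smul, inv_mul_cancel₀ hc.ne', one_smul] at h1
    refine le_antisymm (hK.coneRatio_le hx h1) ?_
    by_contra hlt
    push Not at hlt
    have h2 := hK.smul_sub_mem_conePart hy.1 hx hy.2.symm hlt
    refine haP ?_
    rw [ea]
    exact hK.smul_mem_conePart hx (hK.mem_conePart_of_samePart hx hy h2.1 h2.2) hc
  · exfalso
    set β := (1 + c) / c with hβ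
    have hβ0 : 0 < β := by linarith
    have h1 := hK.smul_mem (inv_pos.2 (mul_pos hc hβ0)).le ha
    have e1 : (c * β)⁻¹ • -(x + c • (x - y)) = β⁻¹ • y - x := by
      have i1 : (c * β)⁻¹ * (c * β) = 1 := inv_mul_cancel₀ (by positivity)
      have i2 : (c * β)⁻¹ * c = β⁻¹ := by field_simp
      calc (c * β)⁻¹ • -(x + c • (x - y))
          = ((c * β)⁻¹ * c) • y - ((c * β)⁻¹ * (c * β)) • x := by rw [ea]; module
        _ = _ := by rw [i1, i2, one_smul]
    rw [e1] at h1
    have h2 := hK.coneRatio_le hy.1 h1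
    have h3 : β⁻¹ < 1 := inv_lt_one_of_one_lt₀ hgt
    have h4 := hK.smul_sub_mem_conePart hx hy.1 hy.2 (h2.trans_lt (h3.trans hgt'))
    refine hbP ?_
    rw [eb]
    exact hK.smul_mem_conePart hx ⟨h4.1, h4.2⟩ hc'

/-- The cross ratio of the four points on a line meeting the part of `x` is determined by their
order: the two outer points are those where the line leaves the part. -/
theorem log_crossRatio_eq_coneDist {x y : Fin d → ℝ} (hx : x ∈ K \ {0})
    (hy : y ∈ conePart K x ∨ -y ∈ conePart K x) {c c' : ℝ} (hc : 0 < c) (hc' : 0 < c')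
    (ha : x + c • (x - y) ∈ K ∨ -(x + c • (x - y)) ∈ K)
    (hb : y + c' • (y - x) ∈ K ∨ -(y + c' • (y - x)) ∈ K)
    (haP : x + c • (x - y) ∉ conePart K x) (hbP : y + c' • (y - x) ∉ conePart K x) :
    y ∈ conePart K x ∧
      1 / 2 * Real.log (((1 + c) / c) * ((1 + c') / c')) = coneDist K x y := by
  rcases hy with hy | hy
  · refine ⟨hy, ?_⟩
    have hP := hK.conePart_eq_of_mem hx hy
    have h1 := hK.coneRatio_eq_of_boundary hx hy hc hc' ha haP hbP
    have h2 := hK.coneRatio_eq_of_boundary hy.1 ⟨hx, hy.2.symm⟩ hc' hc hb (by rwa [hP])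
      (by rwa [hP])
    unfold coneDist
    rw [h1, h2, mul_comm (_ / c)]
  · refine absurd ?_ haP
    have h1 : x + c • (x - y) = (1 + c) • x + c • -y := by module
    rw [h1]
    exact hK.add_mem_conePart hx (hK.smul_mem_conePart hx (hK.self_mem_conePart hx) (by linarith))
      (hK.smul_mem_conePart hx hy hc)

end Collinear

section Boundary

variable (hK : IsSharpCone K φ) {F : Set (RP d)} {x : Fin d → ℝ}
include hK

theorem projRelint_eq (hx : x ∈ K \ {0}) (hF : IsProjectivizationOf F (conePart K x)) :
    projRelint F = F := by
  have hspan : projSpan F ≤ Submodule.span ℝ (conePart K x) := by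
    refine iSup₂_le fun z hz => ?_
    induction z using ind with
    | h v hv =>
    rw [submodule_mk, Submodule.span_singleton_le_iff_mem]
    rcases (hF v hv).1 hz with h | h
    · exact Submodule.subset_span h
    · rw [← neg_mem_iff]; exact Submodule.subset_span h
  have hmem : ∀ v (hv : v ≠ 0), v ∈ conePart K x → Projectivization.mk ℝ v hv ∈ projRelint F := by
    intro v hv hvP
    refine ⟨le_iSup₂_of_le (Projectivization.mk ℝ v hv) ((hF v hv).2 (Or.inl hvP)) le_rfl, ?_⟩
    obtain ⟨δ, hδ, h⟩ := hK.exists_ball_inter_span_subset_conePart hx hvP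
    refine ⟨mk' ℝ '' {w | dist w.1 v < δ}, isOpenMap_mk' _ ?_, ⟨⟨v, hv⟩, ?_, rfl⟩, ?_⟩
    · exact isOpen_lt (continuous_subtype_val.dist continuous_const) continuous_const
    · simpa using hδ
    · rintro _ ⟨w, hw, rfl⟩ hsub
      rw [mk'_eq_mk, submodule_mk, Submodule.span_singleton_le_iff_mem] at hsub
      exact (hF w.1 w.2).2 (Or.inl (h w.1 (hspan hsub) hw))
  refine Set.Subset.antisymm ?_ fun z hz => ?_
  · rintro z ⟨hz, U, -, hzU, hU⟩
    exact hU z hzU hz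
  · induction z using ind with
    | h v hv =>
    rcases (hF v hv).1 hz with h | h
    · exact hmem v hv h
    · rw [← mk_neg_eq hv]; exact hmem _ _ h

theorem mk_mem_projBoundary_iff (hx : x ∈ K \ {0}) (hF : IsProjectivizationOf F (conePart K x))
    {a : Fin d → ℝ} (ha : a ≠ 0) : Projectivization.mk ℝ a ha ∈ projBoundary F ↔
      (a ∈ closure (conePart K x) ∨ -a ∈ closure (conePart K x)) ∧ a ∉ conePart K x ∧
        -a ∉ conePart K x := by
  have h0 : (0 : Fin d → ℝ) ∉ conePart K x := fun h => h.1.2 rfl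
  unfold projBoundary
  rw [hK.projRelint_eq hx hF, Set.mem_sdiff, hF.closure h0, hF a ha, not_or]

theorem closure_conePart_subset : closure (conePart K x) ⊆ K :=
  closure_minimal conePart_subset hK.isClosed

theorem exists_boundary_point (hx : x ∈ K \ {0}) (hF : IsProjectivizationOf F (conePart K x))
    (hx1 : φ x = 1) {y : Fin d → ℝ} (hy : y ∈ conePart K x) (hy1 : φ y = 1) (hxy : x ≠ y) :
    1 < coneRatio K y x ∧ ∀ h : x + (coneRatio K y x - 1)⁻¹ • (x - y) ≠ 0,
      Projectivization.mk ℝ (x + (coneRatio K y x - 1)⁻¹ • (x - y)) h ∈ projBoundary F := by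
  have hmem := hK.coneRatio_mem hx hy.2.2
  have hgt : 1 < coneRatio K y x := by
    have h1 := hK.div_le_of_mem hx hmem
    rw [hx1, hy1, div_one] at h1
    refine lt_of_le_of_ne h1 fun h => hxy ?_
    rw [← h, one_smul] at hmem
    by_contra hne
    have h2 := hK.pos (x := x - y) ⟨hmem, sub_ne_zero.2 hne⟩
    rw [map_sub, hx1, hy1, sub_self] at h2
    exact lt_irrefl _ h2
  refine ⟨hgt, fun h => ?_⟩
  set β := coneRatio K y x with hβ
  have hc : 0 < (β - 1)⁻¹ := inv_pos.2 (by linarith)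
  have ea : x + (β - 1)⁻¹ • (x - y) = (β - 1)⁻¹ • (β • x - y) := by
    have e1 : (β - 1)⁻¹ * (β - 1) = 1 := inv_mul_cancel₀ (by linarith)
    calc x + (β - 1)⁻¹ • (x - y) = (1 : ℝ) • x + (β - 1)⁻¹ • (x - y) := by rw [one_smul]
      _ = ((β - 1)⁻¹ * (β - 1)) • x + (β - 1)⁻¹ • (x - y) := by rw [e1]
      _ = _ := by module
  have hne : β • x - y ∈ K \ {0} := by
    refine ⟨hmem, fun h0 => h ?_⟩
    rw [Set.mem_singleton_iff] at h0
    rw [ea, h0, smul_zero]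
  have hcl : β • x - y ∈ closure (conePart K x) := by
    have hlim : Tendsto (fun n : ℕ => (β + 1 / ((n : ℝ) + 1)) • x - y) atTop
        (𝓝 ((β + 0) • x - y)) :=
      ((tendsto_const_nhds.add tendsto_one_div_add_atTop_nhds_zero_nat).smul_const x).sub
        tendsto_const_nhds
    rw [add_zero] at hlim
    refine mem_closure_of_tendsto hlim (Eventually.of_forall fun n => ?_)
    have hn : (0 : ℝ) < 1 / ((n : ℝ) + 1) := by positivity
    have h1 := hK.smul_sub_mem_conePart hy.1 hx hy.2.symm
      (show coneRatio K y x < β + 1 / ((n : ℝ) + 1) by rw [← hβ]; linarith)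
    exact hK.mem_conePart_of_samePart hx hy h1.1 h1.2
  rw [hK.mk_mem_projBoundary_iff hx hF, ea]
  refine ⟨Or.inl (smul_mem_closure ⟨x, hK.self_mem_conePart hx⟩
    (fun ht hz => hK.smul_mem_conePart hx hz ht) hc.le hcl), fun h1 => ?_, fun h1 => ?_⟩
  · have h2 := hK.smul_mem_conePart hx h1 (inv_pos.2 hc)
    rw [smul_smul, inv_mul_cancel₀ hc.ne', one_smul] at h2
    exact hK.not_samePart_coneRatio_smul_sub hx hne h2.2
  · exact hK.not_neg_mem (hK.smul_mem_of_pos hne hc) h1.1.1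

end Boundary

variable (hK : IsSharpCone K φ) {F : Set (RP d)} {x y : Fin d → ℝ}
include hK

theorem coneDist_eq_zero_of_mk_eq (hx : x ∈ K \ {0}) (hy : y ∈ K \ {0})
    (h : (Projectivization.mk ℝ x (ne_zero_of_mem_diff hx) : RP d) =
      Projectivization.mk ℝ y (ne_zero_of_mem_diff hy)) :
      coneDist K x y = 0 := by
  obtain ⟨t, ht⟩ := (mk_eq_mk_iff' ℝ _ _ _ _).1 h
  have h1 := hK.pos hx
  rw [← ht, map_smul, smul_eq_mul] at h1
  have ht0 : 0 < t := pos_of_mul_pos_left h1 (hK.pos hy).le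
  rw [← ht, hK.coneDist_smul_left hy hy (hK.samePart_refl y) ht0, hK.coneDist_self hy]

theorem isHilbertDist_coneDist (hx : x ∈ K \ {0}) (hF : IsProjectivizationOf F (conePart K x))
    (hy : y ∈ conePart K x) :
    IsHilbertDist F (Projectivization.mk ℝ x (ne_zero_of_mem_diff hx))
      (Projectivization.mk ℝ y (ne_zero_of_mem_diff hy.1))
      (coneDist K x y) := by
  by_cases hne : (Projectivization.mk ℝ x (ne_zero_of_mem_diff hx) : RP d) =
      Projectivization.mk ℝ y (ne_zero_of_mem_diff hy.1)
  · exact Or.inl ⟨hne, hK.coneDist_eq_zero_of_mk_eq hx hy.1 hne⟩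
  right
  have px := hK.pos hx
  have py := hK.pos hy.1
  set x' := (φ x)⁻¹ • x with hx'
  set y' := (φ y)⁻¹ • y with hy'
  have hxm : x' ∈ K \ {0} := hK.smul_mem_of_pos hx (inv_pos.2 px)
  have hx1 : φ x' = 1 := by rw [hx', map_smul, smul_eq_mul, inv_mul_cancel₀ px.ne']
  have hy1 : φ y' = 1 := by rw [hy', map_smul, smul_eq_mul, inv_mul_cancel₀ py.ne']
  have hP := hK.conePart_eq_of_mem hx
    (hK.smul_mem_conePart hx (hK.self_mem_conePart hx) (inv_pos.2 px))
  rw [← hx'] at hP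
  have hym : y' ∈ conePart K x' := by
    rw [hP]; exact hK.smul_mem_conePart hx hy (inv_pos.2 py)
  have hP' := hK.conePart_eq_of_mem hxm hym
  have hmx : Projectivization.mk ℝ x' (ne_zero_of_mem_diff hxm) =
      Projectivization.mk ℝ x (ne_zero_of_mem_diff hx) :=
      mk_smul_eq (ne_zero_of_mem_diff hx) (inv_pos.2 px).ne'
  have hmy : Projectivization.mk ℝ y' (ne_zero_of_mem_diff hym.1) =
      Projectivization.mk ℝ y (ne_zero_of_mem_diff hy.1) :=
      mk_smul_eq (ne_zero_of_mem_diff hy.1) (inv_pos.2 py).ne'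
  have hxy : x' ≠ y' := by
    intro h
    refine hne ?_
    rw [← hmx, ← hmy]
    congr 1
  have hd : coneDist K x y = coneDist K x' y' := by
    rw [hx', hK.coneDist_smul_left hx hym.1 (hK.samePart_trans hx hy.1 hym.1 hy.2
      (hK.samePart_smul y (inv_pos.2 py))) (inv_pos.2 px), hy',
      hK.coneDist_smul_right hx hy.1 hy.2 (inv_pos.2 py)]
  have hF' : IsProjectivizationOf F (conePart K x') := by rwa [hP]
  have hF'' : IsProjectivizationOf F (conePart K y') := by rwa [hP']
  obtain ⟨hβ, ha⟩ := hK.exists_boundary_point hxm hF' hx1 hym hy1 hxy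
  obtain ⟨hα, hb⟩ := hK.exists_boundary_point hym.1 hF'' hy1 ⟨hxm, hym.2.symm⟩ hx1 hxy.symm
  set β := coneRatio K y' x'
  set α := coneRatio K x' y'
  have hc : 0 < (β - 1)⁻¹ := inv_pos.2 (by linarith)
  have hc' : 0 < (α - 1)⁻¹ := inv_pos.2 (by linarith)
  have ha1 : φ (x' + (β - 1)⁻¹ • (x' - y')) = 1 := by simp [hx1, hy1]
  have hb1 : φ (y' + (α - 1)⁻¹ • (y' - x')) = 1 := by simp [hx1, hy1]
  have ca := affCoord_mk_of_eq_one ha1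
  have cb := affCoord_mk_of_eq_one hb1
  have cx := affCoord_mk_of_eq_one hx1 (ne_zero_of_mem_diff hxm)
  have cy := affCoord_mk_of_eq_one hy1 (ne_zero_of_mem_diff hym.1)
  rw [← hmx, ← hmy]
  refine ⟨φ, _, _, ha (ne_zero_of_apply_eq_one ha1), hb (ne_zero_of_apply_eq_one hb1),
    (mk_mem_affChart_iff _).2 (by rw [ha1]; exact one_ne_zero),
    (mk_mem_affChart_iff _).2 (by rw [hx1]; exact one_ne_zero),
    (mk_mem_affChart_iff _).2 (by rw [hy1]; exact one_ne_zero),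
    (mk_mem_affChart_iff _).2 (by rw [hb1]; exact one_ne_zero), ?_, ?_, ?_⟩
  · rw [ca, cx, cy]
    exact sbtw_of_eq hc hxy rfl
  · rw [cb, cx, cy, sbtw_comm]
    exact sbtw_of_eq hc' hxy.symm rfl
  · rw [crossRatio_eq hc hc' (by rwa [cx, cy]) (by rw [ca, cx, cy]) (by rw [cb, cx, cy]), hd]
    have e1 : (1 + (β - 1)⁻¹) / (β - 1)⁻¹ = β := by
      have : β - 1 ≠ 0 := by linarith
      field_simp
      ring
    have e2 : (1 + (α - 1)⁻¹) / (α - 1)⁻¹ = α := by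
      have : α - 1 ≠ 0 := by linarith
      field_simp
      ring
    rw [e1, e2, mul_comm β]
    rfl

theorem eq_coneDist_of_isHilbertDist (hx : x ∈ K \ {0})
    (hF : IsProjectivizationOf F (conePart K x)) (hy : y ∈ conePart K x) {r : ℝ}
    (h : IsHilbertDist F (Projectivization.mk ℝ x (ne_zero_of_mem_diff hx))
      (Projectivization.mk ℝ y (ne_zero_of_mem_diff hy.1)) r) :
      r = coneDist K x y := by
  rcases h with ⟨h, rfl⟩ | ⟨ψ, a, b, ha, hb, haψ, hxψ, hyψ, hbψ, hab, hba, rfl⟩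
  · exact (hK.coneDist_eq_zero_of_mk_eq hx hy.1 h).symm
  rw [sbtw_comm] at hba
  obtain ⟨c, hc, hac⟩ := exists_eq_of_sbtw hab
  obtain ⟨c', hc', hbc⟩ := exists_eq_of_sbtw hba
  rw [crossRatio_eq hc hc' hab.2.2 hac hbc]
  have hbd : ∀ z : RP d, z ∈ projBoundary F → z ∈ affChart ψ →
      (affCoord ψ z ∈ K ∨ -affCoord ψ z ∈ K) ∧ affCoord ψ z ∉ conePart K x ∧
        -affCoord ψ z ∉ conePart K x := by
    intro z hz hzψ
    rw [← mk_affCoord hzψ, hK.mk_mem_projBoundary_iff hx hF] at hz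
    exact ⟨hz.1.imp (fun h => hK.closure_conePart_subset h) fun h => hK.closure_conePart_subset h,
      hz.2⟩
  obtain ⟨a1, a2, a3⟩ := hbd a ha haψ
  obtain ⟨b1, b2, b3⟩ := hbd b hb hbψ
  rw [hac] at a1 a2 a3
  rw [hbc] at b1 b2 b3
  rw [affCoord_mk, affCoord_mk] at a1 a2 a3 b1 b2 b3
  rw [mk_mem_affChart_iff] at hxψ hyψ
  -- after a change of the sign of `ψ` the representative of the first point lies in `K`
  have main : ∀ t s : ℝ, 0 < t → s ≠ 0 →
      (t • x + c • (t • x - s • y) ∈ K ∨ -(t • x + c • (t • x - s • y)) ∈ K) →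
      t • x + c • (t • x - s • y) ∉ conePart K x →
      (s • y + c' • (s • y - t • x) ∈ K ∨ -(s • y + c' • (s • y - t • x)) ∈ K) →
      s • y + c' • (s • y - t • x) ∉ conePart K x →
      1 / 2 * Real.log (((1 + c) / c) * ((1 + c') / c')) = coneDist K x y := by
    intro t s ht hs h1 h2 h3 h4
    have htx := hK.smul_mem_of_pos hx ht
    have hP := hK.conePart_eq_of_mem hx
      (hK.smul_mem_conePart hx (hK.self_mem_conePart hx) ht)
    have hsy : s • y ∈ conePart K (t • x) ∨ -(s • y) ∈ conePart K (t • x) := by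
      rw [hP]
      rcases lt_or_gt_of_ne hs with hs | hs
      · right
        rw [← neg_smul]
        exact hK.smul_mem_conePart hx hy (by linarith)
      · exact Or.inl (hK.smul_mem_conePart hx hy hs)
    obtain ⟨h5, h6⟩ := hK.log_crossRatio_eq_coneDist htx hsy hc hc' h1 h3 (by rwa [hP])
      (by rwa [hP])
    have hs0 : 0 < s := by
      have h7 := hK.pos h5.1
      rw [map_smul, smul_eq_mul] at h7
      exact pos_of_mul_pos_left h7 (hK.pos hy.1).le
    rw [h6, hK.coneDist_smul_left hx h5.1 (hK.samePart_trans hx hy.1 h5.1 hy.2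
      (hK.samePart_smul y hs0)) ht, hK.coneDist_smul_right hx hy.1 hy.2 hs0]
  rcases lt_or_gt_of_ne hxψ with hneg | hpos
  · refine main (-(ψ x)⁻¹) (-(ψ y)⁻¹) (by simpa using hneg) (by simpa using hyψ) ?_ ?_ ?_ ?_
    · convert a1.symm using 2
      · module
      · module
    · convert a3 using 2
      module
    · convert b1.symm using 2
      · module
      · module
    · convert b3 using 2
      module
  · exact main _ _ (inv_pos.2 hpos) (inv_ne_zero hyψ) a1 a2 b1 b2

/-- The Hilbert metric of the set of rays in a part of `K` is Birkhoff's metric. This covers both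
the domain itself and its open faces. -/
theorem hilbertDist_eq_coneDist (hx : x ∈ K \ {0}) (hF : IsProjectivizationOf F (conePart K x))
    {z : Fin d → ℝ} (hy : y ∈ conePart K x) (hz : z ∈ conePart K x) :
    hilbertDist F (Projectivization.mk ℝ y (ne_zero_of_mem_diff hy.1))
      (Projectivization.mk ℝ z (ne_zero_of_mem_diff hz.1)) =
      coneDist K y z := by
  have hP := hK.conePart_eq_of_mem hx hy
  have hF' : IsProjectivizationOf F (conePart K y) := by rwa [hP]
  have hz' : z ∈ conePart K y := by rwa [hP]
  have hset : {r | IsHilbertDist F (Projectivization.mk ℝ y (ne_zero_of_mem_diff hy.1))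
      (Projectivization.mk ℝ z (ne_zero_of_mem_diff hz.1)) r} =
      {coneDist K y z} := by
    ext r
    exact ⟨fun h => hK.eq_coneDist_of_isHilbertDist hy.1 hF' hz' h,
      fun h => by rw [h]; exact hK.isHilbertDist_coneDist hy.1 hF' hz'⟩
  unfold hilbertDist
  rw [hset, csSup_singleton]

end IsSharpCone

end Dictionary

/-! ### Open faces of the domain -/

section Faces

open Projectivization Topology Filter

theorem IsSharpCone.samePart_of_openSegment {E : Type*} [NormedAddCommGroup E] [NormedSpace ℝ E]
    {K : Set E} {φ : E →ₗ[ℝ] ℝ} (hK : IsSharpCone K φ) {p q x y : E}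
    (h : ∀ z ∈ openSegment ℝ p q, z ∈ K \ {0} ∨ -z ∈ K \ {0}) (hx : x ∈ openSegment ℝ p q)
    (hy : y ∈ openSegment ℝ p q) (hxK : x ∈ K) : y ∈ K \ {0} ∧ SamePart K x y := by
  have hne : ∀ z ∈ openSegment ℝ p q, φ z ≠ 0 := by
    intro z hz
    rcases h z hz with h1 | h1
    · exact (hK.pos h1).ne'
    · have := hK.pos h1
      rw [map_neg] at this
      linarith
  have hxpos : 0 < φ x := lt_of_le_of_ne (hK.nonneg hxK) (hne x hx).symm
  have hall : ∀ z ∈ openSegment ℝ p q, z ∈ K \ {0} := by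
    intro z hz
    refine (h z hz).resolve_right fun h1 => ?_
    have h2 := hK.pos h1
    rw [map_neg] at h2
    have h3 : 0 < φ x * φ z := apply_mul_apply_pos hxpos.ne' (hne z hz) fun a b ha hb hab =>
      hne _ ((convex_openSegment p q) hx hz ha.le hb.le hab)
    nlinarith
  have hdom : ∀ x ∈ openSegment ℝ p q, ∀ y ∈ openSegment ℝ p q, ∃ t : ℝ, t • x - y ∈ K := by
    rintro _ ⟨a, b, ha, hb, hab, rfl⟩ _ ⟨a', b', ha', hb', hab', rfl⟩
    -- the segment extends beyond `x` in the direction away from `y`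
    set m := min a b with hm
    have hm0 : 0 < m := lt_min ha hb
    have hma : m ≤ a := min_le_left _ _
    have hmb : m ≤ b := min_le_right _ _
    have hz : (a + m * (a - a')) • p + (b + m * (b - b')) • q ∈ openSegment ℝ p q :=
      ⟨_, _, by nlinarith, by nlinarith, by linear_combination (1 + m) * hab - m * hab', rfl⟩
    refine ⟨(1 + m) / m, ?_⟩
    have h1 := hK.smul_mem (inv_pos.2 hm0).le (hall _ hz).1
    convert h1 using 1
    have e1 : (1 + m) / m = m⁻¹ * (1 + m) := by field_simp
    have e2 : m⁻¹ * m = 1 := inv_mul_cancel₀ hm0.ne'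
    calc ((1 + m) / m) • (a • p + b • q) - (a' • p + b' • q)
        = (m⁻¹ * (1 + m)) • (a • p + b • q) - (1 : ℝ) • (a' • p + b' • q) := by
          rw [e1, one_smul]
      _ = (m⁻¹ * (1 + m)) • (a • p + b • q) - (m⁻¹ * m) • (a' • p + b' • q) := by rw [e2]
      _ = _ := by module
  exact ⟨hall y hy, ⟨hdom y hy x hx, hdom x hx y hy⟩⟩

variable {d : ℕ} {Ω C : Set (RP d)} {K L : Set (Fin d → ℝ)} {φ : Module.Dual ℝ (Fin d → ℝ)}

namespace IsConeModel

variable (hM : IsConeModel Ω C K L φ)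
include hM

theorem mk_mem_idealBoundary {v : Fin d → ℝ} (hv : v ∈ L) (h : v ∉ interior K) (hv0 : v ≠ 0) :
    Projectivization.mk ℝ v hv0 ∈ idealBoundary C := by
  have := hM.nontrivial
  have h1 : Projectivization.mk ℝ v hv0 ∉ C := by
    intro h2
    rcases (hM.convex v hv0).1 h2 with h3 | h3
    · exact h h3.2
    · exact hM.sharp.not_neg_mem ⟨hM.subset hv, hv0⟩ (interior_subset h3.2)
  refine ⟨⟨(hM.closure_convex v hv0).2 (Or.inl hv), ?_⟩, h1⟩
  rintro ⟨h2, U, -, hvU, hU⟩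
  exact h1 (hU _ hvU h2)

theorem mk_mem_idealBoundary_iff {v : Fin d → ℝ} (hv0 : v ≠ 0) :
    Projectivization.mk ℝ v hv0 ∈ idealBoundary C ↔
      (v ∈ L ∧ v ∉ interior K) ∨ (-v ∈ L ∧ -v ∉ interior K) := by
  constructor
  · rintro ⟨⟨h1, -⟩, h2⟩
    rw [hM.convex v hv0, not_or] at h2
    rcases (hM.closure_convex v hv0).1 h1 with h | h
    · exact Or.inl ⟨h, fun h' => h2.1 ⟨h, h'⟩⟩
    · exact Or.inr ⟨h, fun h' => h2.2 ⟨h, h'⟩⟩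
  · rintro (h | h)
    · exact hM.mk_mem_idealBoundary h.1 h.2 hv0
    · rw [← mk_neg_eq hv0]
      exact hM.mk_mem_idealBoundary h.1 h.2 _

omit hM in
theorem projBoundary_domain (hΩ : IsOpen Ω) : projBoundary Ω = closure Ω \ Ω := by
  have h1 : projRelint Ω = Ω := by
    refine Set.Subset.antisymm ?_ fun z hz => ?_
    · rintro z ⟨hz, U, -, hzU, hU⟩
      exact hU z hzU hz
    · exact ⟨le_iSup₂_of_le z hz le_rfl, Ω, hΩ, hz, fun y hy _ => hy⟩
  unfold projBoundary
  rw [h1]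

theorem closure_inter_projBoundary (hΩ : IsOpen Ω) :
    closure C ∩ projBoundary Ω = idealBoundary C := by
  ext z
  induction z using ind with
  | h v hv =>
  rw [projBoundary_domain hΩ, hM.mk_mem_idealBoundary_iff hv]
  constructor
  · rintro ⟨h1, h2, h3⟩
    rw [hM.domain v hv, not_or] at h3
    exact ((hM.closure_convex v hv).1 h1).imp (fun h => ⟨h, h3.1⟩) fun h => ⟨h, h3.2⟩
  · intro h
    have hns : ∀ w : Fin d → ℝ, w ≠ 0 → w ∈ L → -w ∉ interior K := fun w hw hwL hn =>
      hM.sharp.not_neg_mem ⟨hM.subset hwL, hw⟩ (interior_subset hn)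
    refine ⟨(hM.closure_convex v hv).2 (h.imp And.left And.left),
      (hM.closure_domain v hv).2 (h.imp (fun h => hM.subset h.1) fun h => hM.subset h.1), ?_⟩
    rw [hM.domain v hv, not_or]
    rcases h with h | h
    · exact ⟨h.2, hns v hv h.1⟩
    · exact ⟨by simpa using hns (-v) (neg_ne_zero.2 hv) h.1, h.2⟩

theorem mem_conePart_or_neg {x v : Fin d → ℝ} (hx : x ∈ K \ {0}) {t : ℝ} (ht : t ≠ 0)
    (h : t • v ∈ conePart K x) : v ∈ conePart K x ∨ -v ∈ conePart K x := by
  rcases lt_or_gt_of_ne ht with ht0 | ht0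
  · right
    have := hM.sharp.smul_mem_conePart hx h (t := -t⁻¹) (by simpa using ht0)
    rwa [smul_smul, neg_mul, inv_mul_cancel₀ ht, neg_one_smul] at this
  · left
    have := hM.sharp.smul_mem_conePart hx h (inv_pos.2 ht0)
    rwa [smul_smul, inv_mul_cancel₀ ht, one_smul] at this

theorem mk_mem_openFace_of_mem_conePart {x y : Fin d → ℝ} (hx : x ∈ K \ {0}) (hx0 : x ≠ 0)
    (hy : y ∈ conePart K x) (hy0 : y ≠ 0) :
    Projectivization.mk ℝ y hy0 ∈ openFace Ω (Projectivization.mk ℝ x hx0) := by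
  have hK := hM.sharp
  by_cases hne : Projectivization.mk ℝ y hy0 = Projectivization.mk ℝ x hx0
  · exact Or.inl hne
  right
  refine ⟨(hM.closure_domain y hy0).2 (Or.inl hy.1.1), ?_⟩
  have px := hK.pos hx
  have py := hK.pos hy.1
  set x' := (φ x)⁻¹ • x with hx'
  set y' := (φ y)⁻¹ • y with hy'
  have hxm : x' ∈ conePart K x :=
    hK.smul_mem_conePart hx (hK.self_mem_conePart hx) (inv_pos.2 px)
  have hym : y' ∈ conePart K x := hK.smul_mem_conePart hx hy (inv_pos.2 py)
  have hx1 : φ x' = 1 := by rw [hx', map_smul, smul_eq_mul, inv_mul_cancel₀ px.ne']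
  have hy1 : φ y' = 1 := by rw [hy', map_smul, smul_eq_mul, inv_mul_cancel₀ py.ne']
  have hx'0 := ne_zero_of_apply_eq_one hx1
  have hy'0 := ne_zero_of_apply_eq_one hy1
  have hmx : Projectivization.mk ℝ x' hx'0 = Projectivization.mk ℝ x hx0 :=
    mk_smul_eq hx0 (inv_pos.2 px).ne'
  have hmy : Projectivization.mk ℝ y' hy'0 = Projectivization.mk ℝ y hy0 :=
    mk_smul_eq hy0 (inv_pos.2 py).ne'
  rw [← hmx, ← hmy]
  have hxy : y' ≠ x' := by
    intro h
    refine hne ?_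
    rw [← hmx, ← hmy]
    congr 1
  -- the segment extended slightly on both sides
  have hext : ∀ u v : Fin d → ℝ, u ∈ conePart K x → v ∈ conePart K x → ∃ ε > (0 : ℝ),
      u + ε • (u - v) ∈ K := by
    intro u v hu hv
    obtain ⟨s, hs⟩ := (hK.samePart_of_mem_conePart hx hv hu).1
    have hs0 := hK.pos_of_mem hv.1 hu.1 hs
    refine ⟨s⁻¹, inv_pos.2 hs0, ?_⟩
    have h1 := hK.smul_mem (inv_pos.2 hs0).le (hK.add_mem hs hu.1.1)
    have e1 : s⁻¹ * s = 1 := inv_mul_cancel₀ hs0.ne'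
    convert h1 using 1
    calc u + s⁻¹ • (u - v) = (1 : ℝ) • u + s⁻¹ • (u - v) := by rw [one_smul]
      _ = (s⁻¹ * s) • u + s⁻¹ • (u - v) := by rw [e1]
      _ = _ := by module
  obtain ⟨ε, hε, hp⟩ := hext x' y' hxm hym
  obtain ⟨ε', hε', hq⟩ := hext y' x' hym hxm
  set p := x' + ε • (x' - y') with hpdef
  set q := y' + ε' • (y' - x') with hqdef
  have hp1 : φ p = 1 := by rw [hpdef]; simp [hx1, hy1]
  have hq1 : φ q = 1 := by rw [hqdef]; simp [hx1, hy1]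
  have hp0 := ne_zero_of_apply_eq_one hp1
  have hq0 := ne_zero_of_apply_eq_one hq1
  have hθ : 0 < 1 + ε + ε' := by positivity
  have hxs : x' ∈ openSegment ℝ p q := by
    refine ⟨(1 + ε') / (1 + ε + ε'), ε / (1 + ε + ε'), by positivity, by positivity,
      by field_simp; ring, ?_⟩
    have e1 : (1 + ε') / (1 + ε + ε') = 1 - ε / (1 + ε + ε') := by field_simp; ring
    have e2 : ε / (1 + ε + ε') * (1 + ε + ε') = ε := by field_simp
    calc ((1 + ε') / (1 + ε + ε')) • p + (ε / (1 + ε + ε')) • q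
        = x' + (ε - ε / (1 + ε + ε') * (1 + ε + ε')) • (x' - y') := by
          rw [e1, hpdef, hqdef]; module
      _ = x' := by rw [e2, sub_self, zero_smul, add_zero]
  have hys : y' ∈ openSegment ℝ p q := by
    refine ⟨ε' / (1 + ε + ε'), (1 + ε) / (1 + ε + ε'), by positivity, by positivity,
      by field_simp; ring, ?_⟩
    have e1 : (1 + ε) / (1 + ε + ε') = 1 - ε' / (1 + ε + ε') := by field_simp; ring
    have e2 : ε' / (1 + ε + ε') * (1 + ε + ε') = ε' := by field_simp
    calc (ε' / (1 + ε + ε')) • p + ((1 + ε) / (1 + ε + ε')) • q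
        = y' + (ε' - ε' / (1 + ε + ε') * (1 + ε + ε')) • (y' - x') := by
          rw [e1, hpdef, hqdef]; module
      _ = y' := by rw [e2, sub_self, zero_smul, add_zero]
  have hchart : ∀ {w : Fin d → ℝ} (hw : φ w = 1),
      Projectivization.mk ℝ w (ne_zero_of_apply_eq_one hw) ∈ affChart φ := fun hw =>
    (mk_mem_affChart_iff _).2 (by rw [hw]; exact one_ne_zero)
  have hpne : p ≠ q := by
    intro h
    rw [h, openSegment_same] at hxs hys
    exact hxy (hys.trans hxs.symm)
  refine ⟨φ, Projectivization.mk ℝ p hp0, Projectivization.mk ℝ q hq0, hchart hp1, hchart hq1,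
    fun h => hpne ?_, ?_, ?_, ?_⟩
  · have := congrArg (affCoord φ) h
    rwa [affCoord_mk_of_eq_one hp1, affCoord_mk_of_eq_one hq1] at this
  · rintro z ⟨hz, hz'⟩
    rw [affCoord_mk_of_eq_one hp1, affCoord_mk_of_eq_one hq1] at hz'
    rw [← mk_affCoord hz]
    exact (hM.closure_domain _ _).2 (Or.inl (hK.convex.openSegment_subset hp hq hz'))
  · refine ⟨hchart hx1, ?_⟩
    rwa [affCoord_mk_of_eq_one hp1, affCoord_mk_of_eq_one hq1, affCoord_mk_of_eq_one hx1]
  · refine ⟨hchart hy1, ?_⟩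
    rwa [affCoord_mk_of_eq_one hp1, affCoord_mk_of_eq_one hq1, affCoord_mk_of_eq_one hy1]

/-- Open faces of `Ω` are the sets of rays of the parts of `K`. -/
theorem openFace_isProjectivizationOf {x : Fin d → ℝ} (hx : x ∈ K \ {0}) (hx0 : x ≠ 0) :
    IsProjectivizationOf (openFace Ω (Projectivization.mk ℝ x hx0)) (conePart K x) := by
  have hK := hM.sharp
  intro v hv
  constructor
  · rintro (h | ⟨-, ψ, p, q, hp, hq, -, hsub, hxs, hvs⟩)
    · obtain ⟨t, ht⟩ := (mk_eq_mk_iff' ℝ _ _ _ _).1 (Set.mem_singleton_iff.1 h)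
      have ht0 : t ≠ 0 := by
        rintro rfl
        exact hv (by rw [← ht, zero_smul])
      refine hM.mem_conePart_or_neg hx (inv_ne_zero ht0) ?_
      rw [← ht, smul_smul, inv_mul_cancel₀ ht0, one_smul]
      exact hK.self_mem_conePart hx
    · set p' := affCoord ψ p with hp'
      set q' := affCoord ψ q with hq'
      have hseg : ∀ z ∈ openSegment ℝ p' q', z ∈ K \ {0} ∨ -z ∈ K \ {0} := by
        intro z hz
        have hz1 : ψ z = 1 := by
          obtain ⟨a, b, -, -, hab, rfl⟩ := hz
          rw [map_add, map_smul, map_smul, apply_affCoord hp, apply_affCoord hq]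
          simpa using hab
        have hz0 := ne_zero_of_apply_eq_one hz1
        have h1 : Projectivization.mk ℝ z hz0 ∈ closure Ω := hsub
          ⟨(mk_mem_affChart_iff _).2 (by rw [hz1]; exact one_ne_zero), by
            rwa [affCoord_mk_of_eq_one hz1]⟩
        exact ((hM.closure_domain z hz0).1 h1).imp (fun h => ⟨h, hz0⟩)
          fun h => ⟨h, neg_ne_zero.2 hz0⟩
      have hx1 := (mk_mem_affChart_iff hx0).1 hxs.1
      have hv1 := (mk_mem_affChart_iff hv).1 hvs.1
      have hx2 := hxs.2
      have hv2 := hvs.2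
      rw [affCoord_mk] at hx2 hv2
      rcases lt_or_gt_of_ne hx1 with hneg | hpos
      · have hneg_seg : ∀ z : Fin d → ℝ, z ∈ openSegment ℝ (-p') (-q') ↔
            -z ∈ openSegment ℝ p' q' := by
          intro z
          constructor
          · rintro ⟨a, b, ha, hb, hab, rfl⟩
            exact ⟨a, b, ha, hb, hab, by module⟩
          · rintro ⟨a, b, ha, hb, hab, h⟩
            exact ⟨a, b, ha, hb, hab, by rw [← neg_neg z, ← h]; module⟩
        have hs0 : 0 < -(ψ x)⁻¹ := by simpa using hneg
        have h1 := hK.samePart_of_openSegment (p := -p') (q := -q') (x := (-(ψ x)⁻¹) • x)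
          (y := (-(ψ v)⁻¹) • v) (fun z hz => by
            have := hseg _ ((hneg_seg z).1 hz)
            rw [neg_neg] at this
            exact this.symm)
          ((hneg_seg _).2 (by rwa [neg_smul, neg_neg]))
          ((hneg_seg _).2 (by rwa [neg_smul, neg_neg]))
          (hK.smul_mem hs0.le hx.1)
        exact hM.mem_conePart_or_neg hx (by simpa using hv1)
          (hK.mem_conePart_of_samePart hx
            (hK.smul_mem_conePart hx (hK.self_mem_conePart hx) hs0) h1.1 h1.2)
      · have hs0 : 0 < (ψ x)⁻¹ := inv_pos.2 hpos
        have h1 := hK.samePart_of_openSegment hseg hx2 hv2 (hK.smul_mem hs0.le hx.1)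
        exact hM.mem_conePart_or_neg hx (inv_ne_zero hv1)
          (hK.mem_conePart_of_samePart hx
            (hK.smul_mem_conePart hx (hK.self_mem_conePart hx) hs0) h1.1 h1.2)
  · rintro (h | h)
    · exact hM.mk_mem_openFace_of_mem_conePart hx hx0 h hv
    · rw [← mk_neg_eq hv]
      exact hM.mk_mem_openFace_of_mem_conePart hx hx0 h _

theorem hilbertDist_openFace {x y z : Fin d → ℝ} (hx : x ∈ K \ {0}) (hx0 : x ≠ 0)
    (hy : y ∈ conePart K x) (hz : z ∈ conePart K x) (hy0 : y ≠ 0) (hz0 : z ≠ 0) :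
    hilbertDist (openFace Ω (Projectivization.mk ℝ x hx0))
      (Projectivization.mk ℝ y hy0) (Projectivization.mk ℝ z hz0) =
      coneDist K y z :=
  hM.sharp.hilbertDist_eq_coneDist hx (hM.openFace_isProjectivizationOf hx hx0) hy hz

theorem hilbertDist_domain {y z : Fin d → ℝ} (hy : y ∈ interior K) (hz : z ∈ interior K)
    (hy0 : y ≠ 0) (hz0 : z ≠ 0) :
    hilbertDist Ω (Projectivization.mk ℝ y hy0) (Projectivization.mk ℝ z hz0) =
    coneDist K y z := by
  have := hM.nontrivial
  have hP := hM.sharp.conePart_eq_interior hy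
  exact hM.sharp.hilbertDist_eq_coneDist (hM.sharp.interior_subset_ne_zero hy)
    (by rw [hP]; exact hM.domain) (by rwa [hP]) (by rwa [hP])

/-- The representative in `L ∩ interior K`, normalized by `φ`, of a point of `C`. -/
theorem affCoord_mem {x : RP d} (hx : x ∈ C) :
    x ∈ affChart φ ∧ affCoord φ x ∈ L ∧ affCoord φ x ∈ interior K := by
  have := hM.nontrivial
  induction x using ind with
  | h v hv =>
  have aux : ∀ w : Fin d → ℝ, w ≠ 0 → w ∈ L ∩ interior K → φ w ≠ 0 ∧
      (φ w)⁻¹ • w ∈ L ∩ interior K := by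
    intro w hw hw'
    have h1 := hM.sharp.pos (hM.sharp.interior_subset_ne_zero hw'.2)
    exact ⟨h1.ne', hM.smul_mem (inv_pos.2 h1).le hw'.1,
      hM.sharp.smul_mem_interior hw'.2 (inv_pos.2 h1)⟩
  rw [mk_mem_affChart_iff, affCoord_mk]
  rcases (hM.convex v hv).1 hx with h | h
  · exact aux v hv h
  · have := aux (-v) (neg_ne_zero.2 hv) h
    rw [map_neg, inv_neg, neg_smul, smul_neg, neg_neg] at this
    exact ⟨by simpa using this.1, this.2⟩

theorem hilbertDist_eq {x y : RP d} (hx : x ∈ C) (hy : y ∈ C) :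
    hilbertDist Ω x y = coneDist K (affCoord φ x) (affCoord φ y) := by
  obtain ⟨h1, h2, h3⟩ := hM.affCoord_mem hx
  obtain ⟨h4, h5, h6⟩ := hM.affCoord_mem hy
  rw [← hM.hilbertDist_domain h3 h6 (affCoord_ne_zero h1) (affCoord_ne_zero h4), mk_affCoord h1,
    mk_affCoord h4]

end IsConeModel

end Faces

/-! ### Limits of triangles under a cocompact group of automorphisms -/

section Cocompact

open Topology Filter

variable {E : Type*} [NormedAddCommGroup E] [NormedSpace ℝ E]

/-- A linear automorphism that preserves the cones `K` and `L`. -/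
structure IsConeAut (K L : Set E) (A : E ≃ₗ[ℝ] E) : Prop where
  mem_left : ∀ w, A w ∈ K ↔ w ∈ K
  mem_right : ∀ w, A w ∈ L ↔ w ∈ L

/-- The automorphisms of the pair of cones move every point of `L ∩ interior K` into a fixed compact
subset of a slice. -/
def IsConeCocompact (K L : Set E) (φ : E →ₗ[ℝ] ℝ) : Prop :=
  ∃ Q : Set E, Q ⊆ L ∩ interior K ∧ IsCompact Q ∧ (∀ q ∈ Q, φ q = 1) ∧
    ∀ v ∈ L ∩ interior K, ∃ A : E ≃ₗ[ℝ] E, IsConeAut K L A ∧ A v ∈ Q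

namespace IsConeAut

variable {K L : Set E} {A : E ≃ₗ[ℝ] E} (hA : IsConeAut K L A)
include hA

theorem mem_interior_iff [FiniteDimensional ℝ E] (w : E) : A w ∈ interior K ↔ w ∈ interior K := by
  have h1 := A.toContinuousLinearEquiv.toHomeomorph.preimage_interior K
  have h2 : A.toContinuousLinearEquiv.toHomeomorph ⁻¹' K = K := Set.ext hA.mem_left
  rw [h2] at h1
  exact Set.ext_iff.1 h1 w

theorem coneNear_iff {r : ℝ} {x y : E} : ConeNear K r (A x) (A y) ↔ ConeNear K r x y := by
  have h : ∀ (s : ℝ) (x y : E), s • A y - A x ∈ K ↔ s • y - x ∈ K := fun s x y => by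
    rw [← map_smul, ← map_sub, hA.mem_left]
  unfold ConeNear
  simp only [h]

theorem coneDist_eq (x y : E) : coneDist K (A x) (A y) = coneDist K x y := by
  have h : ∀ (s : ℝ) (x y : E), s • A y - A x ∈ K ↔ s • y - x ∈ K := fun s x y => by
    rw [← map_smul, ← map_sub, hA.mem_left]
  unfold coneDist coneRatio
  simp only [h]

theorem symm : IsConeAut K L A.symm :=
  ⟨fun w => by rw [← hA.mem_left, A.apply_symm_apply],
    fun w => by rw [← hA.mem_right, A.apply_symm_apply]⟩

end IsConeAut

theorem exists_of_map_mem_coneSegment {A : E ≃ₗ[ℝ] E} {x y w : E} {a b : ℝ} (ha : 0 < a)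
    (hb : 0 < b) (hw : w ∈ coneSegment (a • A x) (b • A y)) : ∃ v ∈ coneSegment x y, w = A v := by
  obtain ⟨s, t, hs, ht, hst, rfl⟩ := hw
  refine ⟨(s * a) • x + (t * b) • y, ⟨s * a, t * b, by positivity, by positivity, ?_, rfl⟩, ?_⟩
  · rcases hs.eq_or_lt with rfl | hs
    · have : 0 < t * b := mul_pos (by linarith) hb
      linarith
    · have := mul_pos hs ha
      have : 0 ≤ t * b := by positivity
      linarith
  · rw [map_add, map_smul, map_smul, mul_smul, mul_smul]

variable [FiniteDimensional ℝ E] [Nontrivial E]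
variable {K L : Set E} {φ : E →ₗ[ℝ] ℝ}

/-- A sequence of triangles together with points `u n` whose distance to two of the sides tends to
infinity. After translating the points `u n` into a compact set, the triangles accumulate at a
triangle for which these two sides lie in the boundary. -/
theorem IsSharpCone.exists_limit_triangle (hK : IsSharpCone K φ) (hLK : L ⊆ K) (hL : IsClosed L)
    (hLs : ∀ {t : ℝ} {x : E}, 0 ≤ t → x ∈ L → t • x ∈ L) (hcoc : IsConeCocompact K L φ)
    {p a b u : ℕ → E} {s t r : ℕ → ℝ} (hp : ∀ n, p n ∈ L \ {0}) (ha : ∀ n, a n ∈ L \ {0})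
    (hb : ∀ n, b n ∈ L \ {0}) (hu : ∀ n, u n ∈ L ∩ interior K) (hs : ∀ n, 0 ≤ s n)
    (ht : ∀ n, 0 ≤ t n) (hr : ∀ n, 0 ≤ r n)
    (hcomb : ∀ n, u n = s n • p n + t n • a n + r n • b n)
    (hpa : ∀ n, ∀ w ∈ coneSegment (p n) (a n), w ∈ interior K → ¬ ConeNear K n (u n) w)
    (hpb : ∀ n, ∀ w ∈ coneSegment (p n) (b n), w ∈ interior K → ¬ ConeNear K n (u n) w) :
    ∃ p₀ a₀ b₀ u₀ : E, ∃ s₀ t₀ r₀ : ℝ, p₀ ∈ L ∧ a₀ ∈ L ∧ b₀ ∈ L ∧ u₀ ∈ interior K ∧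
      φ p₀ = 1 ∧ φ a₀ = 1 ∧ φ b₀ = 1 ∧ 0 ≤ s₀ ∧ 0 ≤ t₀ ∧ 0 ≤ r₀ ∧
      u₀ = s₀ • p₀ + t₀ • a₀ + r₀ • b₀ ∧
      (∀ w ∈ coneSegment p₀ a₀, w ∉ interior K) ∧ (∀ w ∈ coneSegment p₀ b₀, w ∉ interior K) ∧
      ((∀ n, ∀ w ∈ coneSegment (a n) (b n), w ∉ interior K) →
        ∀ w ∈ coneSegment a₀ b₀, w ∉ interior K) ∧ ((∀ n, s n = 0) → s₀ = 0) := by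
  obtain ⟨Q, hQ, hQc, hQ1, hcov⟩ := hcoc
  choose A hA hAQ using fun n => hcov (u n) (hu n)
  have hpos : ∀ (n : ℕ) (x : E), x ∈ L \ {0} → 0 < φ (A n x) := fun n x hx =>
    hK.pos ⟨((hA n).mem_left x).2 (hLK hx.1), fun h => hx.2 (by simpa using h)⟩
  set S : Set E := {v ∈ L | φ v = 1} with hS
  have hSc : IsCompact S := hK.isCompact_slice.of_isClosed_subset
    (hL.inter (isClosed_singleton.preimage φ.continuous_of_finiteDimensional :
      IsClosed (φ ⁻¹' {1}))) fun v hv => ⟨hLK hv.1, hv.2⟩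
  -- translated and normalized vertices
  set N : ℕ → E → E := fun n x => (φ (A n x))⁻¹ • A n x with hN
  have hNS : ∀ n x, x ∈ L \ {0} → N n x ∈ S := fun n x hx =>
    ⟨hLs (inv_pos.2 (hpos n x hx)).le (((hA n).mem_right x).2 hx.1), by
      rw [hN, map_smul, smul_eq_mul, inv_mul_cancel₀ (hpos n x hx).ne']⟩
  have hNA : ∀ n x, x ∈ L \ {0} → A n x = φ (A n x) • N n x := fun n x hx => by
    rw [hN, smul_smul, mul_inv_cancel₀ (hpos n x hx).ne', one_smul]
  have hcomb' : ∀ n, A n (u n) = (s n * φ (A n (p n))) • N n (p n) +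
      (t n * φ (A n (a n))) • N n (a n) + (r n * φ (A n (b n))) • N n (b n) := fun n => by
    rw [mul_smul, mul_smul, mul_smul, ← hNA n _ (hp n), ← hNA n _ (ha n), ← hNA n _ (hb n),
      hcomb n, map_add, map_add, map_smul, map_smul, map_smul]
  have hsum : ∀ n, s n * φ (A n (p n)) + t n * φ (A n (a n)) + r n * φ (A n (b n)) = 1 :=
      fun n => by
    have h1 := congrArg φ (hcomb' n)
    rw [hQ1 _ (hAQ n)] at h1
    simp only [map_add, map_smul, (hNS n _ (hp n)).2, (hNS n _ (ha n)).2, (hNS n _ (hb n)).2,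
      smul_eq_mul, mul_one] at h1
    exact h1.symm
  have q1 : ∀ n, 0 ≤ s n * φ (A n (p n)) := fun n => mul_nonneg (hs n) (hpos n _ (hp n)).le
  have q2 : ∀ n, 0 ≤ t n * φ (A n (a n)) := fun n => mul_nonneg (ht n) (hpos n _ (ha n)).le
  have q3 : ∀ n, 0 ≤ r n * φ (A n (b n)) := fun n => mul_nonneg (hr n) (hpos n _ (hb n)).le
  have hprod : IsCompact (Q ×ˢ S ×ˢ S ×ˢ S ×ˢ Set.Icc (0 : ℝ) 1 ×ˢ Set.Icc (0 : ℝ) 1 ×ˢ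
      Set.Icc (0 : ℝ) 1) :=
    hQc.prod (hSc.prod (hSc.prod (hSc.prod (isCompact_Icc.prod (isCompact_Icc.prod
      isCompact_Icc)))))
  obtain ⟨⟨u₀, p₀, a₀, b₀, s₀, t₀, r₀⟩, hmem, ψ, hψ, hlim⟩ := hprod.tendsto_subseq
    (x := fun n => (A n (u n), N n (p n), N n (a n), N n (b n), s n * φ (A n (p n)),
      t n * φ (A n (a n)), r n * φ (A n (b n))))
    (fun n => ⟨hAQ n, hNS n _ (hp n), hNS n _ (ha n), hNS n _ (hb n),
      ⟨q1 n, by linarith [q1 n, q2 n, q3 n, hsum n]⟩,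
      ⟨q2 n, by linarith [q1 n, q2 n, q3 n, hsum n]⟩,
      ⟨q3 n, by linarith [q1 n, q2 n, q3 n, hsum n]⟩⟩)
  obtain ⟨m1, m2, m3, m4, m5, m6, m7⟩ := hmem
  simp only [nhds_prod_eq, tendsto_prod_iff'] at hlim
  obtain ⟨l1, l2, l3, l4, l5, l6, l7⟩ := hlim
  simp only [Function.comp_apply] at l1 l2 l3 l4 l5 l6 l7
  have hinv : ∀ n x, x ∈ L \ {0} → 0 < (φ (A n x))⁻¹ := fun n x hx => inv_pos.2 (hpos n x hx)
  have hfar : ∀ x y : ℕ → E, (∀ n, x n ∈ L \ {0}) → (∀ n, y n ∈ L \ {0}) →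
      (∀ n, ∀ w ∈ coneSegment (x n) (y n), w ∈ interior K → ¬ ConeNear K n (u n) w) →
      ∀ n, ∀ w ∈ coneSegment (N n (x n)) (N n (y n)), w ∈ interior K →
        ¬ ConeNear K n (A n (u n)) w := by
    intro x y hx hy h n w hw hwi
    obtain ⟨v, hv, rfl⟩ := exists_of_map_mem_coneSegment (hinv n _ (hx n)) (hinv n _ (hy n)) hw
    rw [(hA n).coneNear_iff]
    exact h n v hv (((hA n).mem_interior_iff v).1 hwi)
  have hψr : Tendsto (fun n => ((ψ n : ℕ) : ℝ)) atTop atTop :=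
    tendsto_natCast_atTop_atTop.comp hψ.tendsto_atTop
  refine ⟨p₀, a₀, b₀, u₀, s₀, t₀, r₀, m2.1, m3.1, m4.1, (hQ m1).2, m2.2, m3.2, m4.2, m5.1, m6.1,
    m7.1, ?_, ?_, ?_, fun hab => ?_, fun h0 => ?_⟩
  · refine tendsto_nhds_unique l1 ?_
    have h1 := ((l5.smul l2).add (l6.smul l3)).add (l7.smul l4)
    exact h1.congr fun n => (hcomb' (ψ n)).symm
  · exact hK.coneSegment_disjoint_interior_of_tendsto l1 l2 l3 (hQ m1).2 hψr
      fun n => hfar p a hp ha hpa (ψ n)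
  · exact hK.coneSegment_disjoint_interior_of_tendsto l1 l2 l4 (hQ m1).2 hψr
      fun n => hfar p b hp hb hpb (ψ n)
  · exact hK.coneSegment_disjoint_interior_of_tendsto l1 l3 l4 (hQ m1).2 hψr
      fun n => hfar a b ha hb (fun n w hw hwi => absurd hwi (hab n w hw)) (ψ n)
  · refine tendsto_nhds_unique l5 ?_
    simp [h0]

/-- If open faces contain arbitrarily distant points of `L`, then some triangle with vertices in `L`
has its sides in the boundary of `K` but contains an interior point of `K`. -/
theorem IsSharpCone.exists_ideal_triangle (hK : IsSharpCone K φ) (hLK : L ⊆ K) (hL : IsClosed L)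
    (hLa : ∀ {x y : E}, x ∈ L → y ∈ L → x + y ∈ L)
    (hLs : ∀ {t : ℝ} {x : E}, 0 ≤ t → x ∈ L → t • x ∈ L) (hne : (L ∩ interior K).Nonempty)
    (hcoc : IsConeCocompact K L φ)
    (h : ∀ R : ℝ, ∃ a ∈ L \ {0}, ∃ b ∈ L \ {0}, a ∉ interior K ∧ SamePart K a b ∧
      R < coneDist K a b) :
    ∃ p a b u : E, ∃ s t r : ℝ, p ∈ L ∧ a ∈ L ∧ b ∈ L ∧ u ∈ interior K ∧
      0 ≤ s ∧ 0 ≤ t ∧ 0 ≤ r ∧ u = s • p + t • a + r • b ∧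
      (∀ w ∈ coneSegment p a, w ∉ interior K) ∧ (∀ w ∈ coneSegment p b, w ∉ interior K) ∧
      (∀ w ∈ coneSegment a b, w ∉ interior K) := by
  have hKdiff : ∀ {x : E}, x ∈ L \ {0} → x ∈ K \ {0} := fun hx => ⟨hLK hx.1, hx.2⟩
  obtain ⟨p, hpL, hpK⟩ : ∃ p ∈ L \ {0}, p ∈ interior K ∧ φ p = 1 := by
    obtain ⟨v, hvL, hvK⟩ := hne
    have h1 := hK.pos (hK.interior_subset_ne_zero hvK)
    have h2 : φ ((φ v)⁻¹ • v) = 1 := by rw [map_smul, smul_eq_mul, inv_mul_cancel₀ h1.ne']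
    exact ⟨(φ v)⁻¹ • v, ⟨hLs (inv_pos.2 h1).le hvL, fun h => by
      rw [Set.mem_singleton_iff.1 h, map_zero] at h2; exact zero_ne_one h2⟩,
      hK.smul_mem_interior hvK (inv_pos.2 h1), h2⟩
  have key : ∀ n : ℕ, ∃ a ∈ L \ {0}, ∃ b ∈ L \ {0}, ∃ u ∈ L ∩ interior K, ∃ s t r : ℝ,
      0 ≤ s ∧ 0 ≤ t ∧ 0 ≤ r ∧ u = s • p + t • a + r • b ∧
      (∀ w ∈ coneSegment p a, ¬ ConeNear K n u w) ∧ (∀ w ∈ coneSegment p b, ¬ ConeNear K n u w) ∧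
      ∀ w ∈ coneSegment a b, w ∉ interior K := by
    intro n
    obtain ⟨a, ha, b, hb, hai, hab, hR⟩ := h (2 * n)
    have ha' := hKdiff ha
    have hb' := hKdiff hb
    have hseg : ∀ w ∈ coneSegment a b, w ∉ interior K := fun w hw hwi =>
      hai (hK.mem_interior_of_samePart hwi ha'
        (hK.samePart_of_mem_coneSegment ha' hb' hab hw).symm)
    -- the metric midpoint of `a` and `b`
    obtain ⟨c, hc, hcd⟩ := hK.exists_mem_coneSegment_coneDist_eq ha' hb' hab
      (s := coneDist K a b / 2) (by have : (0 : ℝ) ≤ n := by positivity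
                                    linarith) (by have : (0 : ℝ) ≤ n := by positivity
                                                  linarith)
    have hc' := hK.coneSegment_subset ha' hb' hc
    have hac := hK.samePart_of_mem_coneSegment ha' hb' hab hc
    have hcb := hK.samePart_trans hc' ha' hb' hac.symm hab
    have hcd' : coneDist K c b = coneDist K a b / 2 := by
      have := hK.coneDist_add_coneDist ha' hb' hab hc
      linarith
    have hpos : ∀ {x : E}, x ∈ K \ {0} → 0 < (φ x)⁻¹ := fun hx => inv_pos.2 (hK.pos hx)
    have hone : ∀ {x : E}, x ∈ K \ {0} → φ ((φ x)⁻¹ • x) = 1 := fun hx => by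
      rw [map_smul, smul_eq_mul, inv_mul_cancel₀ (hK.pos hx).ne']
    have hnear : ∀ {x y : E}, x ∈ K \ {0} → y ∈ K \ {0} →
        ConeNear K n ((φ x)⁻¹ • x) ((φ y)⁻¹ • y) → ConeNear K n x y := fun hx hy h => by
      have h1 := hK.coneNear_smul_left (hK.coneNear_smul_right h (hK.pos hy)) (hK.pos hx)
      rwa [smul_smul, smul_smul, mul_inv_cancel₀ (hK.pos hx).ne', mul_inv_cancel₀ (hK.pos hy).ne',
        one_smul, one_smul] at h1
    have hci : (φ c)⁻¹ • c ∉ interior K := fun h => hseg _ (smul_mem_coneSegment hc (hpos hc')) h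
    obtain ⟨ε₁, hε₁, h₁⟩ := hK.exists_forall_not_coneNear (r := n) hpK.1
      (hK.smul_mem (hpos ha').le ha'.1) (hK.smul_mem (hpos hc').le hc'.1) hci hpK.2 (hone ha')
      (hone hc') (fun h => by
        have := hK.coneDist_le_of_coneNear hc' ha' (hnear hc' ha' h)
        rw [coneDist_symm] at this
        linarith)
    obtain ⟨ε₂, hε₂, h₂⟩ := hK.exists_forall_not_coneNear (r := n) hpK.1
      (hK.smul_mem (hpos hb').le hb'.1) (hK.smul_mem (hpos hc').le hc'.1) hci hpK.2 (hone hb')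
      (hone hc') (fun h => by
        have := hK.coneDist_le_of_coneNear hc' hb' (hnear hc' hb' h)
        linarith)
    -- the interior point `u` lies on the segment from `c` to `p`, close to `c`
    set ε := min (min ε₁ ε₂) 1 / 2 with hε
    have hm : 0 < min (min ε₁ ε₂) 1 := lt_min (lt_min hε₁ hε₂) one_pos
    have hε0 : 0 < ε := by positivity
    have he1 : ε < ε₁ := by
      have : min (min ε₁ ε₂) 1 ≤ ε₁ := (min_le_left _ _).trans (min_le_left _ _)
      linarith
    have he2 : ε < ε₂ := by
      have : min (min ε₁ ε₂) 1 ≤ ε₂ := (min_le_left _ _).trans (min_le_right _ _)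
      linarith
    have he3 : ε < 1 := by
      have : min (min ε₁ ε₂) 1 ≤ 1 := min_le_right _ _
      linarith
    obtain ⟨x, y, hx, hy, hxy, hcxy⟩ := hc
    have hk : 0 ≤ (1 - ε) * (φ c)⁻¹ := mul_nonneg (by linarith) (hpos hc').le
    have hcL : c ∈ L := by rw [hcxy]; exact hLa (hLs hx ha.1) (hLs hy hb.1)
    have hsegn : ∀ {z w : E}, z ∈ K \ {0} → w ∈ coneSegment p z →
        w ∈ coneSegment p ((φ z)⁻¹ • z) := by
      rintro z w hz ⟨s, t, hs, ht, hst, rfl⟩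
      refine ⟨s, t * φ z, hs, mul_nonneg ht (hK.pos hz).le, ?_, ?_⟩
      · rcases hs.eq_or_lt with rfl | hs
        · have := mul_pos (show 0 < t by linarith) (hK.pos hz)
          linarith
        · have := mul_nonneg ht (hK.pos hz).le
          linarith
      · rw [smul_smul, mul_assoc, mul_inv_cancel₀ (hK.pos hz).ne', mul_one]
    refine ⟨a, ha, b, hb, (1 - ε) • ((φ c)⁻¹ • c) + ε • p, ⟨?_, ?_⟩, ε, (1 - ε) * (φ c)⁻¹ * x,
      (1 - ε) * (φ c)⁻¹ * y, hε0.le, mul_nonneg hk hx, mul_nonneg hk hy, ?_, ?_, ?_, hseg⟩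
    · rw [smul_smul]
      exact hLa (hLs hk hcL) (hLs hε0.le hpL.1)
    · rw [add_comm, smul_smul]
      exact hK.add_mem_interior (hK.smul_mem_interior hpK.1 hε0) (hK.smul_mem hk hc'.1)
    · nth_rewrite 2 [hcxy]
      module
    · exact fun w hw => h₁ ε hε0 he1 w (hsegn ha' hw)
    · exact fun w hw => h₂ ε hε0 he2 w (hsegn hb' hw)
  choose a ha b hb u hu s t r hs ht hr hcomb hpa hpb hab using key
  obtain ⟨p₀, a₀, b₀, u₀, s₀, t₀, r₀, h1, h2, h3, h4, -, -, -, h5, h6, h7, h8, h9, h10, h11, -⟩ :=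
    hK.exists_limit_triangle hLK hL hLs hcoc (p := fun _ => p) (fun _ => hpL)
      ha hb hu hs ht hr hcomb
      (fun n w hw _ => hpa n w hw) (fun n w hw _ => hpb n w hw)
  exact ⟨p₀, a₀, b₀, u₀, s₀, t₀, r₀, h1, h2, h3, h4, h5, h6, h7, h8, h9, h10, h11 hab⟩

omit [FiniteDimensional ℝ E] [Nontrivial E] in
theorem samePart_of_mem_Ioo {K : Set E} {φ : E →ₗ[ℝ] ℝ} (hK : IsSharpCone K φ) {x z : E}
    (hx : x ∈ K) (hz : z ∈ K) {s s' : ℝ} (h0 : 0 < s) (h1 : s < 1) (h0' : 0 < s') (h1' : s' < 1) :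
    SamePart K ((1 - s) • x + s • z) ((1 - s') • x + s' • z) := by
  have aux : ∀ s s' : ℝ, 0 < s → s < 1 → 0 < s' → s' < 1 →
      ∃ t : ℝ, t • ((1 - s') • x + s' • z) - ((1 - s) • x + s • z) ∈ K := by
    intro s s' h0 h1 h0' h1'
    refine ⟨1 / (1 - s') + 1 / s', ?_⟩
    have p1 : 0 < 1 - s' := by linarith
    have e1 : (1 / (1 - s') + 1 / s') * (1 - s') = 1 + (1 - s') / s' := by field_simp
    have e2 : (1 / (1 - s') + 1 / s') * s' = 1 + s' / (1 - s') := by field_simp; ring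
    have e3 : (1 / (1 - s') + 1 / s') • ((1 - s') • x + s' • z) - ((1 - s) • x + s • z) =
        (s + (1 - s') / s') • x + ((1 - s) + s' / (1 - s')) • z := by
      rw [smul_add, smul_smul, smul_smul, e1, e2]; module
    rw [e3]
    have p2 : 0 < 1 - s := by linarith
    exact hK.add_mem (hK.smul_mem (by positivity) hx) (hK.smul_mem (by positivity) hz)
  exact ⟨aux s s' h0 h1 h0' h1', aux s' s h0' h1' h0 h1⟩

/-- If every open face meets `L` in a bounded set, then triangles in `L ∩ interior K` are
uniformly slim. -/
theorem IsSharpCone.exists_slim (hK : IsSharpCone K φ) (hLK : L ⊆ K) (hL : IsClosed L)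
    (hLa : ∀ {x y : E}, x ∈ L → y ∈ L → x + y ∈ L)
    (hLs : ∀ {t : ℝ} {x : E}, 0 ≤ t → x ∈ L → t • x ∈ L) (hcoc : IsConeCocompact K L φ)
    (h : ∀ x ∈ L \ {0}, x ∉ interior K → ∃ R : ℝ, ∀ y ∈ L \ {0}, SamePart K x y →
      ConeNear K R y x) :
    ∃ R : ℝ, 0 ≤ R ∧ ∀ x ∈ L ∩ interior K, ∀ y ∈ L ∩ interior K, ∀ z ∈ L ∩ interior K,
      ∀ u ∈ coneSegment x y, (∃ w ∈ coneSegment z x, ConeNear K R u w) ∨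
        ∃ w ∈ coneSegment z y, ConeNear K R u w := by
  -- points `u n` of the sides `[x n, y n]` that escape from the other two sides
  by_contra! hcon
  choose x hx y hy z hz u hu hzx hzy using fun n : ℕ => hcon n (Nat.cast_nonneg n)
  have hdiff : ∀ {v : E}, v ∈ L ∩ interior K → v ∈ L \ {0} := fun hv =>
    ⟨hv.1, (hK.interior_subset_ne_zero hv.2).2⟩
  choose t r ht hr htr hcomb using hu
  have huL : ∀ n, u n ∈ L ∩ interior K := fun n =>
    ⟨by rw [hcomb]; exact hLa (hLs (ht n) (hx n).1) (hLs (hr n) (hy n).1),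
      hK.coneSegment_subset_interior (hx n).2 (hy n).2 ⟨t n, r n, ht n, hr n, htr n, hcomb n⟩⟩
  obtain ⟨p₀, a₀, b₀, u₀, s₀, t₀, r₀, h1, h2, h3, h4, p1, a1, b1,
      h5, h6, h7, h8, h9, h10, -, h11⟩ :=
    hK.exists_limit_triangle hLK hL hLs hcoc (p := z) (a := x) (b := y) (u := u) (s := fun _ => 0)
      (t := t) (r := r) (fun n => hdiff (hz n)) (fun n => hdiff (hx n)) (fun n => hdiff (hy n)) huL
      (fun _ => le_rfl) ht hr (fun n => by rw [zero_smul, zero_add]; exact hcomb n)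
      (fun n w hw _ => hzx n w hw) (fun n w hw _ => hzy n w hw)
  rw [h11 fun _ => rfl, zero_smul, zero_add] at h8
  have hne : ∀ {v : E}, v ∈ L → φ v = 1 → v ∈ K \ {0} := fun hv h =>
    mem_of_pos (φ := φ) (hLK hv) (by rw [h]; norm_num)
  -- a side in the boundary has its ends in the same open face
  have side : ∀ a ∈ L, φ a = 1 → (∀ w ∈ coneSegment p₀ a, w ∉ interior K) → SamePart K p₀ a := by
    intro a ha ha1 hint
    set m := (1 / 2 : ℝ) • p₀ + (1 / 2 : ℝ) • a with hm
    have hmseg : m ∈ coneSegment p₀ a :=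
      ⟨1 / 2, 1 / 2, by norm_num, by norm_num, by norm_num, rfl⟩
    have hmL : m ∈ L := hLa (hLs (by norm_num) h1) (hLs (by norm_num) ha)
    have hm0 := hK.coneSegment_subset (hne h1 p1) (hne ha ha1) hmseg
    obtain ⟨R, hR⟩ := h m ⟨hmL, hm0.2⟩ (hint m hmseg)
    refine hK.samePart_of_bounded (R := R) (hne h1 p1) (hne ha ha1) p1 ha1 fun s hs0 hs1 => ?_
    refine hR _ ⟨hLa (hLs (by linarith) h1) (hLs hs0.le ha), ?_⟩ ?_
    · exact (hK.coneSegment_subset (hne h1 p1) (hne ha ha1)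
        (mem_coneSegment_of_mem_Icc ⟨hs0.le, hs1.le⟩)).2
    · have := samePart_of_mem_Ioo hK (hLK h1) (hLK ha) (s := 1 / 2) (s' := s) (by norm_num)
        (by norm_num) hs0 hs1
      rwa [show (1 - 1 / 2 : ℝ) = 1 / 2 by norm_num] at this
  -- hence the limit `u₀` of the points `u n` lies in the part of `a₀`, in the boundary
  have hab := hK.samePart_trans (hne h2 a1) (hne h1 p1) (hne h3 b1) (side a₀ h2 a1 h9).symm
    (side b₀ h3 b1 h10)
  have hu1 : 0 < t₀ + r₀ := by
    have h12 := hK.pos (hK.interior_subset_ne_zero h4)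
    rw [h8, map_add, map_smul, map_smul, a1, b1] at h12
    simpa using h12
  have hau := hK.samePart_of_mem_coneSegment (hne h2 a1) (hne h3 b1) hab
    ⟨t₀, r₀, h6, h7, hu1, h8⟩
  exact h9 a₀ (right_mem_coneSegment _ _) (hK.mem_interior_of_samePart h4 (hne h2 a1) hau.symm)

end Cocompact

/-! ### Linear lifts of projective automorphisms -/

section Lifts

open Topology Filter

theorem IsConeAut.smul {E : Type*} [NormedAddCommGroup E] [NormedSpace ℝ E] {K L : Set E}
    (hKs : ∀ {t : ℝ} {x : E}, 0 ≤ t → x ∈ K → t • x ∈ K)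
    (hLs : ∀ {t : ℝ} {x : E}, 0 ≤ t → x ∈ L → t • x ∈ L) {A : E ≃ₗ[ℝ] E} (hA : IsConeAut K L A)
    {t : ℝ} (ht : 0 < t) : IsConeAut K L (A.trans (LinearEquiv.smulOfNeZero ℝ E t ht.ne')) := by
  have aux : ∀ P : Set E, (∀ {t : ℝ} {x : E}, 0 ≤ t → x ∈ P → t • x ∈ P) → ∀ w, t • w ∈ P ↔ w ∈ P :=
    fun P hP w => ⟨fun h => by
      have := hP (inv_nonneg.2 ht.le) h
      rwa [smul_smul, inv_mul_cancel₀ ht.ne', one_smul] at this, hP ht.le⟩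
  exact ⟨fun w => (aux K hKs _).trans (hA.mem_left w),
    fun w => (aux L hLs _).trans (hA.mem_right w)⟩

variable {d : ℕ}

/-- The linear automorphism of `ℝ^d` given by an invertible matrix. -/
abbrev glEquiv (A : Matrix.GeneralLinearGroup (Fin d) ℝ) : (Fin d → ℝ) ≃ₗ[ℝ] (Fin d → ℝ) :=
  DistribMulAction.toLinearEquiv ℝ (Fin d → ℝ) A

variable {Ω C : Set (RP d)} {K L : Set (Fin d → ℝ)} {φ : Module.Dual ℝ (Fin d → ℝ)}

/-- A linear automorphism that preserves `K ∪ -K` and `L ∪ -L` and does not exchange `K` and `-K`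
preserves both cones. -/
theorem IsConeModel.isConeAut_of_union (hM : IsConeModel Ω C K L φ)
    {A : (Fin d → ℝ) ≃ₗ[ℝ] (Fin d → ℝ)}
    (h1 : ∀ v, (A v ∈ interior K ∨ -A v ∈ interior K) ↔ (v ∈ interior K ∨ -v ∈ interior K))
    (h2 : ∀ v, (A v ∈ L ∩ interior K ∨ -A v ∈ L ∩ interior K) ↔
      (v ∈ L ∩ interior K ∨ -v ∈ L ∩ interior K))
    {u : Fin d → ℝ} (hu : u ∈ L ∩ interior K) (hu1 : 0 < φ (A u)) : IsConeAut K L A := by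
  have := hM.nontrivial
  have hK := hM.sharp
  have pos : ∀ {v}, v ∈ interior K → 0 < φ v := fun h => hK.pos (hK.interior_subset_ne_zero h)
  have key : ∀ v, v ∈ interior K → 0 < φ (A v) := by
    intro v hv
    have ne : ∀ w ∈ interior K, φ (A w) ≠ 0 := by
      intro w hw
      rcases (h1 w).2 (Or.inl hw) with h | h
      · exact (pos h).ne'
      · have := pos h
        rw [map_neg] at this
        linarith
    have := apply_mul_apply_pos (ψ := φ.comp A.toLinearMap) (ne v hv) (ne u hu.2)
      fun a b ha hb _ => ne _ (hK.convex.interior (hv) (hu.2) ha.le hb.le ‹_›)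
    exact pos_of_mul_pos_left this hu1.le
  have i1 : ∀ v, A v ∈ interior K ↔ v ∈ interior K := by
    intro v
    constructor
    · intro h
      rcases (h1 v).1 (Or.inl h) with h' | h'
      · exact h'
      · have e1 := key _ h'
        have e2 := pos h
        rw [map_neg, map_neg] at e1
        linarith
    · intro h
      rcases (h1 v).2 (Or.inl h) with h' | h'
      · exact h'
      · have e1 := key _ h
        have e2 := pos h'
        rw [map_neg] at e2
        linarith
  have i2 : ∀ v, A v ∈ L ∩ interior K ↔ v ∈ L ∩ interior K := by
    intro v
    constructor
    · intro h
      rcases (h2 v).1 (Or.inl h) with h' | h'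
      · exact h'
      · have e1 := key _ h'.2
        have e2 := pos h.2
        rw [map_neg, map_neg] at e1
        linarith
    · intro h
      rcases (h2 v).2 (Or.inl h) with h' | h'
      · exact h'
      · have e1 := key _ h.2
        have e2 := pos h'.2
        rw [map_neg] at e2
        linarith
  have clK : closure (interior K) = K := by
    rw [hK.convex.closure_interior_eq_closure_of_nonempty_interior ⟨u, hu.2⟩,
      hK.isClosed.closure_eq]
  have clL : closure (L ∩ interior K) = L := by
    refine subset_antisymm (closure_minimal Set.inter_subset_left hM.isClosed) fun w hw => ?_
    have t1 : Tendsto (fun n : ℕ => w + (1 / ((n : ℝ) + 1)) • u) atTop (𝓝 (w + (0 : ℝ) • u)) :=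
      tendsto_const_nhds.add (tendsto_one_div_add_atTop_nhds_zero_nat.smul_const u)
    rw [zero_smul, add_zero] at t1
    refine mem_closure_of_tendsto t1 (Eventually.of_forall fun n => ?_)
    have hn : (0 : ℝ) < 1 / ((n : ℝ) + 1) := by positivity
    exact ⟨hM.add_mem hw (hM.smul_mem hn.le hu.1),
      add_comm w ((1 / ((n : ℝ) + 1)) • u) ▸
        hK.add_mem_interior (hK.smul_mem_interior hu.2 hn) (hM.subset hw)⟩
  have pre : ∀ P : Set (Fin d → ℝ), (∀ v, A v ∈ P ↔ v ∈ P) →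
      ∀ v, A v ∈ closure P ↔ v ∈ closure P := by
    intro P hP
    have h1 := A.toContinuousLinearEquiv.toHomeomorph.preimage_closure P
    have h2 : A.toContinuousLinearEquiv.toHomeomorph ⁻¹' P = P := Set.ext hP
    rw [h2] at h1
    exact Set.ext_iff.1 h1
  have p1 := pre _ i1
  have p2 := pre _ i2
  rw [clK] at p1
  rw [clL] at p2
  exact ⟨p1, p2⟩

theorem IsProjectivizationOf.smul_mem_iff {S : Set (RP d)} {P : Set (Fin d → ℝ)}
    (hS : IsProjectivizationOf S P)
    {A : Matrix.GeneralLinearGroup (Fin d) ℝ} (hA : Matrix.ProjGenLinGroup.mk A • S = S)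
    (v : Fin d → ℝ) : (A • v ∈ P ∨ -(A • v) ∈ P) ↔ (v ∈ P ∨ -v ∈ P) := by
  by_cases hv : v = 0
  · subst hv
    simp
  · rw [← hS v hv, ← hS _ ((smul_ne_zero_iff_ne A).2 hv), ← Projectivization.PGL.mk_smul_mk A hv]
    conv_lhs => rw [← hA, Set.smul_mem_smul_set_iff]

/-- Every projective automorphism of the pair `(Ω, C)` lifts to a linear automorphism of the pair of
cones. -/
theorem IsConeModel.exists_lift (hM : IsConeModel Ω C K L φ) {g : PGLR d} (hΩ : g • Ω = Ω)
    (hC : g • C = C) :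
    ∃ A : Matrix.GeneralLinearGroup (Fin d) ℝ, Matrix.ProjGenLinGroup.mk A = g ∧
      IsConeAut K L (glEquiv A) := by
  have := hM.nontrivial
  have hK := hM.sharp
  obtain ⟨u, hu⟩ := hM.nonempty
  have main : ∀ A : Matrix.GeneralLinearGroup (Fin d) ℝ, Matrix.ProjGenLinGroup.mk A = g →
      0 < φ (A • u) → IsConeAut K L (glEquiv A) := by
    rintro A rfl h
    exact hM.isConeAut_of_union (hM.domain.smul_mem_iff hΩ)
      (hM.convex.smul_mem_iff hC) hu h
  obtain ⟨A, rfl⟩ := Matrix.ProjGenLinGroup.mk_surjective g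
  have hneg : Matrix.ProjGenLinGroup.mk (-A) = Matrix.ProjGenLinGroup.mk A := by
    rw [Matrix.ProjGenLinGroup.mk_eq_mk_iff]
    use -1
    ext i j
    simp
  rcases (hM.domain.smul_mem_iff hΩ u).2 (Or.inl hu.2) with h | h
  · exact ⟨A, rfl, main A rfl (hK.pos (hK.interior_subset_ne_zero h))⟩
  · refine ⟨-A, hneg, main _ hneg ?_⟩
    have := hK.pos (hK.interior_subset_ne_zero h)
    have e : (-A) • u = -(A • u) := by simp
    rwa [e]

theorem IsConeModel.isConeCocompact (hM : IsConeModel Ω C K L φ) {Λ : Subgroup (PGLR d)}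
    (h : IsNaiveConvexCocompactTriple Ω C Λ) : IsConeCocompact K L φ := by
  have := hM.nontrivial
  have hK := hM.sharp
  obtain ⟨Q, hQC, hQ, hcov⟩ := h.cocompact
  refine ⟨affCoord φ '' Q, ?_, ?_, ?_, ?_⟩
  · rintro _ ⟨x, hx, rfl⟩
    exact (hM.affCoord_mem (hQC hx)).2
  · exact hQ.image_of_continuousOn ((continuousOn_affCoord φ).mono fun x hx =>
      (hM.affCoord_mem (hQC hx)).1)
  · rintro _ ⟨x, hx, rfl⟩
    exact apply_affCoord (hM.affCoord_mem (hQC hx)).1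
  · intro v hv
    have hv0 : v ≠ 0 := (hK.interior_subset_ne_zero hv.2).2
    have hvC := (hM.convex v hv0).2 (Or.inl hv)
    obtain ⟨g, hg, hgv⟩ := Set.mem_iUnion₂.1 (hcov hvC)
    rw [Set.mem_smul_set_iff_inv_smul_mem] at hgv
    obtain ⟨A, hA, hAut⟩ := hM.exists_lift (h.aut _ (Λ.inv_mem hg)) (h.invariant _ (Λ.inv_mem hg))
    rw [← hA, Projectivization.PGL.mk_smul_mk] at hgv
    have hp : 0 < φ (glEquiv A v) :=
      hK.pos (hK.interior_subset_ne_zero ((hAut.mem_interior_iff v).2 hv.2))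
    exact ⟨_, hAut.smul hK.smul_mem hM.smul_mem (inv_pos.2 hp), _, hgv, affCoord_mk φ _⟩

end Lifts

/-! ### Coarse dimension zero and bounded faces -/

section CoarseDim

open Projectivization

variable {d : ℕ}

theorem isProjConvex_singleton (b : RP d) : IsProjConvex {b} := by
  obtain ⟨ψ, hψ⟩ : ∃ ψ : Module.Dual ℝ (Fin d → ℝ), ψ b.rep ≠ 0 := by
    by_contra! h
    exact b.rep_nonzero ((Module.forall_dual_apply_eq_zero_iff ℝ _).1 h)
  refine ⟨ψ, ?_, ?_, ?_⟩
  · rintro rfl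
    exact hψ rfl
  · rintro _ rfl
    exact hψ
  · rw [Set.image_singleton]
    exact convex_singleton _

theorem hasProjDim_zero_iff {B : Set (RP d)} : HasProjDim B 0 ↔ ∃ b, B = {b} := by
  constructor
  · intro h
    have h1 : Module.finrank ℝ (projSpan B) = 1 := h
    have h2 : ∀ x ∈ B, x.submodule = projSpan B := fun x hx =>
      Submodule.eq_of_le_of_finrank_eq (le_iSup₂_of_le x hx le_rfl) (by rw [h1, finrank_submodule])
    have h3 : B.Nonempty := by
      by_contra! h4
      subst h4
      have h5 : projSpan (∅ : Set (RP d)) = ⊥ := iSup₂_eq_bot.2 fun x hx => absurd hx (by simp)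
      rw [h5, finrank_bot] at h1
      omega
    obtain ⟨b, hb⟩ := h3
    refine ⟨b, subset_antisymm (fun x hx => ?_) (Set.singleton_subset_iff.2 hb)⟩
    exact submodule_injective ((h2 x hx).trans (h2 b hb).symm)
  · rintro ⟨b, rfl⟩
    have : projSpan {b} = b.submodule := by simp [projSpan]
    unfold HasProjDim
    rw [this, finrank_submodule]

/-- The coarse dimension vanishes exactly when the set lies in a ball. -/
theorem coarseDim_eq_zero_iff {F A : Set (RP d)} : coarseDim F A = 0 ↔
    ∃ R : ℝ, ∃ b ∈ F, ∀ p ∈ A, p ∈ F ∧ hilbertDist F p b < R := by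
  constructor
  · intro h
    have h1 : coarseDim F A < 1 := by rw [h]; exact zero_lt_one
    unfold coarseDim at h1
    obtain ⟨k, hk⟩ := iInf_lt_iff.1 h1
    obtain ⟨⟨R, -, B, hBF, -, hB, hA⟩, hk⟩ := iInf_lt_iff.1 hk
    have hk0 : k = 0 := by
      have : k < 1 := by exact_mod_cast hk
      omega
    subst hk0
    obtain ⟨b, rfl⟩ := hasProjDim_zero_iff.1 hB
    refine ⟨R, b, hBF rfl, fun p hp => ?_⟩
    obtain ⟨h1, _, rfl, h2⟩ := hA hp
    exact ⟨h1, h2⟩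
  · rintro ⟨R, b, hb, h⟩
    refine le_antisymm ?_ zero_le
    refine (iInf₂_le 0 ⟨max R 1, lt_max_of_lt_right one_pos, {b}, Set.singleton_subset_iff.2 hb,
      isProjConvex_singleton b, hasProjDim_zero_iff.2 ⟨b, rfl⟩, fun p hp => ?_⟩)
    exact ⟨(h p hp).1, b, rfl, (h p hp).2.trans_le (le_max_left _ _)⟩

theorem hilbertDist_le_of_hilbertDiam_le {F A : Set (RP d)} {R : ℝ} (hR : 0 ≤ R)
    (h : hilbertDiam F A ≤ ENNReal.ofReal R) {y z : RP d} (hy : y ∈ A) (hz : z ∈ A) :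
    hilbertDist F y z ≤ R :=
  (ENNReal.ofReal_le_ofReal_iff hR).1 <| le_trans
    (le_iSup₂_of_le (f := fun y _ => ⨆ z ∈ A, ENNReal.ofReal (hilbertDist F y z)) y hy
      (le_iSup₂_of_le (f := fun z _ => ENNReal.ofReal (hilbertDist F y z)) z hz le_rfl)) h

theorem mem_openFace_self (Ω : Set (RP d)) (x : RP d) : x ∈ openFace Ω x := Or.inl rfl

/-- A uniform bound on the diameters of the traces of the ideal boundary on the open faces gives
coarse dimension zero. -/
theorem coarseDim_eq_zero_of_hilbertDiam_le {Ω C : Set (RP d)} {R : ℝ} (hR : 0 ≤ R) {x : RP d}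
    (hx : x ∈ idealBoundary C)
    (h : hilbertDiam (openFace Ω x) (idealBoundary C ∩ openFace Ω x) ≤ ENNReal.ofReal R) :
    coarseDim (openFace Ω x) (idealBoundary C ∩ openFace Ω x) = 0 :=
  coarseDim_eq_zero_iff.2 ⟨R + 1, x, mem_openFace_self Ω x, fun p hp => ⟨hp.2, by
    have := hilbertDist_le_of_hilbertDiam_le hR h hp ⟨hx, mem_openFace_self Ω x⟩
    linarith⟩⟩

end CoarseDim

namespace IsConeModel

variable {d : ℕ} {Ω C : Set (RP d)} {K L : Set (Fin d → ℝ)} {φ : Module.Dual ℝ (Fin d → ℝ)}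
  (hM : IsConeModel Ω C K L φ)
include hM

theorem exists_rep_of_mem_idealBoundary {x : RP d} (hx : x ∈ idealBoundary C) :
    ∃ (v : Fin d → ℝ) (hv : v ≠ 0), v ∈ L ∧ v ∉ interior K ∧ Projectivization.mk ℝ v hv = x := by
  induction x using Projectivization.ind with
  | h v hv =>
  rcases (hM.mk_mem_idealBoundary_iff hv).1 hx with h | h
  · exact ⟨v, hv, h.1, h.2, rfl⟩
  · exact ⟨-v, neg_ne_zero.2 hv, h.1, h.2, mk_neg_eq hv⟩

theorem mem_conePart_of_mk_mem_openFace {x y : Fin d → ℝ} (hx : x ∈ K \ {0}) (hx0 : x ≠ 0)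
    (hy : y ∈ K) (hy0 : y ≠ 0)
    (h : Projectivization.mk ℝ y hy0 ∈ openFace Ω (Projectivization.mk ℝ x hx0)) :
    y ∈ conePart K x :=
  ((hM.openFace_isProjectivizationOf hx hx0 y hy0).1 h).resolve_right fun h' =>
    hM.sharp.not_neg_mem ⟨hy, hy0⟩ h'.1.1

theorem notMem_interior_of_mem_conePart {x y : Fin d → ℝ} (hx : x ∈ K \ {0})
    (hxi : x ∉ interior K) (hy : y ∈ conePart K x) : y ∉ interior K := by
  have := hM.nontrivial
  exact fun h => hxi (hM.sharp.mem_interior_of_samePart h hx hy.2.symm)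

/-- Faces of ideal points meet the closure of `C` only in the ideal boundary. -/
theorem closure_inter_openFace {x : RP d} (hx : x ∈ idealBoundary C) :
    closure C ∩ openFace Ω x = idealBoundary C ∩ openFace Ω x := by
  obtain ⟨x, hx0, hxL, hxi, rfl⟩ := hM.exists_rep_of_mem_idealBoundary hx
  ext z
  refine and_congr_left fun hz => ⟨fun h => ?_, fun h => h.1.1⟩
  obtain ⟨v, hv, hvL, rfl⟩ : ∃ (v : Fin d → ℝ) (hv : v ≠ 0),
      v ∈ L ∧ Projectivization.mk ℝ v hv = z := by
    induction z using Projectivization.ind with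
    | h v hv =>
    rcases (hM.closure_convex v hv).1 h with h | h
    · exact ⟨v, hv, h, rfl⟩
    · exact ⟨-v, neg_ne_zero.2 hv, h, mk_neg_eq hv⟩
  have hxK : x ∈ K \ {0} := ⟨hM.subset hxL, hx0⟩
  exact hM.mk_mem_idealBoundary hvL (hM.notMem_interior_of_mem_conePart hxK hxi
    (hM.mem_conePart_of_mk_mem_openFace hxK hx0 (hM.subset hvL) hv hz)) hv

theorem coneNear_of_coarseDim_eq_zero (h : ∀ x ∈ idealBoundary C,
    coarseDim (openFace Ω x) (idealBoundary C ∩ openFace Ω x) = 0) {x : Fin d → ℝ}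
    (hx : x ∈ L \ {0}) (hxi : x ∉ interior K) :
    ∃ R : ℝ, ∀ y ∈ L \ {0}, SamePart K x y → ConeNear K R y x := by
  have hK := hM.sharp
  have hx0 : x ≠ 0 := hx.2
  have hxK : x ∈ K \ {0} := ⟨hM.subset hx.1, hx0⟩
  obtain ⟨R, b, hb, hR⟩ := coarseDim_eq_zero_iff.1 (h _ (hM.mk_mem_idealBoundary hx.1 hxi hx0))
  obtain ⟨w, hw, hwx, rfl⟩ : ∃ (w : Fin d → ℝ) (hw : w ≠ 0), w ∈ conePart K x ∧
      Projectivization.mk ℝ w hw = b := by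
    induction b using Projectivization.ind with
    | h v hv =>
    rcases (hM.openFace_isProjectivizationOf hxK hx0 v hv).1 hb with h | h
    · exact ⟨v, hv, h, rfl⟩
    · exact ⟨-v, neg_ne_zero.2 hv, h, mk_neg_eq hv⟩
  refine ⟨R + coneDist K w x, fun y hy hxy => ?_⟩
  have hy0 : y ≠ 0 := hy.2
  have hyx : y ∈ conePart K x := ⟨⟨hM.subset hy.1, hy0⟩, hxy⟩
  have h1 := (hR _ ⟨hM.mk_mem_idealBoundary hy.1
    (hM.notMem_interior_of_mem_conePart hxK hxi hyx) hy0,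
    (hM.openFace_isProjectivizationOf hxK hx0 y hy0).2 (Or.inl hyx)⟩).2
  rw [hM.hilbertDist_openFace hxK hx0 hyx hwx hy0 hw] at h1
  exact hK.coneNear_trans hyx.1 hwx.1 hxK ((hK.coneNear_coneDist hyx.1 hwx.1
    (hK.samePart_of_mem_conePart hxK hyx hwx)).mono h1.le)
    (hK.coneNear_coneDist hwx.1 hxK hwx.2.symm)

theorem hilbertDiam_le {R : ℝ} (h : ∀ a ∈ L \ {0}, ∀ b ∈ L \ {0}, a ∉ interior K → SamePart K a b →
    coneDist K a b ≤ R) {x : RP d} (hx : x ∈ idealBoundary C) :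
    hilbertDiam (openFace Ω x) (idealBoundary C ∩ openFace Ω x) ≤ ENNReal.ofReal R := by
  obtain ⟨x, hx0, hxL, hxi, rfl⟩ := hM.exists_rep_of_mem_idealBoundary hx
  have hxK : x ∈ K \ {0} := ⟨hM.subset hxL, hx0⟩
  refine iSup₂_le fun y hy => iSup₂_le fun z hz => ENNReal.ofReal_le_ofReal ?_
  obtain ⟨y, hy0, hyL, hyi, rfl⟩ := hM.exists_rep_of_mem_idealBoundary hy.1
  obtain ⟨z, hz0, hzL, hzi, rfl⟩ := hM.exists_rep_of_mem_idealBoundary hz.1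
  have hyx := hM.mem_conePart_of_mk_mem_openFace hxK hx0 (hM.subset hyL) hy0 hy.2
  have hzx := hM.mem_conePart_of_mk_mem_openFace hxK hx0 (hM.subset hzL) hz0 hz.2
  rw [hM.hilbertDist_openFace hxK hx0 hyx hzx hy0 hz0]
  exact h y ⟨hyL, hy0⟩ z ⟨hzL, hz0⟩ hyi (hM.sharp.samePart_of_mem_conePart hxK hyx hzx)

/-- The restriction of the Hilbert metric to `C` is a metric. -/
theorem isPseudoDist : IsPseudoDist fun x y : C => hilbertDist Ω x y := by
  have := hM.nontrivial
  have hK := hM.sharp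
  have mem : ∀ x : C, affCoord φ (x : RP d) ∈ K \ {0} := fun x =>
    hK.interior_subset_ne_zero (hM.affCoord_mem x.2).2.2
  have same : ∀ x y : C, SamePart K (affCoord φ (x : RP d)) (affCoord φ (y : RP d)) := fun x y =>
    hK.samePart_of_mem_interior (hM.affCoord_mem x.2).2.2 (hM.affCoord_mem y.2).2.2
  constructor
  · intro x
    rw [hM.hilbertDist_eq x.2 x.2, hK.coneDist_self (mem x)]
  · intro x y
    rw [hM.hilbertDist_eq x.2 y.2, hM.hilbertDist_eq y.2 x.2, coneDist_symm]
  · intro x y z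
    rw [hM.hilbertDist_eq x.2 z.2, hM.hilbertDist_eq x.2 y.2, hM.hilbertDist_eq y.2 z.2]
    exact hK.coneDist_triangle (mem x) (mem y) (mem z) (same x y) (same y z)

/-- Any two points of `C` are joined by a rough geodesic that follows the projective segment between
them. -/
theorem exists_isRoughGeodesic (x y : C) : ∃ (n : ℕ) (γ : ℕ → C),
    IsRoughGeodesic (fun x y : C => hilbertDist Ω x y) 2 x y n γ ∧
    (∀ i, affCoord φ (γ i : RP d) ∈ coneSegment (affCoord φ (x : RP d)) (affCoord φ (y : RP d))) ∧
    ∀ w ∈ coneSegment (affCoord φ (x : RP d)) (affCoord φ (y : RP d)),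
      ∃ i ≤ n, coneDist K w (affCoord φ (γ i : RP d)) ≤ 1 := by
  have := hM.nontrivial
  have hK := hM.sharp
  obtain ⟨hx1, hxL, hxi⟩ := hM.affCoord_mem x.2
  obtain ⟨hy1, hyL, hyi⟩ := hM.affCoord_mem y.2
  have hx := hK.interior_subset_ne_zero hxi
  have hy := hK.interior_subset_ne_zero hyi
  have hxy := hK.samePart_of_mem_interior hxi hyi
  obtain ⟨n, γ, hγ, hseg, hdense⟩ := hK.exists_roughGeodesic hx hy hxy
  have hi : ∀ i, γ i ∈ L ∩ interior K := by
    intro i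
    refine ⟨?_, hK.coneSegment_subset_interior hxi hyi (hseg i)⟩
    obtain ⟨a, b, ha, hb, -, h⟩ := hseg i
    rw [h]
    exact hM.add_mem (hM.smul_mem ha hxL) (hM.smul_mem hb hyL)
  have hi0 : ∀ i, γ i ≠ 0 := fun i => (hK.interior_subset_ne_zero (hi i).2).2
  let γ' : ℕ → C := fun i =>
    ⟨Projectivization.mk ℝ (γ i) (hi0 i), (hM.convex _ _).2 (Or.inl (hi i))⟩
  have hγ' : ∀ i, affCoord φ (γ' i : RP d) = (φ (γ i))⁻¹ • γ i := fun i => affCoord_mk φ (hi0 i)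
  have hpos : ∀ i, 0 < (φ (γ i))⁻¹ := fun i =>
    inv_pos.2 (hK.pos (hK.interior_subset_ne_zero (hi i).2))
  have hdist : ∀ i j, hilbertDist Ω (γ' i) (γ' j) = coneDist K (γ i) (γ j) := fun i j =>
    hM.hilbertDist_domain (hi i).2 (hi j).2 (hi0 i) (hi0 j)
  refine ⟨n, γ', ⟨?_, ?_, ?_, ?_⟩, ?_, ?_⟩
  · apply Subtype.ext
    change Projectivization.mk ℝ (γ 0) (hi0 0) = x
    simp only [hγ.start]
    exact mk_affCoord hx1
  · apply Subtype.ext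
    change Projectivization.mk ℝ (γ n) (hi0 n) = y
    simp only [hγ.finish]
    exact mk_affCoord hy1
  · intro i j h1 h2
    rw [hdist]
    exact hγ.lower i j h1 h2
  · intro i j h1 h2
    rw [hdist]
    exact hγ.upper i j h1 h2
  · intro i
    rw [hγ']
    exact smul_mem_coneSegment (hseg i) (hpos i)
  · intro w hw
    obtain ⟨i, hin, h⟩ := hdense w hw
    refine ⟨i, hin, ?_⟩
    have hwK := hK.coneSegment_subset_interior hxi hyi hw
    rwa [hγ', hK.coneDist_smul_right (hK.interior_subset_ne_zero hwK)
      (hK.interior_subset_ne_zero (hi i).2) (hK.samePart_of_mem_interior hwK (hi i).2) (hpos i)]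

/-- If every trace of `L` on a boundary face is bounded, then `C` is Gromov hyperbolic. -/
theorem isGromovHyperbolic (hcoc : IsConeCocompact K L φ)
    (h : ∀ x ∈ L \ {0}, x ∉ interior K → ∃ R, ∀ y ∈ L \ {0}, SamePart K x y → ConeNear K R y x) :
    IsGromovHyperbolic fun x y : C => hilbertDist Ω x y := by
  have := hM.nontrivial
  have hK := hM.sharp
  obtain ⟨R, hR, hslim⟩ := hK.exists_slim hM.subset hM.isClosed hM.add_mem hM.smul_mem hcoc h
  choose n γ hγ hseg hdense using hM.exists_isRoughGeodesic
  refine isGromovHyperbolic_of_slim hM.isPseudoDist (δ := R + 1) (by linarith) hγ ?_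
  intro x y z i _
  have hx := (hM.affCoord_mem x.2).2
  have hy := (hM.affCoord_mem y.2).2
  have hz := (hM.affCoord_mem z.2).2
  have hi := (hM.affCoord_mem (γ x z i).2).2.2
  have step : ∀ x' y' : C, ∀ w ∈ coneSegment (affCoord φ (x' : RP d)) (affCoord φ (y' : RP d)),
      ConeNear K R (affCoord φ (γ x z i : RP d)) w →
      ∃ j ≤ n x' y', hilbertDist Ω (γ x z i) (γ x' y' j) ≤ R + 1 := by
    intro x' y' w hw hnear
    obtain ⟨j, hj, hjw⟩ := hdense x' y' w hw
    refine ⟨j, hj, ?_⟩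
    have hwi := hK.coneSegment_subset_interior (hM.affCoord_mem x'.2).2.2
      (hM.affCoord_mem y'.2).2.2 hw
    have hji := (hM.affCoord_mem (γ x' y' j).2).2.2
    rw [hM.hilbertDist_eq (γ x z i).2 (γ x' y' j).2]
    refine (hK.coneDist_triangle (hK.interior_subset_ne_zero hi) (hK.interior_subset_ne_zero hwi)
      (hK.interior_subset_ne_zero hji) (hK.samePart_of_mem_interior hi hwi)
      (hK.samePart_of_mem_interior hwi hji)).trans (add_le_add ?_ hjw)
    exact hK.coneDist_le_of_coneNear (hK.interior_subset_ne_zero hi)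
      (hK.interior_subset_ne_zero hwi) hnear
  rcases hslim _ hx _ hz _ hy _ (hseg x z i) with ⟨w, hw, hn⟩ | ⟨w, hw, hn⟩
  · left
    rw [coneSegment_symm] at hw
    exact step x y w hw hn
  · right
    exact step y z w hw hn

end IsConeModel

/-! ### Simplices -/

section Simplex

open Projectivization Topology Filter

variable {d : ℕ}

/-- Moving a positive vector along a line until it first meets the boundary of the orthant. -/
theorem exists_add_smul_nonneg_eq_zero {n : ℕ} {c e : Fin n → ℝ} (hc : ∀ i, 0 < c i) (he : e ≠ 0) :
    ∃ t : ℝ, (∀ i, 0 ≤ (c + t • e) i) ∧ ∃ i, (c + t • e) i = 0 := by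
  have main : ∀ e : Fin n → ℝ, (∃ i, e i < 0) →
      ∃ t : ℝ, (∀ i, 0 ≤ (c + t • e) i) ∧ ∃ i, (c + t • e) i = 0 := by
    rintro e ⟨i₀, hi₀⟩
    obtain ⟨j, hj, hmin⟩ := Finset.exists_min_image (Finset.univ.filter fun i => e i < 0)
      (fun i => c i / -e i) ⟨i₀, by simpa using hi₀⟩
    have hj : e j < 0 := by simpa using hj
    refine ⟨c j / -e j, fun i => ?_, j, ?_⟩
    · simp only [Pi.add_apply, Pi.smul_apply, smul_eq_mul]
      have h0 : 0 < c j / -e j := div_pos (hc j) (by linarith)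
      rcases le_or_gt 0 (e i) with hi | hi
      · have := mul_nonneg h0.le hi
        have := (hc i).le
        linarith
      · have := hmin i (by simpa using hi)
        rw [le_div_iff₀ (by linarith)] at this
        linarith
    · simp only [Pi.add_apply, Pi.smul_apply, smul_eq_mul]
      have : e j ≠ 0 := hj.ne
      field_simp
      ring
  obtain ⟨i, hi⟩ := Function.ne_iff.1 he
  rcases lt_or_gt_of_ne hi with h | h
  · exact main e ⟨i, h⟩
  · obtain ⟨t, ht⟩ := main (-e) ⟨i, by simpa using h⟩
    exact ⟨-t, by simpa using ht⟩

theorem mk_smul_set_eq_stdProjSimplex_iff {A : Matrix.GeneralLinearGroup (Fin d) ℝ} {S : Set (RP d)}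
    {k : ℕ} : Matrix.ProjGenLinGroup.mk A • S = stdProjSimplex d k ↔
      IsProjectivizationOf S {v | (∀ i : Fin d, i.val ≤ k → 0 < (A • v) i) ∧
        ∀ i : Fin d, k < i.val → (A • v) i = 0} := by
  have hstd : ∀ (v : Fin d → ℝ) (hv : v ≠ 0), mk ℝ v hv ∈ stdProjSimplex d k ↔
      ((∀ i : Fin d, i.val ≤ k → 0 < v i) ∧ ∀ i : Fin d, k < i.val → v i = 0) ∨
      ((∀ i : Fin d, i.val ≤ k → 0 < (-v) i) ∧ ∀ i : Fin d, k < i.val → (-v) i = 0) := by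
    intro v hv
    constructor
    · rintro ⟨w, hw, hvw, h1, h2⟩
      obtain ⟨a, rfl⟩ := (mk_eq_mk_iff' ℝ _ _ hv hw).1 hvw
      have ha : a ≠ 0 := by
        rintro rfl
        exact hv (zero_smul ℝ w)
      rcases lt_or_gt_of_ne ha with ha | ha
      · right
        refine ⟨fun i hi => ?_, fun i hi => ?_⟩
        · simpa using mul_pos (neg_pos.2 ha) (h1 i hi)
        · simp [h2 i hi]
      · left
        refine ⟨fun i hi => ?_, fun i hi => ?_⟩
        · simpa using mul_pos ha (h1 i hi)
        · simp [h2 i hi]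
    · rintro (h | h)
      · exact ⟨v, hv, rfl, h⟩
      · exact ⟨-v, neg_ne_zero.2 hv, (mk_neg_eq hv).symm, h⟩
  constructor
  · intro h v hv
    rw [← Set.smul_mem_smul_set_iff (a := Matrix.ProjGenLinGroup.mk A), h, PGL.mk_smul_mk, hstd]
    simp only [Set.mem_ofPred_eq, smul_neg]
  · intro h
    ext z
    rw [Set.mem_smul_set_iff_inv_smul_mem]
    obtain ⟨y, rfl⟩ : ∃ y, z = Matrix.ProjGenLinGroup.mk A • y :=
      ⟨(Matrix.ProjGenLinGroup.mk A)⁻¹ • z, (smul_inv_smul _ _).symm⟩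
    rw [inv_smul_smul]
    induction y using ind with
    | h v hv =>
    rw [h v hv, PGL.mk_smul_mk, hstd]
    simp only [Set.mem_ofPred_eq, smul_neg]

/-- A simplex of dimension at least two contains, as the projectivization of a linear section, a
2-simplex whose boundary lies in the boundary of the large one. -/
theorem IsProjSimplex.exists_linearMap {S : Set (RP d)} {k : ℕ} (hS : IsProjSimplex S k)
    (hk : 2 ≤ k) : ∃ F : (Fin 3 → ℝ) →ₗ[ℝ] (Fin d → ℝ), Function.Injective F ∧
      ∀ (c : Fin 3 → ℝ) (hc : F c ≠ 0), mk ℝ (F c) hc ∈ S ↔ (∀ i, 0 < c i) ∨ ∀ i, c i < 0 := by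
  obtain ⟨hkd, g, hg⟩ := hS
  obtain ⟨A, rfl⟩ := Matrix.ProjGenLinGroup.mk_surjective g
  rw [mk_smul_set_eq_stdProjSimplex_iff] at hg
  let W : (Fin 3 → ℝ) →ₗ[ℝ] (Fin d → ℝ) := LinearMap.pi fun i =>
    if i.val ≤ k then LinearMap.proj (⟨min i.val 2, by omega⟩ : Fin 3) else 0
  have hW1 : ∀ (c : Fin 3 → ℝ) (i : Fin d), i.val ≤ k → W c i = c ⟨min i.val 2, by omega⟩ := by
    intro c i hi
    simp [W, hi]
  have hW2 : ∀ (c : Fin 3 → ℝ) (i : Fin d), k < i.val → W c i = 0 := by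
    intro c i hi
    simp [W, not_le.2 hi]
  have hW3 : ∀ (c : Fin 3 → ℝ) (j : Fin 3), W c ⟨j.val, by omega⟩ = c j := by
    intro c j
    rw [hW1 c _ (by simp only []; omega)]
    congr 1
    apply Fin.ext
    simp only []
    omega
  have hAW : ∀ c, A • (glEquiv A).symm (W c) = W c := fun c => (glEquiv A).apply_symm_apply (W c)
  refine ⟨(glEquiv A).symm.toLinearMap.comp W, (glEquiv A).symm.injective.comp fun c c' h => ?_, ?_⟩
  · ext j
    rw [← hW3 c j, h, hW3]
  · intro c hc
    rw [hg _ hc]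
    simp only [Set.mem_ofPred_eq, smul_neg, LinearMap.comp_apply, LinearEquiv.coe_coe, hAW,
      Pi.neg_apply]
    have e1 : ∀ c : Fin 3 → ℝ, ((∀ i : Fin d, i.val ≤ k → 0 < W c i) ∧
        ∀ i : Fin d, k < i.val → W c i = 0) ↔ ∀ j, 0 < c j := by
      intro c
      refine ⟨fun h j => ?_, fun h => ⟨fun i hi => ?_, hW2 c⟩⟩
      · rw [← hW3 c j]
        exact h.1 _ (by simp only []; omega)
      · rw [hW1 c i hi]
        exact h _
    have e2 := e1 (-c)
    simp only [map_neg, Pi.neg_apply, neg_pos] at e2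
    rw [e1 c]
    simp only [neg_pos]
    rw [← e2]

/-- The positive combinations of three linearly independent vectors form a 2-simplex. -/
theorem isProjSimplex_two {f : Fin 3 → Fin d → ℝ} (hf : LinearIndependent ℝ f) {S : Set (RP d)}
    (hS : IsProjectivizationOf S (Fintype.linearCombination ℝ f '' {c | ∀ i, 0 < c i})) :
    IsProjSimplex S 2 := by
  have hd : 2 + 1 ≤ d := by simpa using hf.fintype_card_le_finrank
  let ι : Fin 3 → Fin d := Fin.castLE hd
  have hι : Function.Injective ι := Fin.castLE_injective hd
  have he : LinearIndependent ℝ (fun i => (Pi.basisFun ℝ (Fin d)) (ι i)) :=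
    (Pi.basisFun ℝ (Fin d)).linearIndependent.comp ι hι
  obtain ⟨T, hT⟩ := Submodule.exists_linearEquiv_restrict_eq
    (hf.linearCombinationEquiv.symm ≪≫ₗ he.linearCombinationEquiv)
  have hTf : ∀ i, T (f i) = Pi.single (ι i) 1 := by
    intro i
    have h1 : (hf.linearCombinationEquiv (Finsupp.single i 1) : Fin d → ℝ) = f i := by simp
    rw [← h1, ← hT]
    simp
  have hTc : ∀ c, T (Fintype.linearCombination ℝ f c) = ∑ i, c i • Pi.single (ι i) (1 : ℝ) := by
    intro c
    simp only [Fintype.linearCombination_apply, map_sum, map_smul, hTf]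
  have hTι : ∀ c i, T (Fintype.linearCombination ℝ f c) (ι i) = c i := by
    intro c i
    rw [hTc, Finset.sum_apply, Finset.sum_eq_single i]
    · simp
    · intro j _ hj
      simp [hι.ne hj.symm]
    · simp
  have hT0 : ∀ c (i : Fin d), 2 < i.val → T (Fintype.linearCombination ℝ f c) i = 0 := by
    intro c i hi
    rw [hTc, Finset.sum_apply]
    refine Finset.sum_eq_zero fun j _ => ?_
    have : i ≠ ι j := by
      rintro rfl
      have := j.2
      simp only [ι, Fin.val_castLE] at hi
      omega
    simp [this]
  let A : Matrix.GeneralLinearGroup (Fin d) ℝ :=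
    Matrix.GeneralLinearGroup.toLin.symm (LinearMap.GeneralLinearGroup.ofLinearEquiv T)
  have hA : ∀ v, A • v = T v := by
    intro v
    have h1 : Matrix.GeneralLinearGroup.toLin A = LinearMap.GeneralLinearGroup.ofLinearEquiv T :=
      Matrix.GeneralLinearGroup.toLin.apply_symm_apply _
    have h2 := congrArg (fun U : LinearMap.GeneralLinearGroup ℝ (Fin d → ℝ) => U.1 v) h1
    exact h2
  refine ⟨hd, Matrix.ProjGenLinGroup.mk A, mk_smul_set_eq_stdProjSimplex_iff.2 ?_⟩
  convert hS using 1
  ext v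
  simp only [hA, Set.mem_ofPred_eq]
  constructor
  · rintro ⟨h1, h2⟩
    refine ⟨fun i => T v (ι i), fun i => h1 _ (by simp only [ι, Fin.val_castLE]; omega), ?_⟩
    apply T.injective
    ext j
    rcases le_or_gt j.val 2 with hj | hj
    · have : j = ι ⟨j.val, by omega⟩ := by
        apply Fin.ext
        simp [ι]
      rw [this, hTι]
    · rw [hT0 _ _ hj, h2 _ hj]
  · rintro ⟨c, hc, rfl⟩
    refine ⟨fun j hj => ?_, hT0 c⟩
    have : j = ι ⟨j.val, by omega⟩ := by
      apply Fin.ext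
      simp [ι]
    rw [this, hTι]
    exact hc _

end Simplex

/-! ### Properly embedded simplices -/

namespace IsConeModel

open Topology Filter

variable {d : ℕ} {Ω C : Set (RP d)} {K L : Set (Fin d → ℝ)} {φ : Module.Dual ℝ (Fin d → ℝ)}
  (hM : IsConeModel Ω C K L φ)
include hM

/-- A triangle in `L` whose edges lie in the boundary of `K` but which meets the interior of `K`
gives a properly embedded simplex in `C`. -/
theorem exists_isProperlyEmbedded {f : Fin 3 → Fin d → ℝ} (hf : ∀ i, f i ∈ L)
    (hedge : ∀ c : Fin 3 → ℝ, (∀ i, 0 ≤ c i) → (∃ i, c i = 0) →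
      Fintype.linearCombination ℝ f c ∉ interior K)
    {c : Fin 3 → ℝ} (hc : ∀ i, 0 ≤ c i) (hcK : Fintype.linearCombination ℝ f c ∈ interior K) :
    ∃ S : Set (RP d), IsProjSimplex S 2 ∧ IsProperlyEmbedded S C := by
  have := hM.nontrivial
  have hK := hM.sharp
  set F := Fintype.linearCombination ℝ f with hF
  have hc0 : ∀ i, 0 < c i := fun i => lt_of_le_of_ne (hc i) fun h => hedge c hc ⟨i, h.symm⟩ hcK
  have hFL : ∀ e : Fin 3 → ℝ, (∀ i, 0 ≤ e i) → F e ∈ L := by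
    intro e he
    have h0 : ∀ s : Finset (Fin 3), ∑ i ∈ s, e i • f i ∈ L := by
      intro s
      induction s using Finset.induction_on with
      | empty =>
        obtain ⟨u, hu⟩ := hM.nonempty
        simpa using hM.smul_mem le_rfl hu.1
      | insert i s hi ih =>
        rw [Finset.sum_insert hi]
        exact hM.add_mem (hM.smul_mem (he i) (hf i)) ih
    rw [hF, Fintype.linearCombination_apply]
    exact h0 _
  -- A linear relation would move the interior point to an edge without changing it.
  have hker : ∀ e, F e = 0 → e = 0 := by
    intro e he
    by_contra hne
    obtain ⟨t, h1, h2⟩ := exists_add_smul_nonneg_eq_zero hc0 hne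
    refine hedge _ h1 h2 ?_
    rwa [map_add, map_smul, he, smul_zero, add_zero]
  have hinj : Function.Injective F := (injective_iff_map_eq_zero F).2 hker
  have hlin : LinearIndependent ℝ f := by
    rw [Fintype.linearIndependent_iff]
    intro e he i
    exact congrFun (hker e (by rwa [hF, Fintype.linearCombination_apply])) i
  have hpos : ∀ e : Fin 3 → ℝ, (∀ i, 0 < e i) → F e ∈ interior K := by
    intro e he
    obtain ⟨j, -, hj⟩ := Finset.exists_min_image Finset.univ (fun i => e i / c i)
      Finset.univ_nonempty
    have hj0 : 0 < e j / c j := div_pos (he j) (hc0 j)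
    have e1 : e = (e j / c j) • c + (e - (e j / c j) • c) := by abel
    rw [e1, map_add, map_smul]
    refine hK.add_mem_interior (hK.smul_mem_interior hcK hj0) (hM.subset (hFL _ fun i => ?_))
    have := hj i (Finset.mem_univ i)
    rw [le_div_iff₀ (hc0 i)] at this
    simpa using this
  have hzero : ∀ e : Fin 3 → ℝ, (∀ i, 0 < e i) → F e ≠ 0 := fun e he =>
    (hK.interior_subset_ne_zero (hpos e he)).2
  let S : Set (RP d) := {z | ∃ (v : Fin d → ℝ) (hv : v ≠ 0), z = Projectivization.mk ℝ v hv ∧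
    v ∈ F '' {e | ∀ i, 0 < e i}}
  have hS : IsProjectivizationOf S (F '' {e | ∀ i, 0 < e i}) := by
    intro v hv
    constructor
    · rintro ⟨_, hw, hvw, ⟨e, he, rfl⟩⟩
      obtain ⟨a, rfl⟩ := (Projectivization.mk_eq_mk_iff' ℝ _ _ hv hw).1 hvw
      have ha : a ≠ 0 := by
        rintro rfl
        exact hv (zero_smul ℝ _)
      rcases lt_or_gt_of_ne ha with ha | ha
      · exact Or.inr ⟨-a • e, fun i => mul_pos (neg_pos.2 ha) (he i), by rw [map_smul, neg_smul]⟩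
      · exact Or.inl ⟨a • e, fun i => mul_pos ha (he i), by rw [map_smul]⟩
    · rintro (h | h)
      · exact ⟨v, hv, rfl, h⟩
      · exact ⟨-v, neg_ne_zero.2 hv, (mk_neg_eq hv).symm, h⟩
  have hSC : S ⊆ C := by
    rintro _ ⟨v, hv, rfl, ⟨e, he, rfl⟩⟩
    exact (hM.convex _ hv).2 (Or.inl ⟨hFL e fun i => (he i).le, hpos e he⟩)
  refine ⟨S, isProjSimplex_two hlin hS, hSC, ?_⟩
  refine (Topology.IsClosedEmbedding.mk (Topology.IsEmbedding.inclusion hSC) ?_).isProperMap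
  have hclosed : IsClosed (F '' {e | ∀ i, 0 ≤ e i}) := by
    have h1 : IsClosed {e : Fin 3 → ℝ | ∀ i, 0 ≤ e i} := by
      simp only [Set.ofPred_forall]
      exact isClosed_iInter fun i => isClosed_le continuous_const (continuous_apply i)
    exact (LinearMap.isClosedEmbedding_of_injective (LinearMap.ker_eq_bot.2 hinj)).isClosedMap _ h1
  have hlift : closure (projLifts S) ⊆ (F '' {e | ∀ i, 0 ≤ e i}) ∪ -(F '' {e | ∀ i, 0 ≤ e i}) := by
    refine closure_minimal ?_ (hclosed.union hclosed.neg)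
    have hsub : F '' {e | ∀ i, 0 < e i} ⊆ F '' {e | ∀ i, 0 ≤ e i} :=
      Set.image_mono fun e he i => (he i).le
    rintro v ⟨hv, h⟩
    rcases (hS v hv).1 h with h | h
    · exact Or.inl (hsub h)
    · exact Or.inr (hsub h)
  have hclS : closure S ∩ C ⊆ S := by
    rintro z ⟨hz, hzC⟩
    obtain ⟨hz1, hzL, hzi⟩ := hM.affCoord_mem hzC
    have hz0 := affCoord_ne_zero hz1
    rw [← mk_affCoord hz1] at hz ⊢
    rw [mk_mem_closure_iff] at hz
    rcases hlift hz with ⟨e, he, hez⟩ | ⟨e, he, hez⟩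
    · refine (hS _ hz0).2 (Or.inl ⟨e, fun i => lt_of_le_of_ne (he i) fun h => ?_, hez⟩)
      refine hedge e he ⟨i, h.symm⟩ ?_
      rwa [hez]
    · exact absurd (hez ▸ hM.subset (hFL e he))
        (hK.not_neg_mem (hK.interior_subset_ne_zero hzi))
  rw [Set.range_inclusion]
  have : {x : C | (x : RP d) ∈ S} = Subtype.val ⁻¹' closure S :=
    Set.ext fun x => ⟨fun h => subset_closure h, fun h => hclS ⟨h, x.2⟩⟩
  rw [this]
  exact isClosed_closure.preimage continuous_subtype_val

/-- In logarithmic coordinates the Hilbert metric of a simplex is the polyhedral norm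
`x ↦ (max x - min x) / 2`; four points of this normed plane violate the four-point inequality. -/
theorem not_isGromovHyperbolic_of_isProperlyEmbedded {S : Set (RP d)} {k : ℕ} (hk : 2 ≤ k)
    (hS : IsProjSimplex S k) (hSC : IsProperlyEmbedded S C) :
    ¬ IsGromovHyperbolic fun x y : C => hilbertDist Ω x y := by
  have := hM.nontrivial
  have hK := hM.sharp
  obtain ⟨F, hinj, hF⟩ := hS.exists_linearMap hk
  obtain ⟨hsub, hproper⟩ := hSC
  have hF0 : ∀ {e : Fin 3 → ℝ}, e ≠ 0 → F e ≠ 0 := fun he h => he (hinj (h.trans (map_zero F).symm))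
  have hFc : Continuous F := F.continuous_of_finiteDimensional
  have hpm : ∀ e : Fin 3 → ℝ, (∀ i, 0 < e i) → F e ∈ L ∩ interior K ∨ -F e ∈ L ∩ interior K := by
    intro e he
    have h0 : F e ≠ 0 := hF0 fun h => by simpa [h] using he 0
    exact (hM.convex _ h0).1 (hsub ((hF e h0).2 (Or.inl he)))
  -- The edges of the simplex do not meet `C`, since the simplex is closed in `C`.
  have hedge : ∀ e : Fin 3 → ℝ, (∀ i, 0 ≤ e i) → (∃ i, e i = 0) →
      ∀ h0 : F e ≠ 0, Projectivization.mk ℝ (F e) h0 ∉ C := by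
    rintro e he ⟨i, hi⟩ h0 hC
    have hcl : Projectivization.mk ℝ (F e) h0 ∈ closure S := by
      rw [mk_mem_closure_iff]
      have t1 : Tendsto (fun n : ℕ => F (e + (1 / ((n : ℝ) + 1)) • 1)) atTop
          (𝓝 (F (e + (0 : ℝ) • 1))) :=
        (hFc.tendsto _).comp
          (tendsto_const_nhds.add (tendsto_one_div_add_atTop_nhds_zero_nat.smul_const _))
      rw [zero_smul, add_zero] at t1
      refine mem_closure_of_tendsto t1 (Eventually.of_forall fun n => ?_)
      have hp : ∀ i, 0 < (e + (1 / ((n : ℝ) + 1)) • (1 : Fin 3 → ℝ)) i := by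
        intro i
        have h1 : (0 : ℝ) < 1 / ((n : ℝ) + 1) := by positivity
        have := he i
        simp only [Pi.add_apply, Pi.smul_apply, Pi.one_apply, smul_eq_mul, mul_one]
        linarith
      have h0' := hF0 (e := e + (1 / ((n : ℝ) + 1)) • (1 : Fin 3 → ℝ)) fun h => by
        have := hp 0
        rw [h] at this
        simp at this
      exact ⟨h0', (hF _ h0').2 (Or.inl hp)⟩
    have hrange : IsClosed {x : C | (x : RP d) ∈ S} := by
      rw [← Set.range_inclusion hsub]
      exact hproper.isClosedMap.isClosed_range
    have hmem : Projectivization.mk ℝ (F e) h0 ∈ S := by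
      have h1 : (⟨_, hC⟩ : C) ∈ closure {x : C | (x : RP d) ∈ S} := by
        rw [closure_subtype]
        refine closure_mono ?_ hcl
        intro z hz
        exact ⟨⟨z, hsub hz⟩, hz, rfl⟩
      rw [hrange.closure_eq] at h1
      exact h1
    rcases (hF e h0).1 hmem with h1 | h1
    · exact (h1 i).ne' hi
    · exact (h1 i).ne hi
  -- After a change of sign the open simplex is represented in `L ∩ interior K`.
  obtain ⟨F, hpos, hedge⟩ : ∃ F : (Fin 3 → ℝ) →ₗ[ℝ] (Fin d → ℝ),
      (∀ e : Fin 3 → ℝ, (∀ i, 0 < e i) → F e ∈ L ∩ interior K) ∧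
      ∀ e : Fin 3 → ℝ, (∀ i, 0 ≤ e i) → (∃ i, e i = 0) → F e ∉ L ∩ interior K := by
    have pos : ∀ {v}, v ∈ interior K → 0 < φ v := fun h => hK.pos (hK.interior_subset_ne_zero h)
    have main : ∀ G : (Fin 3 → ℝ) →ₗ[ℝ] (Fin d → ℝ),
        (∀ e : Fin 3 → ℝ, (∀ i, 0 < e i) → G e ∈ L ∩ interior K ∨ -G e ∈ L ∩ interior K) →
        G 1 ∈ L ∩ interior K → ∀ e : Fin 3 → ℝ, (∀ i, 0 < e i) → G e ∈ L ∩ interior K := by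
      intro G hG h1 e he
      have hne : ∀ e : Fin 3 → ℝ, (∀ i, 0 < e i) → φ (G e) ≠ 0 := by
        intro e he
        rcases hG e he with h | h
        · exact (pos h.2).ne'
        · have := pos h.2
          rw [map_neg] at this
          linarith
      refine (hG e he).resolve_right fun h => ?_
      have h2 := apply_mul_apply_pos (ψ := φ.comp G) (v := e) (w := 1) (hne e he)
        (hne 1 fun _ => one_pos) fun a b ha hb _ => hne _ fun i => by
          have := mul_pos ha (he i)
          simp only [Pi.add_apply, Pi.smul_apply, Pi.one_apply, smul_eq_mul, mul_one]
          linarith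
      have h3 := pos_of_mul_pos_left h2 (pos h1.2).le
      have h4 := pos h.2
      rw [map_neg] at h4
      simp only [LinearMap.comp_apply] at h3
      linarith
    rcases hpm 1 fun _ => one_pos with h1 | h1
    · refine ⟨F, main F hpm h1, fun e he hi h => ?_⟩
      have h0 : F e ≠ 0 := (hK.interior_subset_ne_zero h.2).2
      exact hedge e he hi h0 ((hM.convex _ h0).2 (Or.inl h))
    · refine ⟨-F, main (-F) (fun e he => ?_) h1, fun e he hi h => ?_⟩
      · simpa using (hpm e he).symm
      · have h0 : F e ≠ 0 := fun h' => (hK.interior_subset_ne_zero h.2).2 (by simp [h'])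
        exact hedge e he hi h0 ((hM.convex _ h0).2 (Or.inr h))
  have hFL : ∀ e : Fin 3 → ℝ, (∀ i, 0 ≤ e i) → F e ∈ L := by
    intro e he
    have t1 : Tendsto (fun n : ℕ => F (e + (1 / ((n : ℝ) + 1)) • 1)) atTop
        (𝓝 (F (e + (0 : ℝ) • 1))) :=
      (F.continuous_of_finiteDimensional.tendsto _).comp
        (tendsto_const_nhds.add (tendsto_one_div_add_atTop_nhds_zero_nat.smul_const _))
    rw [zero_smul, add_zero] at t1
    refine hM.isClosed.mem_of_tendsto t1 (Eventually.of_forall fun n => (hpos _ fun i => ?_).1)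
    have h1 : (0 : ℝ) < 1 / ((n : ℝ) + 1) := by positivity
    have := he i
    simp only [Pi.add_apply, Pi.smul_apply, Pi.one_apply, smul_eq_mul, mul_one]
    linarith
  have hFK : ∀ e : Fin 3 → ℝ, F e ∈ K ↔ ∀ i, 0 ≤ e i := by
    refine fun e => ⟨fun h i => ?_, fun h => hM.subset (hFL e h)⟩
    by_contra! hi
    -- Adding a positive combination that cancels the negative coefficient leads to an edge.
    let w : Fin 3 → ℝ := fun j => if j = i then -e i else |e j| + 1
    have hw : ∀ j, 0 < w j := by
      intro j
      by_cases hj : j = i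
      · simp [w, hj, hi]
      · simp only [w, hj, if_false]
        positivity
    have hew : ∀ j, 0 ≤ (e + w) j := by
      intro j
      by_cases hj : j = i
      · simp [w, hj]
      · simp only [w, hj, if_false, Pi.add_apply]
        linarith [neg_abs_le (e j)]
    refine hedge (e + w) hew ⟨i, by simp [w]⟩ ⟨hFL _ hew, ?_⟩
    rw [map_add, add_comm]
    exact hK.add_mem_interior (hpos w hw).2 h
  let u : (Fin 3 → ℝ) → Fin d → ℝ := fun x => F fun i => Real.exp (x i)
  have hu : ∀ x, u x ∈ L ∩ interior K := fun x => hpos _ fun i => Real.exp_pos _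
  have hsubK : ∀ (s : ℝ) x y, Real.exp s • u y - u x ∈ K ↔ ∀ i, x i ≤ s + y i := by
    intro s x y
    have : Real.exp s • u y - u x = F (fun i => Real.exp (s + y i) - Real.exp (x i)) := by
      simp only [u]
      rw [← map_smul, ← map_sub]
      congr 1
      ext i
      simp [Real.exp_add]
    rw [this, hFK]
    simp only [sub_nonneg, Real.exp_le_exp]
  have hu0 : ∀ x, u x ∈ K \ {0} := fun x => hK.interior_subset_ne_zero (hu x).2
  have upper : ∀ (x y : Fin 3 → ℝ) (s t : ℝ), (∀ i, x i ≤ s + y i) → (∀ i, y i ≤ t + x i) →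
      coneDist K (u x) (u y) ≤ (s + t) / 2 := fun x y s t h1 h2 =>
    hK.coneDist_le_of_coneNear (hu0 x) (hu0 y) ⟨Real.exp s, Real.exp t, (hsubK s x y).2 h1,
      (hsubK t y x).2 h2, by rw [← Real.exp_add]; apply Real.exp_le_exp.2; linarith⟩
  have lower : ∀ (x y : Fin 3 → ℝ) (i j : Fin 3),
      ((x i - y i) - (x j - y j)) / 2 ≤ coneDist K (u x) (u y) := by
    intro x y i j
    have hxy := hK.samePart_of_mem_interior (hu x).2 (hu y).2
    obtain ⟨s, t, hs, ht, hst⟩ := hK.coneNear_coneDist (hu0 x) (hu0 y) hxy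
    have hs0 := hK.pos_of_mem (hu0 x) (hu0 y) hs
    have ht0 := hK.pos_of_mem (hu0 y) (hu0 x) ht
    rw [← Real.exp_log hs0] at hs hst
    rw [← Real.exp_log ht0] at ht hst
    rw [← Real.exp_add, Real.exp_le_exp] at hst
    have h1 := (hsubK _ x y).1 hs i
    have h2 := (hsubK _ y x).1 ht j
    linarith
  let pt : (Fin 3 → ℝ) → C := fun x =>
    ⟨Projectivization.mk ℝ (u x) (hu0 x).2, (hM.convex _ _).2 (Or.inl (hu x))⟩
  have hpt : ∀ x y, hilbertDist Ω (pt x) (pt y) = coneDist K (u x) (u y) := fun x y =>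
    hM.hilbertDist_domain (hu x).2 (hu y).2 (hu0 x).2 (hu0 y).2
  rintro ⟨δ, hδ⟩
  set T : ℝ := 2 * |δ| + 1 with hT
  have hT0 : 0 < T := by positivity
  -- A parallelogram with sides of length `T` whose diagonals both have length `3 * T / 2`.
  let o : Fin 3 → ℝ := ![0, 0, 0]
  let p : Fin 3 → ℝ := ![2 * T, 0, T]
  let q : Fin 3 → ℝ := ![2 * T, 2 * T, 0]
  let r : Fin 3 → ℝ := ![4 * T, 2 * T, T]
  have h4 := hδ (pt q) (pt o) (pt p) (pt r)
  simp only [gromovProd, hpt] at h4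
  have op := upper o p 0 (2 * T) (by intro i; fin_cases i <;> simp [o, p] <;> linarith)
    (by intro i; fin_cases i <;> simp [o, p] <;> linarith)
  have oq := upper o q 0 (2 * T) (by intro i; fin_cases i <;> simp [o, q] <;> linarith)
    (by intro i; fin_cases i <;> simp [o, q]; linarith)
  have pr := upper p r 0 (2 * T) (by intro i; fin_cases i <;> simp [p, r] <;> linarith)
    (by intro i; fin_cases i <;> simp [p, r] <;> linarith)
  have rq := upper r q (2 * T) 0 (by intro i; fin_cases i <;> simp [q, r] <;> linarith)
    (by intro i; fin_cases i <;> simp [q, r] <;> linarith)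
  have hor := lower o r 2 0
  have pq := lower p q 2 1
  simp only [o, p, q, r, Matrix.cons_val, Matrix.cons_val_zero, Matrix.cons_val_one]
    at op oq pr rq hor pq
  have hle := le_abs_self δ
  rcases min_le_iff.1 (sub_le_iff_le_add.1 h4) with h | h <;> linarith

end IsConeModel

/-! ### Word metrics and orbit maps -/

section WordMetric

variable {G : Type*} [Group G] {S : Set G}

theorem connected_mulCayley (hS : Subgroup.closure S = ⊤) :
    (SimpleGraph.mulCayley S).Connected := by
  have h : ∀ g ∈ Subgroup.closure S, ∀ u, (SimpleGraph.mulCayley S).Reachable u (u * g) := by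
    intro g hg
    induction hg using Subgroup.closure_induction with
    | mem s hs =>
      intro u
      by_cases hu : u = u * s
      · rw [← hu]
      · exact ((SimpleGraph.mulCayley_adj S _ _).2 ⟨hu, Or.inl (by simpa using hs)⟩).reachable
    | one => intro u; rw [mul_one]
    | mul x y _ _ hx hy => intro u; rw [← mul_assoc]; exact (hx u).trans (hy _)
    | inv x _ hx => intro u; simpa using (hx (u * x⁻¹)).symm
  refine ⟨fun u v => ?_⟩
  simpa using h (u⁻¹ * v) (by rw [hS]; trivial) u

theorem dist_mul_left_le (hS : Subgroup.closure S = ⊤) (d u v : G) :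
    (SimpleGraph.mulCayley S).dist (d * u) (d * v) ≤ (SimpleGraph.mulCayley S).dist u v := by
  obtain ⟨p, hp⟩ := (connected_mulCayley hS).exists_walk_length_eq_dist u v
  let f : SimpleGraph.mulCayley S →g SimpleGraph.mulCayley S :=
    ⟨fun x => d * x, fun h => SimpleGraph.mulCayley_adj_mul_iff_right.2 h⟩
  rw [← hp, ← p.length_map f]
  exact SimpleGraph.dist_le _

theorem isPseudoDist_dist {V : Type*} {Γ : SimpleGraph V} (hΓ : Γ.Connected) :
    IsPseudoDist fun u v => (Γ.dist u v : ℝ) :=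
  ⟨fun u => by simp, fun u v => by rw [SimpleGraph.dist_comm], fun u v w => by
    exact_mod_cast hΓ.dist_triangle⟩

theorem exists_isRoughGeodesic_dist {V : Type*} {Γ : SimpleGraph V} (hΓ : Γ.Connected) (u v : V) :
    ∃ n γ, IsRoughGeodesic (fun u v => (Γ.dist u v : ℝ)) 0 u v n γ := by
  obtain ⟨p, hp⟩ := hΓ.exists_walk_length_eq_dist u v
  have hsub : ∀ i j, i ≤ j → j ≤ p.length → Γ.dist (p.getVert i) (p.getVert j) ≤ j - i := by
    intro i j hij hj
    induction j, hij using Nat.le_induction with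
    | base => simp
    | succ k hk ih =>
      have h1 := ih (by omega)
      have h2 := (SimpleGraph.dist_eq_one_iff_adj.2 (p.adj_getVert_succ (i := k) (by omega))).le
      have h3 := hΓ.dist_triangle (u := p.getVert i) (v := p.getVert k) (w := p.getVert (k + 1))
      omega
  refine ⟨p.length, p.getVert, p.getVert_zero, p.getVert_length, fun i j hij hj => ?_,
    fun i j hij hj => ?_⟩
  · have h1 := hsub 0 i (Nat.zero_le _) (hij.trans hj)
    have h2 := hsub j p.length hj le_rfl
    have h3 := hΓ.dist_triangle (u := u) (v := p.getVert i) (w := v)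
    have h4 := hΓ.dist_triangle (u := p.getVert i) (v := p.getVert j) (w := v)
    rw [p.getVert_zero] at h1
    rw [p.getVert_length] at h2
    have h5 : j ≤ Γ.dist (p.getVert i) (p.getVert j) + i := by omega
    have h6 : (j : ℝ) ≤ Γ.dist (p.getVert i) (p.getVert j) + i := by exact_mod_cast h5
    linarith
  · have h1 := hsub i j hij hj
    have h2 : Γ.dist (p.getVert i) (p.getVert j) + i ≤ j := by omega
    have h3 : (Γ.dist (p.getVert i) (p.getVert j) : ℝ) + i ≤ j := by exact_mod_cast h2
    linarith

variable {X : Type*} {D : X → X → ℝ}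

/-- An orbit map is Lipschitz with respect to a finite generating set. -/
theorem exists_le_mul_dist (hD : IsPseudoDist D) {f : G → X}
    (hf : ∀ g h k, D (f (g * h)) (f (g * k)) = D (f h) (f k)) (hSf : S.Finite)
    (hS : Subgroup.closure S = ⊤) :
    ∃ J : ℝ, 0 ≤ J ∧ ∀ g h, D (f g) (f h) ≤ J * (SimpleGraph.mulCayley S).dist g h := by
  obtain ⟨J, hJ⟩ := (hSf.image fun s => D (f 1) (f s)).bddAbove
  have hJ' : ∀ s ∈ S, D (f 1) (f s) ≤ max J 0 := fun s hs =>
    (hJ ⟨s, hs, rfl⟩).trans (le_max_left _ _)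
  refine ⟨max J 0, le_max_right _ _, fun g h => ?_⟩
  obtain ⟨p, hp⟩ := (connected_mulCayley hS).exists_walk_length_eq_dist g h
  rw [← hp]
  clear hp
  induction p with
  | nil => simp [hD.self]
  | @cons u v w huv p ih =>
    have h1 : D (f u) (f v) ≤ max J 0 := by
      rcases ((SimpleGraph.mulCayley_adj S u v).1 huv).2 with h | h
      · have := hf u 1 (u⁻¹ * v)
        rw [mul_one, mul_inv_cancel_left] at this
        rw [this]
        exact hJ' _ h
      · have := hf v (v⁻¹ * u) 1
        rw [mul_one, mul_inv_cancel_left] at this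
        rw [this, hD.symm]
        exact hJ' _ h
    have := hD.tri (f u) (f v) (f w)
    rw [SimpleGraph.Walk.length_cons]
    push_cast
    linarith

/-- Two orbit points are joined by a chain of orbit points with bounded steps, whose length is
controlled by their distance. -/
theorem exists_orbit_chain (hD : IsPseudoDist D) {c r₀ : ℝ}
    (hgD : ∀ x y, ∃ n γ, IsRoughGeodesic D c x y n γ) {f : G → X}
    (hf : ∀ g h k, D (f (g * h)) (f (g * k)) = D (f h) (f k)) (hr : ∀ x, ∃ g, D x (f g) ≤ r₀)
    (g h : G) : ∃ (n : ℕ) (k : ℕ → G), k 0 = g ∧ k n = h ∧ (n : ℝ) ≤ D (f g) (f h) + c + 1 ∧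
      ∀ i < n, D (f 1) (f ((k i)⁻¹ * k (i + 1))) ≤ 2 * r₀ + 1 + c := by
  classical
  obtain ⟨n, γ, hγ⟩ := hgD (f g) (f h)
  choose q hq using hr
  have hr0 : 0 ≤ r₀ := (hD.nonneg _ _).trans (hq (f g))
  let k : ℕ → G := fun i => if i = 0 then g else if i = n then h else q (γ i)
  have hlen : (n : ℝ) ≤ D (f g) (f h) + c := by
    have := hγ.lower 0 n (Nat.zero_le n) le_rfl
    rw [hγ.start, hγ.finish] at this
    push_cast at this
    linarith
  rcases Nat.eq_zero_or_pos n with hn | hn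
  · -- A geodesic of length zero still has to pass from `g` to `h`, in a single step.
    have hc := hγ.nonneg hD
    have hgh : f g = f h := by rw [← hγ.start, ← hγ.finish, hn]
    refine ⟨1, fun i => if i = 0 then g else h, by simp, by simp, ?_, fun i hi => ?_⟩
    · rw [hgh, hD.self]
      push_cast
      linarith
    · obtain rfl : i = 0 := by omega
      have h1 := hf g 1 (g⁻¹ * h)
      rw [mul_one, mul_inv_cancel_left, hgh, hD.self] at h1
      simp only [if_true, zero_add, one_ne_zero, if_false]
      linarith
  have hk : ∀ i, D (γ i) (f (k i)) ≤ r₀ := by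
    intro i
    by_cases h0 : i = 0
    · subst h0
      simp only [k, if_true, hγ.start, hD.self]
      exact hr0
    · by_cases h1 : i = n
      · subst h1
        simp only [k, h0, if_true, if_false, hγ.finish, hD.self]
        exact hr0
      · simp only [k, h0, h1, if_false]
        exact hq _
  refine ⟨n, k, by simp [k], by simp [k, hn.ne'], by linarith, fun i hi => ?_⟩
  have h1 := hf (k i) 1 ((k i)⁻¹ * k (i + 1))
  rw [mul_one, mul_inv_cancel_left] at h1
  rw [← h1]
  have h2 := hγ.upper i (i + 1) (by omega) (by omega)
  have h3 := hD.tri (f (k i)) (γ i) (f (k (i + 1)))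
  have h4 := hD.tri (γ i) (γ (i + 1)) (f (k (i + 1)))
  have h5 := hk i
  have h6 := hk (i + 1)
  rw [hD.symm] at h5
  push_cast at h2
  linarith

/-- The points of a ball that meets every step of a chain generate the group. -/
theorem closure_eq_top_of_orbit_chain {B : Set G} (h : ∀ g : G, ∃ (n : ℕ) (k : ℕ → G), k 0 = 1 ∧
    k n = g ∧ ∀ i < n, (k i)⁻¹ * k (i + 1) ∈ B) : Subgroup.closure B = ⊤ := by
  refine (Subgroup.eq_top_iff' _).2 fun g => ?_
  obtain ⟨n, k, h0, hn, hB⟩ := h g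
  have : ∀ i ≤ n, k i ∈ Subgroup.closure B := by
    intro i
    induction i with
    | zero => intro _; rw [h0]; exact one_mem _
    | succ i ih =>
      intro hi
      have := mul_mem (ih (by omega)) (Subgroup.subset_closure (hB i (by omega)))
      rwa [mul_inv_cancel_left] at this
  rw [← hn]
  exact this n le_rfl

/-- The word metric of a finite generating set is bounded by a multiple of the distance in the
orbit, up to an additive constant. -/
theorem exists_dist_le_mul (hD : IsPseudoDist D) {c r₀ : ℝ}
    (hgD : ∀ x y, ∃ n γ, IsRoughGeodesic D c x y n γ) {f : G → X}
    (hf : ∀ g h k, D (f (g * h)) (f (g * k)) = D (f h) (f k)) (hr : ∀ x, ∃ g, D x (f g) ≤ r₀)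
    (hfin : ∀ r : ℝ, {g | D (f 1) (f g) ≤ r}.Finite) (hS : Subgroup.closure S = ⊤) :
    ∃ M : ℝ, 0 ≤ M ∧ ∀ g h,
      ((SimpleGraph.mulCayley S).dist g h : ℝ) ≤ M * (D (f g) (f h) + c + 1) := by
  obtain ⟨M, hM⟩ := ((hfin (2 * r₀ + 1 + c)).image fun s =>
    (SimpleGraph.mulCayley S).dist 1 s).bddAbove
  refine ⟨M, Nat.cast_nonneg M, fun g h => ?_⟩
  obtain ⟨n, k, h0, hn, hlen, hstep⟩ := exists_orbit_chain hD hgD hf hr g h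
  have hconn := connected_mulCayley hS
  have key : ∀ i ≤ n, (SimpleGraph.mulCayley S).dist g (k i) ≤ M * i := by
    intro i
    induction i with
    | zero => intro _; simp [h0]
    | succ i ih =>
      intro hi
      have h1 := ih (by omega)
      have h2 : (SimpleGraph.mulCayley S).dist 1 ((k i)⁻¹ * k (i + 1)) ≤ M :=
        hM ⟨_, hstep i (by omega), rfl⟩
      have h3 := dist_mul_left_le hS (k i) 1 ((k i)⁻¹ * k (i + 1))
      rw [mul_one, mul_inv_cancel_left] at h3
      have h4 := hconn.dist_triangle (u := g) (v := k i) (w := k (i + 1))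
      rw [mul_add, mul_one]
      omega
  have h1 := key n le_rfl
  rw [hn] at h1
  have h2 : ((SimpleGraph.mulCayley S).dist g h : ℝ) ≤ M * n := by exact_mod_cast h1
  exact h2.trans (mul_le_mul_of_nonneg_left hlen (Nat.cast_nonneg M))

/-- The Švarc–Milnor lemma, combined with the invariance of hyperbolicity under quasi-isometries: a
group with a proper and cobounded isometric action on a roughly geodesic space is word hyperbolic if
and only if the space is Gromov hyperbolic. The action enters only through an orbit map `f`. -/
theorem isWordHyperbolic_iff (hD : IsPseudoDist D) {c r₀ : ℝ}
    (hgD : ∀ x y, ∃ n γ, IsRoughGeodesic D c x y n γ) {f : G → X}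
    (hf : ∀ g h k, D (f (g * h)) (f (g * k)) = D (f h) (f k)) (hr : ∀ x, ∃ g, D x (f g) ≤ r₀)
    (hfin : ∀ r : ℝ, {g | D (f 1) (f g) ≤ r}.Finite) :
    IsGromovHyperbolic D ↔ IsWordHyperbolic G := by
  have hc : 0 ≤ c := by
    obtain ⟨n, γ, hγ⟩ := hgD (f 1) (f 1)
    exact hγ.nonneg hD
  have hr0 : 0 ≤ r₀ := by
    obtain ⟨g, hg⟩ := hr (f 1)
    exact (hD.nonneg _ _).trans hg
  constructor
  · intro hyp
    have hgen : Subgroup.closure ((hfin (2 * r₀ + 1 + c)).toFinset : Set G) = ⊤ := by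
      rw [Set.Finite.coe_toFinset]
      refine closure_eq_top_of_orbit_chain fun g => ?_
      obtain ⟨n, k, h0, hn, -, hstep⟩ := exists_orbit_chain hD hgD hf hr 1 g
      exact ⟨n, k, h0, hn, hstep⟩
    refine ⟨_, hgen, ?_⟩
    have hconn := connected_mulCayley hgen
    obtain ⟨J, hJ0, hJ⟩ := exists_le_mul_dist hD hf (Finset.finite_toSet _) hgen
    obtain ⟨M, hM0, hM⟩ := exists_dist_le_mul hD hgD hf hr hfin hgen
    refine IsGromovHyperbolic.of_quasiIsometricEmbedding (isPseudoDist_dist hconn) hD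
      (exists_isRoughGeodesic_dist hconn) hgD hyp f (a := J + M) (b := M * (c + 1))
      (by positivity) (by positivity) (fun g h => ?_) (fun g h => ?_)
    · have h1 := hJ g h
      have h2 : 0 ≤ M * ((SimpleGraph.mulCayley
        ((hfin (2 * r₀ + 1 + c)).toFinset : Set G)).dist g h : ℝ) := by positivity
      have h3 : 0 ≤ M * (c + 1) := by positivity
      linarith
    · have h1 := hM g h
      have h2 := mul_nonneg hJ0 (hD.nonneg (f g) (f h))
      linarith
  · rintro ⟨S, hgen, hyp⟩
    have hconn := connected_mulCayley hgen
    obtain ⟨J, hJ0, hJ⟩ := exists_le_mul_dist hD hf (Finset.finite_toSet _) hgen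
    obtain ⟨M, hM0, hM⟩ := exists_dist_le_mul hD hgD hf hr hfin hgen
    choose q hq using hr
    refine IsGromovHyperbolic.of_quasiIsometricEmbedding hD (isPseudoDist_dist hconn) hgD
      (exists_isRoughGeodesic_dist hconn) hyp q (a := J + M) (b := M * (2 * r₀ + c + 1) + 2 * r₀)
      (by positivity) (by positivity) (fun x y => ?_) (fun x y => ?_)
    · have h1 := hM (q x) (q y)
      have h2 := hD.tri (f (q x)) x (f (q y))
      have h3 := hD.tri x y (f (q y))
      have h4 := hq x
      rw [hD.symm] at h4
      have h5 := mul_le_mul_of_nonneg_left (h2.trans (add_le_add h4 (h3.trans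
        (add_le_add_right (hq y) _)))) hM0
      have h6 := mul_nonneg hJ0 (hD.nonneg x y)
      linarith
    · have h1 := hJ (q x) (q y)
      have h2 := hD.tri x (f (q x)) y
      have h3 := hD.tri (f (q x)) (f (q y)) y
      have h4 := hq x
      have h5 := hq y
      rw [hD.symm] at h5
      have h6 : 0 ≤ M * ((SimpleGraph.mulCayley (S : Set G)).dist (q x) (q y) : ℝ) := by positivity
      have h7 : 0 ≤ M * (2 * r₀ + c + 1) := by positivity
      linarith

end WordMetric

/-! ### The action of the group on the convex set -/

section Action

open Topology Filter

/-- A linear map that preserves the cone is controlled by its value at one interior point. -/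
theorem IsSharpCone.exists_norm_apply_le {E : Type*} [NormedAddCommGroup E] [NormedSpace ℝ E]
    {K : Set E} {φ : E →ₗ[ℝ] ℝ} (hK : IsSharpCone K φ) {p : E} (hp : p ∈ interior K) (v : E) :
    ∃ N : ℝ, 0 ≤ N ∧ ∀ A : E →ₗ[ℝ] E, (∀ w ∈ K, A w ∈ K) → ‖A v‖ ≤ N * φ (A p) := by
  obtain ⟨B, hB, hbound⟩ := hK.bound
  obtain ⟨t, ht, h1⟩ := hK.exists_smul_sub_mem_interior hp v
  obtain ⟨t', ht', h2⟩ := hK.exists_smul_sub_mem_interior hp (-v)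
  refine ⟨B * (t + 2 * t'), by positivity, fun A hA => ?_⟩
  have e1 := hK.nonneg (hA _ (interior_subset h1))
  have e2 := hbound _ (hA _ (interior_subset h2))
  have e3 := hbound _ (hK.smul_mem ht'.le (hA _ (interior_subset hp)))
  have e4 : ‖A v‖ ≤ ‖A (t' • p - -v)‖ + ‖t' • A p‖ := by
    have : A v = A (t' • p - -v) - t' • A p := by
      rw [map_sub, map_smul, map_neg]
      abel
    rw [this]
    exact norm_sub_le _ _
  simp only [map_sub, map_smul, map_neg, smul_eq_mul] at e1 e2 e3 e4
  have e5 := mul_le_mul_of_nonneg_left (sub_nonneg.1 e1) hB.le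
  linarith

variable {d : ℕ} {Ω C : Set (RP d)} {K L : Set (Fin d → ℝ)} {φ : Module.Dual ℝ (Fin d → ℝ)}

theorem IsConeModel.exists_normalized_lift (hM : IsConeModel Ω C K L φ) {g : PGLR d}
    (hΩ : g • Ω = Ω) (hC : g • C = C) {p : Fin d → ℝ} (hp : p ∈ interior K) :
    ∃ A : Matrix.GeneralLinearGroup (Fin d) ℝ, Matrix.ProjGenLinGroup.mk A = g ∧
      IsConeAut K L (glEquiv A) ∧ φ (A • p) = 1 := by
  have := hM.nontrivial
  have hK := hM.sharp
  obtain ⟨A, hA, hAut⟩ := hM.exists_lift hΩ hC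
  have hpos : 0 < φ (A • p) :=
    hK.pos (hK.interior_subset_ne_zero ((hAut.mem_interior_iff p).2 hp))
  let t : ℝˣ := Units.mk0 (φ (A • p))⁻¹ (inv_ne_zero hpos.ne')
  have hact : ∀ v : Fin d → ℝ,
      (Matrix.GeneralLinearGroup.scalar (Fin d) t * A) • v = (φ (A • p))⁻¹ • A • v := by
    intro v
    rw [mul_smul]
    ext i
    simp [Units.smul_def, t, -Matrix.mulVec_mulVec, Matrix.mulVec_diagonal]
  have e : glEquiv (Matrix.GeneralLinearGroup.scalar (Fin d) t * A) =
      (glEquiv A).trans (LinearEquiv.smulOfNeZero ℝ _ _ (inv_pos.2 hpos).ne') :=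
    LinearEquiv.ext hact
  refine ⟨Matrix.GeneralLinearGroup.scalar (Fin d) t * A, ?_, ?_, ?_⟩
  · rw [map_mul, Matrix.ProjGenLinGroup.mk_scalar, one_mul, hA]
  · rw [e]
    exact hAut.smul hK.smul_mem hM.smul_mem (inv_pos.2 hpos)
  · rw [hact, map_smul, smul_eq_mul, inv_mul_cancel₀ hpos.ne']

/-- Matrices whose entries, and those of their inverses, are bounded form a relatively compact
sequence in the general linear group. -/
theorem exists_tendsto_subseq_generalLinearGroup {A : ℕ → Matrix.GeneralLinearGroup (Fin d) ℝ}
    {N : ℝ} (h1 : ∀ n i j, |(A n).1 i j| ≤ N) (h2 : ∀ n i j, |((A n)⁻¹).1 i j| ≤ N) :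
    ∃ (U : Matrix.GeneralLinearGroup (Fin d) ℝ) (ψ : ℕ → ℕ), StrictMono ψ ∧
      Tendsto (fun n => A (ψ n)) atTop (𝓝 U) := by
  have : FirstCountableTopology (Matrix (Fin d) (Fin d) ℝ) :=
    inferInstanceAs (FirstCountableTopology (Fin d → Fin d → ℝ))
  have hc : IsCompact {M : Matrix (Fin d) (Fin d) ℝ | ∀ i j, |M i j| ≤ N} := by
    have h : IsCompact {M : Fin d → Fin d → ℝ | ∀ i j, |M i j| ≤ N} := by
      have e : {M : Fin d → Fin d → ℝ | ∀ i j, |M i j| ≤ N} =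
          Set.pi Set.univ fun _ => Set.pi Set.univ fun _ => Set.Icc (-N) N := by
        ext M
        simp only [Set.mem_ofPred_eq, Set.mem_pi, Set.mem_univ, true_imp_iff, Set.mem_Icc, abs_le]
      rw [e]
      exact isCompact_univ_pi fun _ => isCompact_univ_pi fun _ => isCompact_Icc
    exact h
  obtain ⟨⟨M, M'⟩, -, ψ, hψ, ht⟩ := (hc.prod hc).tendsto_subseq
    (x := fun n => ((A n).1, ((A n)⁻¹).1)) fun n => ⟨h1 n, h2 n⟩
  have t1 : Tendsto (fun n => (A (ψ n)).1) atTop (𝓝 M) := (continuous_fst.tendsto _).comp ht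
  have t2 : Tendsto (fun n => ((A (ψ n))⁻¹).1) atTop (𝓝 M') := (continuous_snd.tendsto _).comp ht
  have e1 : M * M' = 1 := by
    refine tendsto_nhds_unique (t1.mul t2) ?_
    simp only [Units.mul_inv]
    exact tendsto_const_nhds
  have e2 : M' * M = 1 := by
    refine tendsto_nhds_unique (t2.mul t1) ?_
    simp only [Units.inv_mul]
    exact tendsto_const_nhds
  refine ⟨⟨M, M', e1, e2⟩, ψ, hψ, ?_⟩
  rw [Units.isInducing_embedProduct.tendsto_nhds_iff]
  exact t1.prodMk_nhds ((MulOpposite.continuous_op.tendsto _).comp t2)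

/-- An injective sequence in a discrete subgroup of the projective linear group has no lifts that
converge in the general linear group. -/
theorem not_injective_of_tendsto {Λ : Subgroup (PGLR d)} (hΛ : DiscreteTopology Λ) {g : ℕ → Λ}
    {A : ℕ → Matrix.GeneralLinearGroup (Fin d) ℝ}
    (hA : ∀ n, Matrix.ProjGenLinGroup.mk (A n) = (g n : PGLR d))
    {U : Matrix.GeneralLinearGroup (Fin d) ℝ} (hU : Tendsto A atTop (𝓝 U)) :
    ¬ Function.Injective g := by
  intro hg
  have t1 : Tendsto (fun n => (A n)⁻¹ * A (n + 1)) atTop (𝓝 1) := by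
    have := hU.inv.mul (hU.comp (tendsto_add_atTop_nat 1))
    rwa [inv_mul_cancel] at this
  have hmk : Continuous
      (Matrix.ProjGenLinGroup.mk : Matrix.GeneralLinearGroup (Fin d) ℝ → PGLR d) :=
    continuous_coinduced_rng
  have t2 : Tendsto (fun n => (((g n)⁻¹ * g (n + 1) : Λ) : PGLR d)) atTop
      (𝓝 ((1 : Λ) : PGLR d)) := by
    have := (hmk.tendsto 1).comp t1
    rw [map_one] at this
    refine this.congr fun n => ?_
    simp [hA]
  have t3 : Tendsto (fun n => (g n)⁻¹ * g (n + 1)) atTop (𝓝 (1 : Λ)) :=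
    tendsto_subtype_rng.2 t2
  rw [nhds_discrete, tendsto_pure] at t3
  obtain ⟨n, hn⟩ := t3.exists
  have := hg (inv_mul_eq_one.1 hn)
  omega

namespace IsConeModel

variable (hM : IsConeModel Ω C K L φ)
include hM

theorem hilbertDist_smul {g : PGLR d} (hΩ : g • Ω = Ω) (hC : g • C = C) {x y : RP d} (hx : x ∈ C)
    (hy : y ∈ C) : hilbertDist Ω (g • x) (g • y) = hilbertDist Ω x y := by
  have := hM.nontrivial
  obtain ⟨A, rfl, hA⟩ := hM.exists_lift hΩ hC
  obtain ⟨hx1, -, hxi⟩ := hM.affCoord_mem hx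
  obtain ⟨hy1, -, hyi⟩ := hM.affCoord_mem hy
  have hx0 := affCoord_ne_zero hx1
  have hy0 := affCoord_ne_zero hy1
  rw [← mk_affCoord hx1, ← mk_affCoord hy1, Projectivization.PGL.mk_smul_mk,
    Projectivization.PGL.mk_smul_mk, hM.hilbertDist_domain hxi hyi]
  exact (hM.hilbertDist_domain ((hA.mem_interior_iff _).2 hxi) ((hA.mem_interior_iff _).2 hyi)
    _ _).trans (hA.coneDist_eq _ _)

/-- The action of a discrete group of automorphisms is proper for the Hilbert metric. -/
theorem finite_setOf_hilbertDist_le {Λ : Subgroup (PGLR d)} (hΛ : DiscreteTopology Λ)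
    (hΩ : ∀ g ∈ Λ, g • Ω = Ω) (hC : ∀ g ∈ Λ, g • C = C) {p : RP d} (hp : p ∈ C) (r : ℝ) :
    {g : Λ | hilbertDist Ω p ((g : PGLR d) • p) ≤ r}.Finite := by
  have := hM.nontrivial
  have hK := hM.sharp
  by_contra hinf
  obtain ⟨hp1, -, hpi⟩ := hM.affCoord_mem hp
  have hp0 := affCoord_ne_zero hp1
  set v := affCoord φ p with hv
  have hφv : φ v = 1 := apply_affCoord hp1
  let g : ℕ → Λ := fun n => (Set.Infinite.natEmbedding _ hinf n).1
  have hginj : Function.Injective g :=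
    Subtype.val_injective.comp (Set.Infinite.natEmbedding _ hinf).injective
  have hg : ∀ n, hilbertDist Ω p ((g n : PGLR d) • p) ≤ r := fun n =>
    (Set.Infinite.natEmbedding _ hinf n).2
  choose A hA hAut hAφ using fun n => hM.exists_normalized_lift (hΩ _ (g n).2) (hC _ (g n).2) hpi
  have hAi : ∀ n, A n • v ∈ interior K := fun n => ((hAut n).mem_interior_iff v).2 hpi
  have hinvφ : ∀ n, φ ((A n)⁻¹ • v) ≤ Real.exp (2 * r) := by
    intro n
    have h1 := hg n
    rw [← mk_affCoord hp1, ← hA n, Projectivization.PGL.mk_smul_mk,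
      hM.hilbertDist_domain hpi (hAi n)] at h1
    -- as `φ v = φ (A n • v) = 1`, both factors are at least `1`, so each is at most `exp (2 * r)`
    obtain ⟨s, t, hs, ht, hst⟩ := (hK.coneNear_iff (hK.interior_subset_ne_zero hpi)
      (hK.interior_subset_ne_zero (hAi n)) (hK.samePart_of_mem_interior hpi (hAi n))).2 h1
    have ht1 : 1 ≤ t := by
      have := hK.nonneg ht
      rw [map_sub, map_smul, hφv, hAφ, smul_eq_mul] at this
      linarith
    have hs0 : 0 < s := hK.pos_of_mem (hK.interior_subset_ne_zero hpi)
      (hK.interior_subset_ne_zero (hAi n)) hs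
    have h2 : φ ((A n)⁻¹ • v) ≤ s := by
      have h3 := ((hAut n).mem_left (s • v - (A n)⁻¹ • v)).1 (by
        have : glEquiv (A n) (s • v - (A n)⁻¹ • v) = s • A n • v - v := by
          rw [map_sub, map_smul]
          simp
        rwa [this])
      have h4 := hK.nonneg h3
      rw [map_sub, map_smul, hφv, smul_eq_mul] at h4
      linarith
    nlinarith
  -- the columns of the normalized lifts and of their inverses are bounded
  choose N hN0 hN using fun j : Fin d => hK.exists_norm_apply_le hpi (Pi.single j 1)
  have hentry : ∀ (B : Matrix.GeneralLinearGroup (Fin d) ℝ) i j,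
      |B.1 i j| ≤ ‖(glEquiv B) (Pi.single j 1)‖ := by
    intro B i j
    have h1 : (glEquiv B) (Pi.single j 1) i = B.1 i j := by
      change B.1.mulVec (Pi.single j 1) i = _
      simp
    rw [← h1]
    exact norm_le_pi_norm (glEquiv B (Pi.single j 1)) i
  have hNsum : ∀ j, N j ≤ ∑ i, N i := fun j =>
    Finset.single_le_sum (fun i _ => hN0 i) (Finset.mem_univ j)
  have hS0 : 0 ≤ ∑ i, N i := Finset.sum_nonneg fun i _ => hN0 i
  have hr : 1 ≤ max 1 (Real.exp (2 * r)) := le_max_left _ _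
  have bound : ∀ (B : Matrix.GeneralLinearGroup (Fin d) ℝ), IsConeAut K L (glEquiv B) →
      φ (B • v) ≤ max 1 (Real.exp (2 * r)) →
      ∀ i j, |B.1 i j| ≤ (∑ i, N i) * max 1 (Real.exp (2 * r)) := by
    intro B hB hBv i j
    refine (hentry B i j).trans ((hN j (glEquiv B).toLinearMap fun w hw =>
      (hB.mem_left w).2 hw).trans ?_)
    exact (mul_le_mul_of_nonneg_left hBv (hN0 j)).trans
      (mul_le_mul_of_nonneg_right (hNsum j) (by linarith))
  have hAinv : ∀ n, IsConeAut K L (glEquiv (A n)⁻¹) := fun n => (hAut n).symm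
  obtain ⟨U, ψ, hψ, hU⟩ := exists_tendsto_subseq_generalLinearGroup
    (fun n => bound (A n) (hAut n) ((hAφ n).le.trans (le_max_left _ _)))
    (fun n => bound (A n)⁻¹ (hAinv n) ((hinvφ n).trans (le_max_right _ _)))
  exact not_injective_of_tendsto hΛ (g := fun n => g (ψ n)) (fun n => hA (ψ n)) hU
    (hginj.comp hψ.injective)

/-- A cocompact action is cobounded for the Hilbert metric. -/
theorem exists_hilbertDist_le {Q : Set (RP d)} (hQC : Q ⊆ C) (hQ : IsCompact Q) {p : RP d}
    (hp : p ∈ C) : ∃ r : ℝ, ∀ q ∈ Q, hilbertDist Ω q p ≤ r := by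
  have := hM.nontrivial
  have hK := hM.sharp
  obtain ⟨hp1, -, hpi⟩ := hM.affCoord_mem hp
  have hQ' : IsCompact (affCoord φ '' Q) := hQ.image_of_continuousOn
    ((continuousOn_affCoord φ).mono fun x hx => (hM.affCoord_mem (hQC hx)).1)
  by_contra! h
  choose q hq hqn using fun n : ℕ => h n
  obtain ⟨_, ⟨w, hw, rfl⟩, ψ, hψ, ht⟩ := hQ'.tendsto_subseq (x := fun n => affCoord φ (q n))
    fun n => ⟨_, hq n, rfl⟩
  obtain ⟨r, hr⟩ := hK.exists_eventually_coneNear (hM.affCoord_mem (hQC hw)).2.2 hpi ht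
    tendsto_const_nhds
  obtain ⟨n, hn, hnr⟩ := (hr.and (eventually_ge_atTop ⌈r⌉₊)).exists
  have h1 := hqn (ψ n)
  have hi := (hM.affCoord_mem (hQC (hq (ψ n)))).2.2
  rw [hM.hilbertDist_eq (hQC (hq _)) hp] at h1
  have h2 := hK.coneDist_le_of_coneNear (hK.interior_subset_ne_zero hi)
    (hK.interior_subset_ne_zero hpi) hn
  have h3 : (n : ℝ) ≤ ψ n := by exact_mod_cast hψ.id_le n
  have h4 : r ≤ n := (Nat.le_ceil r).trans (by exact_mod_cast hnr)
  linarith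

theorem isGromovHyperbolic_iff_isWordHyperbolic {Λ : Subgroup (PGLR d)}
    (h : IsNaiveConvexCocompactTriple Ω C Λ) :
    IsGromovHyperbolic (fun x y : C => hilbertDist Ω x y) ↔ IsWordHyperbolic Λ := by
  obtain ⟨p, hp⟩ := h.nonempty
  obtain ⟨Q, hQC, hQ, hcov⟩ := h.cocompact
  obtain ⟨r, hr⟩ := hM.exists_hilbertDist_le hQC hQ hp
  have mem : ∀ (g : Λ) {x}, x ∈ C → (g : PGLR d) • x ∈ C := fun g x hx =>
    (h.invariant g g.2).subset (Set.smul_mem_smul_set hx)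
  refine isWordHyperbolic_iff hM.isPseudoDist (c := 2) (r₀ := r)
    (f := fun g : Λ => (⟨(g : PGLR d) • p, mem g hp⟩ : C)) (fun x y => ?_) (fun g a b => ?_)
    (fun x => ?_) fun r' => ?_
  · obtain ⟨n, γ, hγ, -⟩ := hM.exists_isRoughGeodesic x y
    exact ⟨n, γ, hγ⟩
  · change hilbertDist Ω (((g * a : Λ) : PGLR d) • p) (((g * b : Λ) : PGLR d) • p) = _
    rw [Subgroup.coe_mul, Subgroup.coe_mul, mul_smul, mul_smul]
    exact hM.hilbertDist_smul (h.aut g g.2) (h.invariant g g.2) (mem a hp) (mem b hp)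
  · obtain ⟨g, hg, hgx⟩ := Set.mem_iUnion₂.1 (hcov x.2)
    obtain ⟨q, hq, hqx⟩ := hgx
    refine ⟨⟨g, hg⟩, ?_⟩
    change hilbertDist Ω (x : RP d) (g • p) ≤ r
    rw [← hqx]
    exact (hM.hilbertDist_smul (h.aut g hg) (h.invariant g hg) (hQC hq) hp).trans_le (hr q hq)
  · have := hM.finite_setOf_hilbertDist_le h.discrete h.aut h.invariant hp r'
    simpa using this

end IsConeModel

end Action

/-! ### The equivalences -/

/-- If the traces of the ideal boundary on the open faces have unbounded diameters, then `C`
contains a properly embedded simplex. -/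
theorem IsConeModel.exists_isProjSimplex {d : ℕ} {Ω C : Set (RP d)} {K L : Set (Fin d → ℝ)}
    {φ : Module.Dual ℝ (Fin d → ℝ)} (hM : IsConeModel Ω C K L φ) (hcoc : IsConeCocompact K L φ)
    (h : ¬ ∃ R : ℝ, 0 < R ∧ ∀ x ∈ idealBoundary C,
      hilbertDiam (openFace Ω x) (idealBoundary C ∩ openFace Ω x) ≤ ENNReal.ofReal R) :
    ∃ (S : Set (RP d)) (k : ℕ), 2 ≤ k ∧ IsProjSimplex S k ∧ IsProperlyEmbedded S C := by
  have := hM.nontrivial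
  have hK := hM.sharp
  have hunb : ∀ R : ℝ, ∃ a ∈ L \ {0}, ∃ b ∈ L \ {0}, a ∉ interior K ∧ SamePart K a b ∧
      R < coneDist K a b := by
    intro R
    by_contra! hR
    exact h ⟨max R 1, lt_max_of_lt_right one_pos, fun x hx => (hM.hilbertDiam_le hR hx).trans
      (ENNReal.ofReal_le_ofReal (le_max_left _ _))⟩
  obtain ⟨p, a, b, u, s, t, r, hp, ha, hb, hu, hs, ht, hr, rfl, hpa, hpb, hab⟩ :=
    hK.exists_ideal_triangle hM.subset hM.isClosed hM.add_mem hM.smul_mem hM.nonempty hcoc hunb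
  have hcomb : ∀ c : Fin 3 → ℝ, Fintype.linearCombination ℝ ![p, a, b] c =
      c 0 • p + c 1 • a + c 2 • b := by
    intro c
    simp [Fintype.linearCombination_apply, Fin.sum_univ_three]
  have hseg : ∀ {x y : Fin d → ℝ}, (∀ w ∈ coneSegment x y, w ∉ interior K) → ∀ α β : ℝ, 0 ≤ α →
      0 ≤ β → α • x + β • y ∉ interior K := by
    intro x y hxy α β hα hβ hint
    rcases (add_nonneg hα hβ).eq_or_lt with h0 | h0
    · obtain ⟨rfl, rfl⟩ := (add_eq_zero_iff_of_nonneg hα hβ).1 h0.symm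
      exact (hK.interior_subset_ne_zero hint).2 (by simp)
    · exact hxy _ ⟨α, β, hα, hβ, h0, rfl⟩ hint
  obtain ⟨S, hS, hSC⟩ := hM.exists_isProperlyEmbedded (f := ![p, a, b]) (c := ![s, t, r])
    (by intro i; fin_cases i <;> assumption)
    (by
      rintro c hc ⟨i, hi⟩
      rw [hcomb]
      fin_cases i
      · have hi : c 0 = 0 := hi
        rw [hi, zero_smul, zero_add]
        exact hseg hab _ _ (hc 1) (hc 2)
      · have hi : c 1 = 0 := hi
        rw [hi, zero_smul, add_zero]
        exact hseg hpb _ _ (hc 0) (hc 2)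
      · have hi : c 2 = 0 := hi
        rw [hi, zero_smul, add_zero]
        exact hseg hpa _ _ (hc 0) (hc 1))
    (by intro i; fin_cases i <;> assumption)
    (by rw [hcomb]; exact hu)
  exact ⟨S, 2, le_rfl, hS, hSC⟩

theorem theorem1p8 {d : ℕ} (Ω C : Set (RP d)) (Λ : Subgroup (PGLR d))
    (h : IsNaiveConvexCocompactTriple Ω C Λ) :
    List.TFAE [
      ∀ x ∈ closure C ∩ projBoundary Ω,
        coarseDim (openFace Ω x) (closure C ∩ openFace Ω x) = 0,
      ∀ x ∈ idealBoundary C,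
        coarseDim (openFace Ω x) (idealBoundary C ∩ openFace Ω x) = 0,
      ∃ R : ℝ, 0 < R ∧ ∀ x ∈ idealBoundary C,
        hilbertDiam (openFace Ω x) (idealBoundary C ∩ openFace Ω x) ≤ ENNReal.ofReal R,
      ¬ ∃ (S : Set (RP d)) (k : ℕ), 2 ≤ k ∧ IsProjSimplex S k ∧ IsProperlyEmbedded S C,
      IsGromovHyperbolic (fun x y : C => hilbertDist Ω x y),
      IsWordHyperbolic Λ] := by
  obtain ⟨K, L, φ, hM⟩ := exists_isConeModel h.domain h.subset h.nonempty h.closed h.convex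
  have hcoc := hM.isConeCocompact h
  tfae_have 1 ↔ 2 := by
    rw [hM.closure_inter_projBoundary h.domain.1]
    exact forall₂_congr fun x hx => by rw [hM.closure_inter_openFace hx]
  tfae_have 2 → 5 := fun h2 =>
    hM.isGromovHyperbolic hcoc fun x hx hxi => hM.coneNear_of_coarseDim_eq_zero h2 hx hxi
  tfae_have 5 → 4 := by
    rintro h5 ⟨S, k, hk, hS, hSC⟩
    exact hM.not_isGromovHyperbolic_of_isProperlyEmbedded hk hS hSC h5
  tfae_have 4 → 3 := fun h4 => by
    by_contra h3
    exact h4 (hM.exists_isProjSimplex hcoc h3)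
  tfae_have 3 → 2 := by
    rintro ⟨R, hR, h3⟩ x hx
    exact coarseDim_eq_zero_of_hilbertDiam_le hR.le hx (h3 x hx)
  tfae_have 5 ↔ 6 := hM.isGromovHyperbolic_iff_isWordHyperbolic h
  tfae_finish
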